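/- **Setting.** Let $\mathscr P$ be a poset and $\Bbbk$ a field. A finite $\mathscr P$-filtered graph $(G,f)$ consists of finite sets $V$ (vertices) and $E$ (edges), a map $E\to V\times V$, $e\mapsto(e_0,e_1)$ (loops and multiple edges are allowed), and grades $f(v),f(e)\in\mathscr P$ with $f(e_0)\le f(e)$ and $f(e_1)\le f(e)$ for all $e\in E$. Its size is $|G|=|V|+|E|$. A persistence module is a functor $\mathscr P\to\mathbf{Vec}_\Bbbk$. The persistence module $H_0(G,f;\Bbbk)$ is, at $r\in\mathscr P$, the cokernel of $\langle e: f(e)\le r\rangle_\Bbbk\to\langle v: f(v)\le r\rangle_\Bbbk$, $e\mapsto e_1-e_0$, with structure maps induced by inclusions. Let $\mathsf P_r$ be $\Bbbk$ at all $s\ge r$ (with identity structure maps) and $0$ elsewhere. A module $C\cong\bigoplus_{r}\mathsf P_r^{\beta^C(r)}$ with $\beta^C:\mathscr P\to\mathbb N$ finitely supported is called projective of finite rank. A projective cover of $M$ is a pointwise surjective morphism $C\to M$ with $C$ projective of finite rank and $\sum_r\beta^C(r)$ minimal. A minimal presentation of $M$ is a sequence $C_1\xrightarrow{\partial_1}C_0\xrightarrow{\partial_0}M$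 such that $\partial_0$ is a projective cover, $\partial_0\partial_1=0$, and the induced morphism $C_1\to\ker\partial_0$ is a projective cover. The $0$th and $1$st Betti tables of $M$ are $\beta_0(M)=\beta^{C_0}$ (for any projective cover $C_0\to M$) and $\beta_1(M)=\beta^{C_1}$ (for any minimal presentation). **Collapsing algorithms.** Both collapsing algorithms take a filtered graph $(V,E,\partial,f)$, start with $\varphi=\mathrm{id}_V$, $\mathrm{visited}=\emptyset$, $E'=E$, and use the following *search from $v$*: start with a stack holding $(v,\emptyset,v)$; while the stack is nonempty, pop $(v,e,u)$; if $u$ is not visited, mark it as visited, if $e\ne\emptyset$ set $\varphi[u]\leftarrow v$ and remove $e$ from $E'$, and then push $(v,e',x)$ for every admissible edge $e'\in E$ with $\{e'_0,e'_1\}=\{u,x\}$. At the end they return the graph with vertex set $V'=\{v\in V:\varphi[v]=v\}$, edge set $E'$, endpoint map $(\varphi\times\varphi)\circ\partial$ and grades $f$. * *Local collapse:* search from every $v\in V$, where $e'$ is admissible if $f(e')=f(x)=f(u)$. * *Vertex-minimal collapse:* first apply the local collapse; to its result, apply the search from every vertex $v$ for which there is no edge $e$ with $\{e_0,e_1\}=\{u,v\}$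 and $f(e)=f(v)>f(u)$, where $e'$ is admissible if $f(e')=f(x)>f(u)$. Return the resulting graph and the list $[f(v):v\in V']$. **Minimal presentation algorithm.** Apply the vertex-minimal collapse to obtain $(V',E',\partial',f)$. For each edge $e$ of this graph in turn, run a breadth-first search from $e_0$ on the graph with vertices $\{v\in V':f(v)\le f(e)\}$ and edges $\{d\in E':f(d)\le f(e)\}\setminus\{e\}$, and remove $e$ from $E'$ if $e_1$ is reached. Return the list $\beta_0$ of the grades of the vertices in $V'$, the list $\beta_1$ of the grades of the remaining edges, and the sparse matrix, a list of triples (row, column, value), that has for each remaining edge $e$ the entry $-1$ in the row of $e_0$ and the entry $1$ in the row of $e_1$, in the column of $e$. Running times are numbers of steps of these algorithms, implemented on a random access machine with adjacency lists, on which every elementary operation, including the comparison of two elements of $\mathscr P$, is one step. **Theorem.** Let $\mathscr P$ be any poset, and let $(G,f)$ be a finite $\mathscr P$-filtered graph. 1. The vertex-minimal collapse runs in $O(|G|)$ time, and the list of grades that it returns is the $0$th Betti table of $H_0(G,f;\Bbbk)$: each $r\in\mathscr P$ occurs in it exactly $\beta_0(H_0(G,f;\Bbbk))(r)$ times. 2.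 The minimal presentation algorithm runs in $O(|G|^2)$ time, and its output $(\beta_0,\beta_1,\text{matrix})$ is a minimal presentation of $H_0(G,f;\Bbbk)$: the morphism $\partial_1:\bigoplus_j\mathsf P_{\beta_1[j]}\to\bigoplus_i\mathsf P_{\beta_0[i]}$ with this matrix is the first morphism of a minimal presentation $C_1\xrightarrow{\partial_1} C_0\xrightarrow{\partial_0} H_0(G,f;\Bbbk)$. Hence the lists $\beta_0$ and $\beta_1$ are the $0$th and $1$st Betti tables of $H_0(G,f;\Bbbk)$. The constants in the $O$ are absolute: they do not depend on $\mathscr P$, $\Bbbk$ or $(G,f)$ (for the empty graph the running times are $O(1)$). -/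

import Mathlib

open CategoryTheory CategoryTheory.Limits

universe u v

/-! ## Filtered graphs, persistence modules and persistent homology in degree zero -/

/-- A `P`-filtered graph with vertex set `V` and edge set `E` (loops and multiple edges are
allowed): every edge `e` has an ordered pair of endpoints `(e₀, e₁)`, and vertices and edges have
grades in `P`, the grade of an edge being above the grades of its endpoints. -/
structure FilteredGraph (P : Type u) [PartialOrder P] (V E : Type) where
  /-- the endpoints `(e₀, e₁)` of an edge -/
  bd : E → V × V
  /-- the grade of a vertex -/
  gV : V → P
  /-- the grade of an edge -/
  gE : E → P
  fst_le : ∀ e, gV (bd e).1 ≤ gE e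
  snd_le : ∀ e, gV (bd e).2 ≤ gE e

/-- A `P`-persistence module over `k`: a functor from the poset `P` to `k`-vector spaces. -/
abbrev PersistenceModule (k : Type v) [Field k] (P : Type u) [PartialOrder P] :=
  P ⥤ ModuleCat.{v} k

namespace FilteredGraph

variable {P : Type u} [PartialOrder P] {V E : Type}

/-- The size `|G| = |V| + |E|`. -/
noncomputable def size (_G : FilteredGraph P V E) : ℕ := Nat.card V + Nat.card E

/-- The boundary map `⟨E_r⟩ → ⟨V_r⟩`, `e ↦ e₁ - e₀`, of the subgraph of the vertices and edges of
grade at most `r`. -/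
noncomputable def boundary (k : Type v) [Field k] (G : FilteredGraph P V E) (r : P) :
    ({e : E // G.gE e ≤ r} →₀ k) →ₗ[k] ({x : V // G.gV x ≤ r} →₀ k) :=
  Finsupp.linearCombination k fun e =>
    Finsupp.single ⟨(G.bd e.1).2, (G.snd_le e.1).trans e.2⟩ 1 -
      Finsupp.single ⟨(G.bd e.1).1, (G.fst_le e.1).trans e.2⟩ 1

/-- The inclusion `⟨V_r⟩ → ⟨V_s⟩` for `r ≤ s`. -/
noncomputable def vertexMap (k : Type v) [Field k] (G : FilteredGraph P V E) {r s : P}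
    (h : r ≤ s) : ({x : V // G.gV x ≤ r} →₀ k) →ₗ[k] ({x : V // G.gV x ≤ s} →₀ k) :=
  Finsupp.lmapDomain k k fun x => ⟨x.1, x.2.trans h⟩

theorem range_boundary_le (k : Type v) [Field k] (G : FilteredGraph P V E) {r s : P}
    (h : r ≤ s) :
    LinearMap.range (G.boundary k r) ≤
      (LinearMap.range (G.boundary k s)).comap (G.vertexMap k h) := by
  rintro _ ⟨c, rfl⟩
  induction c using Finsupp.induction_linear with
  | zero => simp
  | add a b ha hb => rw [map_add]; exact Submodule.add_mem _ ha hb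
  | single e a =>
    refine ⟨Finsupp.single ⟨e.1, e.2.trans h⟩ a, ?_⟩
    rw [boundary, boundary, Finsupp.linearCombination_single, Finsupp.linearCombination_single,
      map_smul, map_sub]
    simp [vertexMap, Finsupp.mapDomain_single]

/-- The persistence module `H₀(G, f; k)`: at `r` it is the cokernel of the boundary map of the
subgraph of the vertices and edges of grade at most `r`; its structure maps are induced by the
inclusions. -/
noncomputable def H0 (k : Type v) [Field k] (G : FilteredGraph P V E) :
    PersistenceModule k P where
  obj r := ModuleCat.of k (({x : V // G.gV x ≤ r} →₀ k) ⧸ LinearMap.range (G.boundary k r))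
  map {_ _} h := ModuleCat.ofHom
    (Submodule.mapQ _ _ (G.vertexMap k (leOfHom h)) (G.range_boundary_le k (leOfHom h)))
  map_id r := by
    ext x
    simp [vertexMap]
  map_comp f g := by
    ext x
    simp [vertexMap, Finsupp.mapDomain_single]

end FilteredGraph

section Resolutions

variable {k : Type v} [Field k] {P : Type u} [PartialOrder P]

/-- The direct sum `⨁ i, P_{g i}`, where `P_r` is the persistence module that is `k` at the
elements `≥ r` and `0` elsewhere, with identities as structure maps `k → k`. At `r` it is the
vector space with basis `{i | g i ≤ r}`. -/
noncomputable def freeModule (k : Type v) [Field k] {I : Type} (g : I → P) :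
    PersistenceModule k P where
  obj r := ModuleCat.of k ({i : I // g i ≤ r} →₀ k)
  map {_ _} h := ModuleCat.ofHom
    (Finsupp.lmapDomain k k fun i => ⟨i.1, i.2.trans (leOfHom h)⟩)
  map_id r := by
    ext x
    simp
  map_comp f g := by
    ext x
    simp [Finsupp.mapDomain_single]

/-- The function `P → ℕ` that counts how often each grade occurs in a family. -/
noncomputable def gradeCount {I : Type} (g : I → P) : P → ℕ :=
  fun r => Nat.card {i : I // g i = r}

/-- `C` is projective of finite rank, with Betti table `β`: it is a finite direct sum of modules
`P_r`, where `P_r` occurs `β r` times. -/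
def IsFreeWithTable (C : PersistenceModule k P) (β : P → ℕ) : Prop :=
  ∃ (l : ℕ) (g : Fin l → P), Nonempty (C ≅ freeModule k g) ∧ gradeCount g = β

/-- Surjectivity of a morphism of persistence modules. -/
def IsSurjective {M N : PersistenceModule k P} (π : M ⟶ N) : Prop :=
  ∀ r, Function.Surjective (π.app r).hom

/-- `π : C → M` is a finite projective cover: it is surjective, `C` is projective of finite rank,
and the rank `∑ r, β^C r` is minimal among all such surjections. -/
def IsProjectiveCover {C M : PersistenceModule k P} (π : C ⟶ M) : Prop :=
  IsSurjective π ∧ ∃ β, IsFreeWithTable C β ∧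
    ∀ (C' : PersistenceModule k P) (π' : C' ⟶ M) (β' : P → ℕ),
      IsSurjective π' → IsFreeWithTable C' β' → ∑ᶠ r, β r ≤ ∑ᶠ r, β' r

/-- `C₁ → C₀ → M` is a minimal projective presentation: `C₀ → M` is a finite projective cover,
the composite is zero, and `C₁ → ker (C₀ → M)` is a finite projective cover. -/
def IsMinimalPresentation {C₁ C₀ M : PersistenceModule k P} (d₁ : C₁ ⟶ C₀) (d₀ : C₀ ⟶ M) :
    Prop :=
  IsProjectiveCover d₀ ∧ ∃ w : d₁ ≫ d₀ = 0, IsProjectiveCover (kernel.lift d₀ d₁ w)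

/-- `β` is the zeroth Betti table of `M`: projective covers `C → M` exist, and the Betti table of
`C` is `β` for each of them. -/
def IsBettiZero (M : PersistenceModule k P) (β : P → ℕ) : Prop :=
  (∃ (C : PersistenceModule k P) (π : C ⟶ M), IsProjectiveCover π) ∧
    ∀ (C : PersistenceModule k P) (π : C ⟶ M), IsProjectiveCover π → IsFreeWithTable C β

/-- `β` is the first Betti table of `M`: minimal presentations `C₁ → C₀ → M` exist, and the Betti
table of `C₁` is `β` for each of them. -/
def IsBettiOne (M : PersistenceModule k P) (β : P → ℕ) : Prop :=
  (∃ (C₁ C₀ : PersistenceModule k P) (d₁ : C₁ ⟶ C₀) (d₀ : C₀ ⟶ M),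
      IsMinimalPresentation d₁ d₀) ∧
    ∀ (C₁ C₀ : PersistenceModule k P) (d₁ : C₁ ⟶ C₀) (d₀ : C₀ ⟶ M),
      IsMinimalPresentation d₁ d₀ → IsFreeWithTable C₁ β

/-- The coefficient of the `i`th basis element in the image of the `j`th basis element under the
component at `r` of a morphism between direct sums of modules `P_r`. -/
noncomputable def coefficient {I J : Type} {g₀ : I → P} {g₁ : J → P}
    (d : freeModule k g₁ ⟶ freeModule k g₀) (r : P) (i : I) (hi : g₀ i ≤ r)
    (j : J) (hj : g₁ j ≤ r) : k :=
  let y : {i : I // g₀ i ≤ r} →₀ k :=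
    (d.app r).hom (Finsupp.single (⟨j, hj⟩ : {j : J // g₁ j ≤ r}) (1 : k))
  y ⟨i, hi⟩

/-- `d` is the morphism with matrix `A`: it sends the `j`th generator to the combination of the
generators of the target with the coefficients of column `j`. -/
def HasMatrix {I J : Type} {g₀ : I → P} {g₁ : J → P}
    (d : freeModule k g₁ ⟶ freeModule k g₀) (A : Matrix I J k) : Prop :=
  ∀ i j, (A i j ≠ 0 → g₀ i ≤ g₁ j) ∧
    ∀ (r : P) (hi : g₀ i ≤ r) (hj : g₁ j ≤ r), coefficient d r i hi j hj = A i j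

/-- The list `L` of triples `(row, column, value)`, with rows and columns numbered from one, is
the matrix `A` in coordinate format: every position occurs at most once in `L`, every triple of
`L` gives the entry of `A` at its position, and the entries at the other positions are zero. -/
def IsCoordinateFormat {a b : ℕ} (L : List (ℕ × ℕ × ℤ)) (A : Matrix (Fin a) (Fin b) k) : Prop :=
  (L.map fun t => (t.1, t.2.1)).Nodup ∧
    (∀ t ∈ L, ∃ (i : Fin a) (j : Fin b),
      t.1 = i.val + 1 ∧ t.2.1 = j.val + 1 ∧ A i j = (t.2.2 : k)) ∧
    ∀ i j, A i j ≠ 0 → ∃ x, (i.val + 1, j.val + 1, x) ∈ L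

/-- The lists `β₀`, `β₁` of grades and the list `L` of triples form a minimal presentation of `M`:
`L` is a matrix in coordinate format whose `i`th row stands for the `i`th entry of `β₀` and whose
`j`th column stands for the `j`th entry of `β₁`, and the morphism with this matrix is a minimal
presentation of `M`. -/
def EncodesMinimalPresentation (M : PersistenceModule k P) (β₀ β₁ : List P)
    (L : List (ℕ × ℕ × ℤ)) : Prop :=
  ∃ (A : Matrix (Fin β₀.length) (Fin β₁.length) k)
    (d₁ : freeModule k β₁.get ⟶ freeModule k β₀.get) (d₀ : freeModule k β₀.get ⟶ M),
    IsCoordinateFormat L A ∧ HasMatrix d₁ A ∧ IsMinimalPresentation d₁ d₀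

end Resolutions

/-! ## A random access machine with grades

The machine has finitely many registers and finitely many arrays of natural numbers, finitely many
lists of grades (elements of the poset), whose entries can only be read, compared with `≤`, and
appended, and one list of triples, to which it can append. Every operation, in particular every
comparison of two grades, costs one step. -/

namespace RAM

/-- Names of registers; `n` and `m` hold the numbers of vertices and edges of the input. -/
inductive Reg
  | n | m | i | j | v | e | u | x | p | fresh | sp | flag | qfront | qback
  deriving DecidableEq

/-- Names of arrays of numbers. -/
inductive Arr
  -- the current graph: membership of vertices and edges, endpoints of edges
  | verts | edges | src | tgt
  -- the working copy of the set of edges, and the dictionaries and sets of the searches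
  | newEdges | phi | visited
  -- linked lists of incident edges
  | head | next | ptrEdge | ptrVert
  -- the stack (of triples) and the queue
  | stackV | stackE | stackU | queue
  -- vertices and edges at most a given grade, and row numbers
  | lowVerts | lowEdges | rowIdx
  deriving DecidableEq

/-- Names of lists of grades: the grades of the vertices and of the edges of the input, the output
list of the vertex-minimal collapse, and the two output lists of the presentation algorithm. -/
inductive GList
  | vGrade | eGrade | reducedBeta | beta0 | beta1
  deriving DecidableEq

/-- States of the machine. -/
structure State (P : Type u) where
  reg : Reg → ℕ
  arr : Arr → ℕ → ℕ
  grades : GList → List P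
  triples : List (ℕ × ℕ × ℤ)

/-- Change the content of a register. -/
def State.setReg {P : Type u} (s : State P) (r : Reg) (x : ℕ) : State P :=
  { s with reg := Function.update s.reg r x }

/-- Change one entry of an array. -/
def State.setArr {P : Type u} (s : State P) (a : Arr) (i x : ℕ) : State P :=
  { s with arr := Function.update s.arr a (Function.update (s.arr a) i x) }

/-- Change a list of grades. -/
def State.setGrades {P : Type u} (s : State P) (l : GList) (x : List P) : State P :=
  { s with grades := Function.update s.grades l x }

/-- Numerical expressions. -/
inductive Expr
  | const (c : ℕ)
  | reg (r : Reg)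
  | arr (a : Arr) (i : Expr)
  | length (l : GList)
  | add (a b : Expr)
  | sub (a b : Expr)

/-- Conditions; `gle l i l' j` says that entry `i` of the list `l` of grades is at most entry `j`
of the list `l'`. -/
inductive Cond
  | eq (a b : Expr)
  | lt (a b : Expr)
  | gle (l : GList) (i : Expr) (l' : GList) (j : Expr)
  | neg (c : Cond)
  | conj (c d : Cond)

/-- Programs. -/
inductive Cmd
  | skip
  | assign (r : Reg) (a : Expr)
  | store (a : Arr) (i b : Expr)
  /-- make a list of grades empty -/
  | clear (l : GList)
  /-- append entry `i` of the list `l'` of grades to the list `l` -/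
  | append (l : GList) (l' : GList) (i : Expr)
  /-- make the list of triples empty -/
  | clearTriples
  /-- append a triple to the list of triples -/
  | appendTriple (a b : Expr) (z : ℤ)
  | seq (c d : Cmd)
  | branch (c : Cond) (a b : Cmd)
  | loop (c : Cond) (a : Cmd)

infixr:60 " ;; " => Cmd.seq

section Semantics

variable {P : Type u} [PartialOrder P]

/-- The value of an expression. -/
def Expr.eval (s : State P) : Expr → ℕ
  | const c => c
  | reg r => s.reg r
  | arr a i => s.arr a (i.eval s)
  | length l => (s.grades l).length
  | add a b => a.eval s + b.eval s
  | sub a b => a.eval s - b.eval s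

/-- The number of operations in an expression. -/
def Expr.cost : Expr → ℕ
  | const _ => 1
  | reg _ => 1
  | arr _ i => i.cost + 1
  | length _ => 1
  | add a b => a.cost + b.cost + 1
  | sub a b => a.cost + b.cost + 1

/-- The truth of a condition. -/
def Cond.Holds (s : State P) : Cond → Prop
  | eq a b => a.eval s = b.eval s
  | lt a b => a.eval s < b.eval s
  | gle l i l' j => ∃ p ∈ (s.grades l)[i.eval s]?, ∃ q ∈ (s.grades l')[j.eval s]?, p ≤ q
  | neg c => ¬ c.Holds s
  | conj c d => c.Holds s ∧ d.Holds s

/-- The number of operations in a condition. -/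
def Cond.cost : Cond → ℕ
  | eq a b => a.cost + b.cost + 1
  | lt a b => a.cost + b.cost + 1
  | gle _ i _ j => i.cost + j.cost + 1
  | neg c => c.cost + 1
  | conj c d => c.cost + d.cost + 1

/-- `Exec c s s' t`: started in state `s`, the program `c` halts in state `s'` after `t` steps.
(A program that tries to append a nonexistent grade gets stuck.) -/
inductive Exec : Cmd → State P → State P → ℕ → Prop
  | skip (s : State P) : Exec .skip s s 1
  | assign (s : State P) (r : Reg) (a : Expr) :
      Exec (.assign r a) s (s.setReg r (a.eval s)) (a.cost + 1)
  | store (s : State P) (a : Arr) (i b : Expr) :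
      Exec (.store a i b) s (s.setArr a (i.eval s) (b.eval s)) (i.cost + b.cost + 1)
  | clear (s : State P) (l : GList) :
      Exec (.clear l) s (s.setGrades l []) 1
  | append (s : State P) (l l' : GList) (i : Expr) (p : P) :
      (s.grades l')[i.eval s]? = some p →
      Exec (.append l l' i) s (s.setGrades l (s.grades l ++ [p])) (i.cost + 1)
  | clearTriples (s : State P) : Exec .clearTriples s { s with triples := [] } 1
  | appendTriple (s : State P) (a b : Expr) (z : ℤ) :
      Exec (.appendTriple a b z) s
        { s with triples := s.triples ++ [(a.eval s, b.eval s, z)] } (a.cost + b.cost + 1)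
  | seq {c d : Cmd} {s s₁ s₂ : State P} {t₁ t₂ : ℕ} :
      Exec c s s₁ t₁ → Exec d s₁ s₂ t₂ → Exec (c ;; d) s s₂ (t₁ + t₂)
  | branchTrue {c : Cond} {a b : Cmd} {s s' : State P} {t : ℕ} :
      c.Holds s → Exec a s s' t → Exec (.branch c a b) s s' (c.cost + t)
  | branchFalse {c : Cond} {a b : Cmd} {s s' : State P} {t : ℕ} :
      ¬ c.Holds s → Exec b s s' t → Exec (.branch c a b) s s' (c.cost + t)
  | loopTrue {c : Cond} {a : Cmd} {s s₁ s₂ : State P} {t₁ t₂ : ℕ} :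
      c.Holds s → Exec a s s₁ t₁ → Exec (.loop c a) s₁ s₂ t₂ →
      Exec (.loop c a) s s₂ (c.cost + t₁ + t₂)
  | loopFalse {c : Cond} {a : Cmd} {s : State P} :
      ¬ c.Holds s → Exec (.loop c a) s s c.cost

/-- The machine is deterministic: the final state and the number of steps are unique. -/
theorem Exec.deterministic {c : Cmd} {s s₁ s₂ : State P} {t₁ t₂ : ℕ}
    (h₁ : Exec c s s₁ t₁) (h₂ : Exec c s s₂ t₂) : s₁ = s₂ ∧ t₁ = t₂ := by
  induction h₁ generalizing s₂ t₂ with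
  | seq _ _ ih ih' =>
    cases h₂ with
    | seq a b => obtain ⟨rfl, rfl⟩ := ih a; obtain ⟨rfl, rfl⟩ := ih' b; exact ⟨rfl, rfl⟩
  | loopTrue h _ _ ih ih' =>
    cases h₂ with
    | loopTrue _ a b => obtain ⟨rfl, rfl⟩ := ih a; obtain ⟨rfl, rfl⟩ := ih' b; exact ⟨rfl, rfl⟩
    | loopFalse h' => exact absurd h h'
  | _ => cases h₂ <;> grind

/-- The initial state for a filtered graph whose vertices and edges are listed in some order: the
registers `n`, `m`, the arrays of endpoints and the lists of grades hold the input; all other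
registers and array entries are zero, and all other lists are empty. -/
def inputState {V E : Type} {n m : ℕ} (G : FilteredGraph P V E) (eV : Fin n ≃ V)
    (eE : Fin m ≃ E) : State P where
  reg
    | .n => n
    | .m => m
    | _ => 0
  arr
    | .src => fun i => if h : i < m then (eV.symm (G.bd (eE ⟨i, h⟩)).1).val else 0
    | .tgt => fun i => if h : i < m then (eV.symm (G.bd (eE ⟨i, h⟩)).2).val else 0
    | _ => fun _ => 0
  grades
    | .vGrade => List.ofFn fun i => G.gV (eV i)
    | .eGrade => List.ofFn fun i => G.gE (eE i)
    | _ => []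
  triples := []

end Semantics

/-! ## The algorithms -/

open RAM.Cmd RAM.Expr RAM.Cond

/-- `for r = 0, …, bound - 1 do body`. -/
def forTo (r : Reg) (bound : Expr) (body : Cmd) : Cmd :=
  assign r (const 0) ;;
  loop (lt (reg r) bound) (body ;; assign r (add (reg r) (const 1)))

/-- `if c then body`. -/
def when (c : Cond) (body : Cmd) : Cmd := branch c body skip

/-- The entry of a membership array says that the element belongs to the set. -/
def mem (a : Arr) (i : Expr) : Cond := eq (arr a i) (const 1)

/-- Equality of two grades. -/
def geq (l : GList) (i : Expr) (l' : GList) (j : Expr) : Cond :=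
  conj (gle l i l' j) (gle l' j l i)

/-- Strict inequality of two grades. -/
def glt (l : GList) (i : Expr) (l' : GList) (j : Expr) : Cond :=
  conj (gle l i l' j) (neg (gle l' j l i))

/-- Put edge `e`, leading to the vertex `b`, in front of the incidence list of the vertex `a`. -/
def link (a e b : Expr) : Cmd :=
  assign .fresh (add (reg .fresh) (const 1)) ;;
  store .ptrEdge (reg .fresh) e ;;
  store .ptrVert (reg .fresh) b ;;
  store .next (reg .fresh) (arr .head a) ;;
  store .head a (reg .fresh)

/-- Build linked lists of the edges of a given set of edges that are incident to each vertex. -/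
def buildIncidence (edgeSet : Arr) : Cmd :=
  assign .fresh (const 0) ;;
  forTo .j (reg .n) (store .head (reg .j) (const 0)) ;;
  forTo .j (reg .m) (when (mem edgeSet (reg .j))
    (link (arr .src (reg .j)) (reg .j) (arr .tgt (reg .j)) ;;
      when (neg (eq (arr .src (reg .j)) (arr .tgt (reg .j))))
        (link (arr .tgt (reg .j)) (reg .j) (arr .src (reg .j)))))

/-- `for every edge e of the incidence lists with {e₀, e₁} = {u, x} do body`. -/
def forIncident (body : Cmd) : Cmd :=
  assign .p (arr .head (reg .u)) ;;
  loop (neg (eq (reg .p) (const 0)))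
    (assign .e (arr .ptrEdge (reg .p)) ;;
      assign .x (arr .ptrVert (reg .p)) ;;
      body ;;
      assign .p (arr .next (reg .p)))

/-- Push a triple (root, edge, vertex) onto the stack. The absence of an edge is coded by `m`. -/
def push (a b c : Expr) : Cmd :=
  store .stackV (reg .sp) a ;;
  store .stackE (reg .sp) b ;;
  store .stackU (reg .sp) c ;;
  assign .sp (add (reg .sp) (const 1))

/-- `(v, e, u) ← stack.pop()`. -/
def pop : Cmd :=
  assign .sp (sub (reg .sp) (const 1)) ;;
  assign .v (arr .stackV (reg .sp)) ;;
  assign .e (arr .stackE (reg .sp)) ;;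
  assign .u (arr .stackU (reg .sp))

/-- The depth-first search of the two collapsing algorithms from the vertex `v`, along the edges `e` from `u`
to `x` that satisfy the condition `admissible`. -/
def search (admissible : Cond) : Cmd :=
  assign .sp (const 0) ;;
  push (reg .v) (reg .m) (reg .v) ;;
  loop (lt (const 0) (reg .sp))
    (pop ;;
      when (eq (arr .visited (reg .u)) (const 0))
        (store .visited (reg .u) (const 1) ;;
          when (neg (eq (reg .e) (reg .m)))
            (store .phi (reg .u) (reg .v) ;; store .newEdges (reg .e) (const 0)) ;;
          forIncident (when admissible (push (reg .v) (reg .e) (reg .x)))))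

/-- The initializations common to the two collapsing algorithms: `φ` is the identity, `visited` is empty,
`E' ← E`; also build the incidence lists of the current graph. -/
def prepare : Cmd :=
  forTo .i (reg .n) (store .phi (reg .i) (reg .i)) ;;
  forTo .i (reg .n) (store .visited (reg .i) (const 0)) ;;
  forTo .i (reg .m) (store .newEdges (reg .i) (arr .edges (reg .i))) ;;
  buildIncidence .edges

/-- Replace the current graph `(V, E, ∂)` by `({v ∈ V | φ[v] = v}, E', (φ × φ) ∘ ∂)`. -/
def contract : Cmd :=
  forTo .i (reg .n)
    (when (neg (eq (arr .phi (reg .i)) (reg .i))) (store .verts (reg .i) (const 0))) ;;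
  forTo .i (reg .m)
    (store .edges (reg .i) (arr .newEdges (reg .i)) ;;
      store .src (reg .i) (arr .phi (arr .src (reg .i))) ;;
      store .tgt (reg .i) (arr .phi (arr .tgt (reg .i))))

/-- Local collapse: collapse the local collapsible edges of the current graph. -/
def localCollapse : Cmd :=
  prepare ;;
  forTo .i (reg .n) (when (mem .verts (reg .i))
    (assign .v (reg .i) ;;
      -- f(e) = f(x) = f(u)
      search (conj (geq .eGrade (reg .e) .vGrade (reg .x))
        (geq .vGrade (reg .x) .vGrade (reg .u))))) ;;
  contract

/-- Vertex-minimal collapse: collapse the input to a vertex-minimal filtered graph, which becomes the current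
graph, and return the list of the grades of its vertices (in `GList.reducedBeta`). -/
def vertexCollapse : Cmd :=
  -- the current graph is the input
  forTo .i (reg .n) (store .verts (reg .i) (const 1)) ;;
  forTo .i (reg .m) (store .edges (reg .i) (const 1)) ;;
  localCollapse ;;
  prepare ;;
  forTo .i (reg .n) (when (mem .verts (reg .i))
    (assign .v (reg .i) ;;
      -- is there an edge e from v to x with f(e) = f(v) > f(x)?
      assign .u (reg .v) ;;
      assign .flag (const 0) ;;
      forIncident (when (conj (geq .eGrade (reg .e) .vGrade (reg .v))
        (glt .vGrade (reg .x) .vGrade (reg .v))) (assign .flag (const 1))) ;;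
      -- if not, search from v along the edges e from u to x with f(e) = f(x) > f(u)
      when (eq (reg .flag) (const 0))
        (search (conj (geq .eGrade (reg .e) .vGrade (reg .x))
          (glt .vGrade (reg .u) .vGrade (reg .x)))))) ;;
  contract ;;
  clear .reducedBeta ;;
  forTo .i (reg .n) (when (mem .verts (reg .i)) (append .reducedBeta .vGrade (reg .i)))

/-- Breadth-first search from the first endpoint of edge `i` on the graph with vertex set
`lowVerts` and edge set `lowEdges`; the vertices that are reached are marked as visited. -/
def breadthFirst : Cmd :=
  buildIncidence .lowEdges ;;
  forTo .j (reg .n) (store .visited (reg .j) (const 0)) ;;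
  store .visited (arr .src (reg .i)) (const 1) ;;
  store .queue (const 0) (arr .src (reg .i)) ;;
  assign .qfront (const 0) ;;
  assign .qback (const 1) ;;
  loop (lt (reg .qfront) (reg .qback))
    (assign .u (arr .queue (reg .qfront)) ;;
      assign .qfront (add (reg .qfront) (const 1)) ;;
      forIncident (when (conj (mem .lowVerts (reg .x)) (eq (arr .visited (reg .x)) (const 0)))
        (store .visited (reg .x) (const 1) ;;
          store .queue (reg .qback) (reg .x) ;;
          assign .qback (add (reg .qback) (const 1)))))

/-- Minimal presentation algorithm: collapse, delete every deletable edge (an edge `e` whose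
endpoints are connected by the other remaining edges of grade at most `f(e)`), and read off the
presentation by the vertices and edges that remain. The output consists of the lists `GList.beta0`,
`GList.beta1` and of the list of triples. -/
def presentation : Cmd :=
  clear .beta0 ;;
  clear .beta1 ;;
  clearTriples ;;
  vertexCollapse ;;
  forTo .i (reg .m) (when (mem .edges (reg .i))
    -- the vertices of grade at most f(i), and the other edges of grade at most f(i)
    (forTo .j (reg .n) (branch
        (conj (mem .verts (reg .j)) (gle .vGrade (reg .j) .eGrade (reg .i)))
        (store .lowVerts (reg .j) (const 1)) (store .lowVerts (reg .j) (const 0))) ;;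
      forTo .j (reg .m) (branch
        (conj (conj (mem .edges (reg .j)) (gle .eGrade (reg .j) .eGrade (reg .i)))
          (neg (eq (reg .j) (reg .i))))
        (store .lowEdges (reg .j) (const 1)) (store .lowEdges (reg .j) (const 0))) ;;
      breadthFirst ;;
      -- delete the edge if its endpoints are connected
      when (mem .visited (arr .tgt (reg .i))) (store .edges (reg .i) (const 0)))) ;;
  forTo .i (reg .n) (when (mem .verts (reg .i))
    (append .beta0 .vGrade (reg .i) ;;
      store .rowIdx (reg .i) (length .beta0))) ;;
  forTo .i (reg .m) (when (mem .edges (reg .i))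
    (append .beta1 .eGrade (reg .i) ;;
      appendTriple (arr .rowIdx (arr .src (reg .i))) (length .beta1) (-1) ;;
      appendTriple (arr .rowIdx (arr .tgt (reg .i))) (length .beta1) 1))

end RAM

/-!
The theorem is about three things: the algorithms are fast, they preserve homology, and what they
leave over is minimal.

*Minimality.* A surjection `π` from a free module is a projective cover as soon as its kernel lies
in the radical, i.e. no element of the kernel at the grade `r` involves a generator of grade `r`
(`HasRadicalKernel.isBettiZero`): modulo the images from smaller grades, the generators of grade `r`
are then independent in the target, so that every other surjection from a free module needs at least
as many of them. Free modules are projective, and two covers differ by an isomorphism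
(`HasRadicalKernel.exists_isIso`); so a pointwise exact sequence `C₁ → C₀ → M` of free modules in
which both maps have kernels in the radical is a minimal presentation, and it determines the first
Betti table (`HasRadicalKernel.minimalPresentation`).

*Homology.* The collapse maps every vertex `u` to a representative `φ u` of smaller or equal grade
that is connected to `u` at the grade of `u`. So the representatives generate `H₀`, and the kernel
of this cover is spanned by the differences of the representatives of the endpoints of edges
(`FilteredGraph.IsReduction.appHom_cover_eq_zero`). An edge that is not contracted has a larger
grade than the representatives of its endpoints, so this kernel lies in the radical. The deletion of
edges keeps the components at every grade, so the remaining edges still span the kernel; and no remaining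
edge `j` joins vertices that the other ones of smaller or equal grade connect. Then the linear form
that adds up the coefficients of the component of one endpoint of `j` vanishes on all boundaries of
these edges but that of `j`, so a relation between boundaries at the grade of `j` does not involve
`j`. This is the radical condition for the second map
(`FilteredGraph.IsReduction.minimalPresentation`).

*The algorithms.* Programs are treated by a logic of total correctness with time: `Runs c s Q` says
that `c` halts and that the final state and the number of steps satisfy `Q`. The time spent so far
is a parameter of loop invariants, and bounds for it also give termination (`Runs.loop`). For the
searches the amortized analysis is a potential: an unvisited vertex carries credit in proportion to
the length of its incidence list, which is spent when it is visited, once in a whole collapse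
(`potential`, `runs_search`). The local collapse contracts the edges that have the grade of both
endpoints; after that, the vertices with an edge of their own grade to a vertex of smaller grade are
superfluous as generators, and by induction on the grade each of them lies in the search tree of a
vertex without such an edge (`runs_collapseFromMinimal`). Each deletion test is one breadth-first
search, which gives the quadratic bound (`runs_deleteEdges`).
-/

/-! ### Reasoning about programs of the machine -/

namespace RAM

section Logic

variable {P : Type u}

@[simp] theorem State.setReg_reg (s : State P) (r r' : Reg) (x : ℕ) :
    (s.setReg r x).reg r' = if r' = r then x else s.reg r' := by
  simp [State.setReg, Function.update_apply]

@[simp] theorem State.setReg_arr (s : State P) (r : Reg) (x : ℕ) :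
    (s.setReg r x).arr = s.arr := rfl

@[simp] theorem State.setReg_grades (s : State P) (r : Reg) (x : ℕ) :
    (s.setReg r x).grades = s.grades := rfl

@[simp] theorem State.setReg_triples (s : State P) (r : Reg) (x : ℕ) :
    (s.setReg r x).triples = s.triples := rfl

@[simp] theorem State.setArr_reg (s : State P) (a : Arr) (i x : ℕ) :
    (s.setArr a i x).reg = s.reg := rfl

@[simp] theorem State.setArr_arr (s : State P) (a a' : Arr) (i x : ℕ) :
    (s.setArr a i x).arr a' = if a' = a then Function.update (s.arr a) i x else s.arr a' := by
  simp [State.setArr, Function.update_apply]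

@[simp] theorem State.setArr_grades (s : State P) (a : Arr) (i x : ℕ) :
    (s.setArr a i x).grades = s.grades := rfl

@[simp] theorem State.setGrades_reg (s : State P) (l : GList) (x : List P) :
    (s.setGrades l x).reg = s.reg := rfl

@[simp] theorem State.setGrades_arr (s : State P) (l : GList) (x : List P) :
    (s.setGrades l x).arr = s.arr := rfl

@[simp] theorem State.setGrades_grades (s : State P) (l l' : GList) (x : List P) :
    (s.setGrades l x).grades l' = if l' = l then x else s.grades l' := by
  simp [State.setGrades, Function.update_apply]

@[simp] theorem State.setGrades_triples (s : State P) (l : GList) (x : List P) :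
    (s.setGrades l x).triples = s.triples := rfl

/-- Whether a program contains an assignment to the register `r`. -/
def Cmd.writesReg (r : Reg) : Cmd → Bool
  | .assign r' _ => r = r'
  | .seq c d => c.writesReg r || d.writesReg r
  | .branch _ a b => a.writesReg r || b.writesReg r
  | .loop _ a => a.writesReg r
  | _ => false

/-- Whether a program contains a command that stores to the array `x`. -/
def Cmd.writesArr (x : Arr) : Cmd → Bool
  | .store x' _ _ => x = x'
  | .seq c d => c.writesArr x || d.writesArr x
  | .branch _ a b => a.writesArr x || b.writesArr x
  | .loop _ a => a.writesArr x
  | _ => false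

/-- Whether a program contains a command that changes the list `l` of grades. -/
def Cmd.writesGrades (l : GList) : Cmd → Bool
  | .clear l' => l = l'
  | .append l' _ _ => l = l'
  | .seq c d => c.writesGrades l || d.writesGrades l
  | .branch _ a b => a.writesGrades l || b.writesGrades l
  | .loop _ a => a.writesGrades l
  | _ => false

/-- Whether a program contains a command that changes the list of triples. -/
def Cmd.writesTriples : Cmd → Bool
  | .clearTriples => true
  | .appendTriple _ _ _ => true
  | .seq c d => c.writesTriples || d.writesTriples
  | .branch _ a b => a.writesTriples || b.writesTriples
  | .loop _ a => a.writesTriples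
  | _ => false

/-- The states `s` and `s'` agree on the registers, arrays and lists that the program `c` does not
mention as targets. This spares the invariants of loops all clauses about unchanged data. -/
structure Frame (c : Cmd) (s s' : State P) : Prop where
  reg : ∀ r, c.writesReg r = false → s'.reg r = s.reg r
  arr : ∀ a, c.writesArr a = false → s'.arr a = s.arr a
  grades : ∀ l, c.writesGrades l = false → s'.grades l = s.grades l
  triples : c.writesTriples = false → s'.triples = s.triples

theorem Frame.refl (c : Cmd) (s : State P) : Frame c s s :=
  ⟨fun _ _ => rfl, fun _ _ => rfl, fun _ _ => rfl, fun _ => rfl⟩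

theorem Frame.trans {c : Cmd} {s s₁ s₂ : State P} (h : Frame c s s₁) (h' : Frame c s₁ s₂) :
    Frame c s s₂ :=
  ⟨fun r hr => (h'.reg r hr).trans (h.reg r hr), fun r hr => (h'.arr r hr).trans (h.arr r hr),
    fun r hr => (h'.grades r hr).trans (h.grades r hr),
    fun hr => (h'.triples hr).trans (h.triples hr)⟩

theorem Frame.weaken {c d : Cmd} {s s' : State P} (h : Frame c s s')
    (hr : ∀ r, d.writesReg r = false → c.writesReg r = false)
    (ha : ∀ r, d.writesArr r = false → c.writesArr r = false)
    (hl : ∀ r, d.writesGrades r = false → c.writesGrades r = false)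
    (ht : d.writesTriples = false → c.writesTriples = false) : Frame d s s' :=
  ⟨fun r h' => h.reg r (hr r h'), fun r h' => h.arr r (ha r h'),
    fun r h' => h.grades r (hl r h'), fun h' => h.triples (ht h')⟩

variable [PartialOrder P]

/-- Total correctness with time: started in `s`, the program `c` halts, and its final state and
its number of steps satisfy `Q`. -/
def Runs (c : Cmd) (s : State P) (Q : State P → ℕ → Prop) : Prop :=
  ∃ s' t, Exec c s s' t ∧ Q s' t

theorem runs_skip (s : State P) (Q : State P → ℕ → Prop) : Runs .skip s Q ↔ Q s 1 :=
  ⟨fun ⟨_, _, h, q⟩ => by cases h; exact q, fun q => ⟨_, _, .skip s, q⟩⟩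

theorem runs_assign (s : State P) (r : Reg) (a : Expr) (Q : State P → ℕ → Prop) :
    Runs (.assign r a) s Q ↔ Q (s.setReg r (a.eval s)) (a.cost + 1) :=
  ⟨fun ⟨_, _, h, q⟩ => by cases h; exact q, fun q => ⟨_, _, .assign s r a, q⟩⟩

theorem runs_store (s : State P) (a : Arr) (i b : Expr) (Q : State P → ℕ → Prop) :
    Runs (.store a i b) s Q ↔ Q (s.setArr a (i.eval s) (b.eval s)) (i.cost + b.cost + 1) :=
  ⟨fun ⟨_, _, h, q⟩ => by cases h; exact q, fun q => ⟨_, _, .store s a i b, q⟩⟩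

theorem runs_clear (s : State P) (l : GList) (Q : State P → ℕ → Prop) :
    Runs (.clear l) s Q ↔ Q (s.setGrades l []) 1 :=
  ⟨fun ⟨_, _, h, q⟩ => by cases h; exact q, fun q => ⟨_, _, .clear s l, q⟩⟩

theorem runs_append (s : State P) (l l' : GList) (i : Expr) (Q : State P → ℕ → Prop) :
    Runs (.append l l' i) s Q ↔
      ∃ p, (s.grades l')[i.eval s]? = some p ∧ Q (s.setGrades l (s.grades l ++ [p])) (i.cost + 1) :=
  ⟨fun ⟨_, _, h, q⟩ => by cases h with | append _ _ _ _ p hp => exact ⟨p, hp, q⟩,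
    fun ⟨p, hp, q⟩ => ⟨_, _, .append s l l' i p hp, q⟩⟩

theorem runs_clearTriples (s : State P) (Q : State P → ℕ → Prop) :
    Runs .clearTriples s Q ↔ Q { s with triples := [] } 1 :=
  ⟨fun ⟨_, _, h, q⟩ => by cases h; exact q, fun q => ⟨_, _, .clearTriples s, q⟩⟩

theorem runs_appendTriple (s : State P) (a b : Expr) (z : ℤ) (Q : State P → ℕ → Prop) :
    Runs (.appendTriple a b z) s Q ↔
      Q { s with triples := s.triples ++ [(a.eval s, b.eval s, z)] } (a.cost + b.cost + 1) :=
  ⟨fun ⟨_, _, h, q⟩ => by cases h; exact q, fun q => ⟨_, _, .appendTriple s a b z, q⟩⟩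

theorem runs_seq (c d : Cmd) (s : State P) (Q : State P → ℕ → Prop) :
    Runs (c ;; d) s Q ↔ Runs c s fun s₁ t₁ => Runs d s₁ fun s₂ t₂ => Q s₂ (t₁ + t₂) := by
  constructor
  · rintro ⟨_, _, h, q⟩
    cases h with
    | seq h₁ h₂ => exact ⟨_, _, h₁, _, _, h₂, q⟩
  · rintro ⟨_, _, h₁, _, _, h₂, q⟩
    exact ⟨_, _, .seq h₁ h₂, q⟩

theorem runs_branch (c : Cond) (a b : Cmd) (s : State P) (Q : State P → ℕ → Prop) :
    Runs (.branch c a b) s Q ↔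
      (c.Holds s → Runs a s fun s' t => Q s' (c.cost + t)) ∧
      (¬ c.Holds s → Runs b s fun s' t => Q s' (c.cost + t)) := by
  constructor
  · rintro ⟨_, _, h, q⟩
    cases h with
    | branchTrue hc h => exact ⟨fun _ => ⟨_, _, h, q⟩, fun hn => absurd hc hn⟩
    | branchFalse hc h => exact ⟨fun hn => absurd hn hc, fun _ => ⟨_, _, h, q⟩⟩
  · rintro ⟨h₁, h₂⟩
    by_cases hc : c.Holds s
    · obtain ⟨_, _, h, q⟩ := h₁ hc
      exact ⟨_, _, .branchTrue hc h, q⟩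
    · obtain ⟨_, _, h, q⟩ := h₂ hc
      exact ⟨_, _, .branchFalse hc h, q⟩

theorem runs_when (c : Cond) (a : Cmd) (s : State P) (Q : State P → ℕ → Prop) :
    Runs (when c a) s Q ↔
      (c.Holds s → Runs a s fun s' t => Q s' (c.cost + t)) ∧ (¬ c.Holds s → Q s (c.cost + 1)) := by
  rw [when, runs_branch, runs_skip]

theorem Exec.frame {c : Cmd} {s s' : State P} {t : ℕ} (h : Exec c s s' t) : Frame c s s' := by
  induction h with
  | skip | loopFalse => exact .refl _ _
  | assign s r a =>
    exact ⟨fun r' h => by simp_all [Cmd.writesReg], fun _ _ => rfl, fun _ _ => rfl,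
      fun _ => rfl⟩
  | store s a i b =>
    exact ⟨fun _ _ => rfl, fun r' h => by simp_all [Cmd.writesArr], fun _ _ => rfl,
      fun _ => rfl⟩
  | clear s l =>
    exact ⟨fun _ _ => rfl, fun _ _ => rfl, fun r' h => by simp_all [Cmd.writesGrades],
      fun _ => rfl⟩
  | append s l l' i p =>
    exact ⟨fun _ _ => rfl, fun _ _ => rfl, fun r' h => by simp_all [Cmd.writesGrades],
      fun _ => rfl⟩
  | clearTriples | appendTriple =>
    exact ⟨fun _ _ => rfl, fun _ _ => rfl, fun _ _ => rfl,
      fun h => by simp [Cmd.writesTriples] at h⟩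
  | seq _ _ h h' =>
    refine .trans (h.weaken ?_ ?_ ?_ ?_) (h'.weaken ?_ ?_ ?_ ?_) <;>
      simp +contextual [Cmd.writesReg, Cmd.writesArr, Cmd.writesGrades,
        Cmd.writesTriples]
  | branchTrue _ _ h | branchFalse _ _ h =>
    refine h.weaken ?_ ?_ ?_ ?_ <;>
      simp +contextual [Cmd.writesReg, Cmd.writesArr, Cmd.writesGrades,
        Cmd.writesTriples]
  | loopTrue _ _ _ h h' =>
    exact .trans (h.weaken (fun _ => id) (fun _ => id) (fun _ => id) id) h'

theorem Runs.mono {c : Cmd} {s : State P} {Q Q' : State P → ℕ → Prop} (h : Runs c s Q)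
    (hQ : ∀ s' t, Frame c s s' → Q s' t → Q' s' t) : Runs c s Q' := by
  obtain ⟨s', t, h, q⟩ := h
  exact ⟨s', t, h, hQ s' t h.frame q⟩

/-- The rule for loops. The invariant `I` speaks of the state and the time `T` spent so far; since
every round takes time, a bound for `T` gives termination. -/
theorem Runs.loop {c : Cond} {a : Cmd} {s : State P} (I : State P → ℕ → Prop) (B : ℕ)
    (h₀ : I s 0) (hB : ∀ s T, I s T → T ≤ B)
    (hs : ∀ s' T, Frame (.loop c a) s s' → I s' T → c.Holds s' →
      Runs a s' fun s'' t => I s'' (T + (c.cost + t))) :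
    Runs (.loop c a) s fun s' t => ∃ T, I s' T ∧ ¬ c.Holds s' ∧ t = T + c.cost := by
  have hc : 0 < c.cost := by cases c <;> simp [Cond.cost]
  have key : ∀ d s' T, Frame (.loop c a) s s' → I s' T → B ≤ T + d →
      Runs (.loop c a) s' fun s'' t => ∃ T', I s'' T' ∧ ¬ c.Holds s'' ∧ T + t = T' + c.cost := by
    intro d
    induction d with
    | zero =>
      intro s' T hf hI hT
      by_cases h : c.Holds s'
      · obtain ⟨s'', t, -, hI'⟩ := hs s' T hf hI h
        have := hB _ _ hI'
        omega
      · exact ⟨s', c.cost, .loopFalse h, T, hI, h, rfl⟩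
    | succ d ih =>
      intro s' T hf hI hT
      by_cases h : c.Holds s'
      · obtain ⟨s₁, t₁, h₁, hI₁⟩ := hs s' T hf hI h
        have hf₁ : Frame (.loop c a) s' s₁ :=
          h₁.frame.weaken (fun _ => id) (fun _ => id) (fun _ => id) id
        obtain ⟨s₂, t₂, h₂, T', hI₂, hn, ht⟩ := ih s₁ _ (hf.trans hf₁) hI₁ (by omega)
        exact ⟨s₂, _, .loopTrue h h₁ h₂, T', hI₂, hn, by omega⟩
      · exact ⟨s', c.cost, .loopFalse h, T, hI, h, rfl⟩
  refine (key B s 0 (.refl _ _) h₀ (by omega)).mono ?_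
  rintro s' t - ⟨T, hI, hn, ht⟩
  exact ⟨T, hI, hn, by omega⟩

/-- The rule for counting loops; `I i s T` is the invariant at the beginning of round `i`, where
`T` is the time spent so far. The initialization takes 2 steps, the test and the increment in a
round take 3 + 4 steps, and the last test takes 3 steps. -/
theorem Runs.forTo {r nr : Reg} {body : Cmd} {s : State P} (N : ℕ) (I : ℕ → State P → ℕ → Prop)
    (hN : s.reg nr = N) (hne : nr ≠ r) (hr : body.writesReg r = false)
    (hn : body.writesReg nr = false) (h₀ : I 0 (s.setReg r 0) 2)
    (hs : ∀ i s' T, i < N → s'.reg r = i → Frame (forTo r (.reg nr) body) s s' → I i s' T →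
      Runs body s' fun s'' t => I (i + 1) (s''.setReg r (i + 1)) (T + t + 7)) :
    Runs (forTo r (.reg nr) body) s fun s' t => ∃ T, I N s' T ∧ t = T + 3 := by
  let c : Cond := .lt (.reg r) (.reg nr)
  let b : Cmd := body ;; .assign r (.add (.reg r) (.const 1))
  have key : ∀ d i s' T, i + d = N → s'.reg r = i → Frame (RAM.forTo r (.reg nr) body) s s' →
      I i s' T → Runs (.loop c b) s' fun s'' t => ∃ T', I N s'' T' ∧ T + t = T' + 3 := by
    intro d
    induction d with
    | zero =>
      intro i s' T hi hri hf hI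
      have h1 : s'.reg nr = N := (hf.reg nr (by
        simp [RAM.forTo, Cmd.writesReg, hn, hne])).trans hN
      refine ⟨s', c.cost, .loopFalse ?_, T, ?_, rfl⟩
      · simp [c, Cond.Holds, Expr.eval]; omega
      · have : i = N := by omega
        exact this ▸ hI
    | succ d ih =>
      intro i s' T hi hri hf hI
      have h1 : s'.reg nr = N := (hf.reg nr (by
        simp [RAM.forTo, Cmd.writesReg, hn, hne])).trans hN
      obtain ⟨s₁, t₁, e₁, hI₁⟩ := hs i s' T (by omega) hri hf hI
      have h2 : s₁.reg r = i := (e₁.frame.reg r hr).trans hri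
      have e₂ := Exec.seq e₁ (Exec.assign s₁ r (.add (.reg r) (.const 1)))
      simp only [Expr.eval, Expr.cost, h2] at e₂
      have hf₂ : Frame (RAM.forTo r (.reg nr) body) s' (s₁.setReg r (i + 1)) := by
        refine e₂.frame.weaken ?_ ?_ ?_ ?_ <;>
          simp +contextual [RAM.forTo, Cmd.writesReg, Cmd.writesArr, Cmd.writesGrades,
        Cmd.writesTriples]
      obtain ⟨s₂, t₂, e₃, T', hI₂, ht⟩ := ih (i + 1) _ _ (by omega) (by simp) (hf.trans hf₂) hI₁
      refine ⟨s₂, _, .loopTrue ?_ e₂ e₃, T', hI₂, ?_⟩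
      · simp [c, Cond.Holds, Expr.eval]; omega
      · simp only [c, Cond.cost, Expr.cost]; omega
  rw [RAM.forTo, runs_seq, runs_assign]
  refine (key N 0 (s.setReg r 0) 2 (by omega) (by simp) ?_ h₀).mono ?_
  · refine (Exec.assign s r (.const 0)).frame.weaken ?_ ?_ ?_ ?_ <;>
      simp +contextual [RAM.forTo, Cmd.writesReg, Cmd.writesArr, Cmd.writesGrades,
        Cmd.writesTriples]
  · rintro s' t - ⟨T, hI, ht⟩
    exact ⟨T, hI, by simpa [Expr.cost] using ht⟩

end Logic

end RAM

/-! ### Incidence lists -/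

namespace RAM

section Incidence

variable {P : Type u}

/-- The nodes of the linked list that starts at the node `p` hold the (edge, vertex) pairs in `L`.
The address `0` codes the empty list, and all nodes have addresses at most `b`. -/
def LinkedList (s : State P) (b : ℕ) : ℕ → List (ℕ × ℕ) → Prop
  | p, [] => p = 0
  | p, (e, x) :: L => p ≠ 0 ∧ p ≤ b ∧ s.arr .ptrEdge p = e ∧ s.arr .ptrVert p = x ∧
      LinkedList s b (s.arr .next p) L

theorem LinkedList.mono {s s' : State P} {b b' : ℕ} (hb : b ≤ b')
    (h₁ : ∀ q ≤ b, s'.arr .ptrEdge q = s.arr .ptrEdge q)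
    (h₂ : ∀ q ≤ b, s'.arr .ptrVert q = s.arr .ptrVert q)
    (h₃ : ∀ q ≤ b, s'.arr .next q = s.arr .next q) {p : ℕ} {L : List (ℕ × ℕ)}
    (h : LinkedList s b p L) : LinkedList s' b' p L := by
  induction L generalizing p with
  | nil => exact h
  | cons a L ih =>
    obtain ⟨h0, hp, he, hx, hL⟩ := h
    exact ⟨h0, hp.trans hb, (h₁ p hp).trans he, (h₂ p hp).trans hx, (h₃ p hp).symm ▸ ih hL⟩

@[simp] theorem linkedList_setReg (s : State P) (r : Reg) (x b p : ℕ) (L : List (ℕ × ℕ)) :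
    LinkedList (s.setReg r x) b p L ↔ LinkedList s b p L :=
  ⟨.mono le_rfl (by simp) (by simp) (by simp), .mono le_rfl (by simp) (by simp) (by simp)⟩

/-- The edge `e` has the endpoints `u` and `x`, in one of the two orders. -/
def Joins (src tgt : ℕ → ℕ) (e u x : ℕ) : Prop :=
  (src e = u ∧ tgt e = x) ∨ (src e = x ∧ tgt e = u)

theorem Joins.symm {src tgt : ℕ → ℕ} {e u x : ℕ} (h : Joins src tgt e u x) :
    Joins src tgt e x u := Or.symm h

/-- The linked lists of the state `s` are the incidence lists `inc u` of the vertices `u < n` with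
respect to the edges `e < m` in `E`. The bound on the sum of the lengths holds as an edge
is in at most two lists. -/
structure Incidence (s : State P) (n m : ℕ) (E : ℕ → Prop) (inc : ℕ → List (ℕ × ℕ)) : Prop where
  linked : ∀ u < n, ∃ b, LinkedList s b (s.arr .head u) (inc u)
  mem : ∀ u < n, ∀ e x,
    (e, x) ∈ inc u ↔ e < m ∧ E e ∧ Joins (s.arr .src) (s.arr .tgt) e u x
  sum : ∑ u ∈ Finset.range n, (inc u).length ≤ 2 * m

variable [PartialOrder P]

/-- The new node has the address after all old ones, so the old lists are unchanged. -/
theorem runs_link (X Y : Arr) (hX : X = .src ∨ X = .tgt) (hY : Y = .src ∨ Y = .tgt)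
    (s : State P) (n : ℕ) (inc : ℕ → List (ℕ × ℕ))
    (h : ∀ u < n, LinkedList s (s.reg .fresh) (s.arr .head u) (inc u)) :
    Runs (link (.arr X (.reg .j)) (.reg .j) (.arr Y (.reg .j))) s fun s' t => t = 20 ∧
      ∀ u < n, LinkedList s' (s'.reg .fresh) (s'.arr .head u)
        (if u = s.arr X (s.reg .j) then (s.reg .j, s.arr Y (s.reg .j)) :: inc u else inc u) := by
  have hX1 : X ≠ .head ∧ X ≠ .next ∧ X ≠ .ptrEdge ∧ X ≠ .ptrVert := by
    rcases hX with rfl | rfl <;> simp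
  have hY1 : Y ≠ .head ∧ Y ≠ .next ∧ Y ≠ .ptrEdge ∧ Y ≠ .ptrVert := by
    rcases hY with rfl | rfl <;> simp
  simp only [link, runs_seq, runs_assign, runs_store, Expr.eval, Expr.cost, State.setReg_reg,
    State.setReg_arr, State.setArr_reg, State.setArr_arr, hX1, hY1, reduceCtorEq, if_true, if_false]
  refine ⟨trivial, fun u hu => ?_⟩
  split_ifs with hua
  · subst hua
    refine ⟨by simp, by simp, by simp, by simp, ?_⟩
    simp only [State.setArr_arr, State.setReg_arr, reduceCtorEq, if_true, if_false,
      Function.update_self]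
    refine (h _ hu).mono (by simp) ?_ ?_ ?_ <;> intro q hq <;>
      simp [Function.update_apply] <;> omega
  · simp only [Function.update_apply, hua, if_false]
    refine (h _ hu).mono (by simp) ?_ ?_ ?_ <;> intro q hq <;>
      simp [Function.update_apply] <;> omega

theorem runs_buildIncidence (A : Arr) (hA : (buildIncidence A).writesArr A = false) (s : State P)
    (n m : ℕ) (hn : s.reg .n = n) (hm : s.reg .m = m)
    (hst : ∀ e < m, s.arr .src e < n ∧ s.arr .tgt e < n) :
    Runs (buildIncidence A) s fun s' t => t ≤ 100 * (n + m + 1) ∧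
      ∃ inc, Incidence s' n m (fun e => s.arr A e = 1) inc := by
  rw [buildIncidence, runs_seq, runs_assign, runs_seq]
  refine (Runs.forTo n (fun i s' T => T ≤ 2 + 20 * i ∧ ∀ u < i, s'.arr .head u = 0)
    (by simpa using hn) (by simp) rfl rfl (by simp) ?_).mono ?_
  · rintro i s' T hi hr hf ⟨hT, hI⟩
    rw [runs_store]
    simp only [Expr.eval, Expr.cost, State.setReg_arr, State.setArr_arr, hr]
    refine ⟨by omega, fun u hu => ?_⟩
    by_cases h : u = i
    · simp [h]
    · simp [h]; exact hI u (by omega)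
  rintro s₁ t₁ hf₁ ⟨T₁, ⟨hT₁, hz⟩, ht₁⟩
  have hsrc : s₁.arr .src = s.arr .src := hf₁.arr _ rfl
  have htgt : s₁.arr .tgt = s.arr .tgt := hf₁.arr _ rfl
  have hA1 : s₁.arr A = s.arr A := hf₁.arr _ (by
    cases A <;> first | rfl | simp [buildIncidence, Cmd.writesArr, RAM.forTo, RAM.when, link] at hA)
  have hfresh : s₁.reg .fresh = 0 := hf₁.reg .fresh rfl
  refine (Runs.forTo m (fun j s' T => T ≤ 2 + 80 * j ∧ ∃ inc : ℕ → List (ℕ × ℕ),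
      (∀ u < n, LinkedList s' (s'.reg .fresh) (s'.arr .head u) (inc u)) ∧
      (∀ u < n, ∀ e x, (e, x) ∈ inc u ↔
        e < j ∧ s.arr A e = 1 ∧ Joins (s.arr .src) (s.arr .tgt) e u x) ∧
      ∑ u ∈ Finset.range n, (inc u).length ≤ 2 * j)
    ((hf₁.reg .m rfl).trans (by simpa using hm)) (by simp) rfl rfl
    ⟨by simp, fun _ => [], ?_, by simp, by simp⟩ ?_).mono ?_
  · intro u hu
    simp [LinkedList, hz u hu]
  · rintro j s' T hj hr hf ⟨hT, inc, hI₁, hI₂, hI₃⟩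
    have hsrc' : s'.arr .src = s.arr .src := (hf.arr _ rfl).trans hsrc
    have htgt' : s'.arr .tgt = s.arr .tgt := (hf.arr _ rfl).trans htgt
    have hA' : s'.arr A = s.arr A := (hf.arr A (by
      cases A <;> first | rfl | simp [buildIncidence, Cmd.writesArr, RAM.forTo, RAM.when,
        link] at hA)).trans hA1
    rw [runs_when]
    simp only [RAM.mem, Cond.Holds, Cond.cost, Expr.eval, Expr.cost, hr, hA']
    refine ⟨fun hin => ?_,
      fun hin => ⟨by omega, inc, by simpa using hI₁, fun u hu e x => ?_, by omega⟩⟩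
    · rw [runs_seq]
      refine (runs_link .src .tgt (by simp) (by simp) s' n inc hI₁).mono ?_
      rintro s₂ t₂ hf₂ ⟨ht₂, hL₂⟩
      have hr₂ : s₂.reg .j = j := (hf₂.reg .j rfl).trans hr
      have hsrc₂ : s₂.arr .src = s.arr .src := (hf₂.arr _ rfl).trans hsrc'
      have htgt₂ : s₂.arr .tgt = s.arr .tgt := (hf₂.arr _ rfl).trans htgt'
      rw [runs_when]
      simp only [Cond.Holds, Cond.cost, Expr.eval, Expr.cost, hr₂, hsrc₂, htgt₂]
      simp only [hr, hsrc', htgt'] at hL₂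
      have hsum : ∀ (a : ℕ) (c : ℕ × ℕ) (f : ℕ → List (ℕ × ℕ)), a < n →
          ∑ u ∈ Finset.range n, (if u = a then c :: f u else f u).length =
            ∑ u ∈ Finset.range n, (f u).length + 1 := by
        intro a c f ha
        have : ∀ u, (if u = a then c :: f u else f u).length =
            (f u).length + if u = a then 1 else 0 := by
          intro u; split_ifs <;> simp
        simp only [this, Finset.sum_add_distrib]
        simp [ha]
      refine ⟨fun hne => ?_, fun heq => ?_⟩
      · refine (runs_link .tgt .src (by simp) (by simp) s₂ n _ hL₂).mono ?_
        rintro s₃ t₃ hf₃ ⟨ht₃, hL₃⟩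
        simp only [hr₂, hsrc₂, htgt₂] at hL₃
        refine ⟨by omega, _, by simpa using hL₃, fun u hu e x => ?_, ?_⟩
        · have := hI₂ u hu e x
          by_cases h3 : e = j
          · subst h3
            simp only [Joins] at this ⊢
            split_ifs <;> grind
          · split_ifs <;> grind
        · rw [hsum _ _ _ (hst j hj).2, hsum _ _ _ (hst j hj).1]; omega
      · refine ⟨by omega, _, by simpa using hL₂, fun u hu e x => ?_, ?_⟩
        · have := hI₂ u hu e x
          by_cases h3 : e = j
          · subst h3
            simp only [Joins] at this ⊢
            split_ifs <;> grind
          · split_ifs <;> grind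
        · rw [hsum _ _ _ (hst j hj).1]; omega
    · rw [hI₂ u hu e x]
      by_cases h3 : e = j
      · subst h3; simp [hin]
      · grind
  · rintro s₂ t₂ hf₂ ⟨T₂, ⟨hT₂, inc, hI₁, hI₂, hI₃⟩, ht₂⟩
    simp only [Expr.cost]
    refine ⟨by omega, inc, fun u hu => ⟨_, hI₁ u hu⟩, fun u hu e x => ?_, hI₃⟩
    rw [hI₂ u hu e x, hf₂.arr .src rfl, hf₂.arr .tgt rfl, hsrc, htgt]

/-- The rule for running through an incidence list; in the invariant `I L s T`, `L` is the rest of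
the list and `T` the time spent so far. The commands around `body` take 13 steps in each round. -/
theorem Runs.forIncident {body : Cmd} {s : State P} {b : ℕ} {L : List (ℕ × ℕ)}
    (hL : LinkedList s b (s.arr .head (s.reg .u)) L) (hp : body.writesReg .p = false)
    (h₁ : body.writesArr .ptrEdge = false) (h₂ : body.writesArr .ptrVert = false)
    (h₃ : body.writesArr .next = false) (I : List (ℕ × ℕ) → State P → ℕ → Prop)
    (h₀ : ∀ q, I L (s.setReg .p q) 3)
    (hs : ∀ e x L' s' T, (e, x) ∈ L → Frame (forIncident body) s s' → I ((e, x) :: L') s' T →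
      Runs body ((s'.setReg .e e).setReg .x x) fun s'' t =>
        ∀ q, I L' (s''.setReg .p q) (T + t + 13)) :
    Runs (forIncident body) s fun s' t => ∃ T, I [] s' T ∧ t = T + 4 := by
  let c : Cond := .neg (.eq (.reg .p) (.const 0))
  let a : Cmd := .assign .e (.arr .ptrEdge (.reg .p)) ;; .assign .x (.arr .ptrVert (.reg .p)) ;;
      body ;; .assign .p (.arr .next (.reg .p))
  have key : ∀ K s' T, K ⊆ L → Frame (RAM.forIncident body) s s' → LinkedList s b (s'.reg .p) K →
      I K s' T → Runs (.loop c a) s' fun s'' t => ∃ T', I [] s'' T' ∧ T + t = T' + 4 := by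
    intro K
    induction K with
    | nil =>
      intro s' T hK hf hl hI
      exact ⟨s', c.cost, .loopFalse (by simpa [c, Cond.Holds, Expr.eval, LinkedList] using hl),
        T, hI, rfl⟩
    | cons y K ih =>
      obtain ⟨e, x⟩ := y
      intro s' T hK hf hl hI
      obtain ⟨hp0, hpb, he, hx, hl'⟩ := hl
      have g₁ : s'.arr .ptrEdge = s.arr .ptrEdge := hf.arr _ (by
        simp [RAM.forIncident, Cmd.writesArr, h₁])
      have g₂ : s'.arr .ptrVert = s.arr .ptrVert := hf.arr _ (by
        simp [RAM.forIncident, Cmd.writesArr, h₂])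
      obtain ⟨s₁, t₁, e₁, hI₁⟩ := hs e x K s' T (hK (by simp)) hf hI
      have e₂ : Exec a s' (s₁.setReg .p (s₁.arr .next (s₁.reg .p))) (3 + (3 + (t₁ + 3))) := by
        refine .seq (s₁ := s'.setReg .e e) ?_ (.seq (s₁ := (s'.setReg .e e).setReg .x x) ?_
          (.seq e₁ ?_))
        · have := Exec.assign s' .e (.arr .ptrEdge (.reg .p))
          simpa only [Expr.eval, Expr.cost, g₁, he] using this
        · have := Exec.assign (s'.setReg .e e) .x (.arr .ptrVert (.reg .p))
          simpa [Expr.eval, Expr.cost, g₂, hx] using this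
        · exact Exec.assign s₁ .p (.arr .next (.reg .p))
      have f₁ := e₁.frame
      have hpe : s₁.reg .p = s'.reg .p := (f₁.reg .p hp).trans (by simp)
      have g₃ : s₁.arr .next = s.arr .next := (f₁.arr .next h₃).trans (hf.arr _ (by
        simp [RAM.forIncident, Cmd.writesArr, h₃]))
      have f₂ : Frame (RAM.forIncident body) s' (s₁.setReg .p (s₁.arr .next (s₁.reg .p))) := by
        refine e₂.frame.weaken ?_ ?_ ?_ ?_ <;>
          simp +contextual [RAM.forIncident, Cmd.writesReg, Cmd.writesArr, Cmd.writesGrades,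
          Cmd.writesTriples, a]
      obtain ⟨s₂, t₂, e₃, T', hI₂, ht⟩ := ih _ _ (fun z hz => hK (by simp [hz])) (hf.trans f₂)
        (by simpa [hpe, g₃] using hl') (hI₁ _)
      refine ⟨s₂, _, .loopTrue ?_ e₂ e₃, T', hI₂, ?_⟩
      · simpa [c, Cond.Holds, Expr.eval] using hp0
      · simp only [c, Cond.cost, Expr.cost]; omega
  rw [RAM.forIncident, runs_seq, runs_assign]
  refine (key L _ 3 (fun _ => id) ?_ ?_ (h₀ _)).mono ?_
  · refine (Exec.assign s .p (.arr .head (.reg .u))).frame.weaken ?_ ?_ ?_ ?_ <;>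
      simp +contextual [RAM.forIncident, Cmd.writesReg, Cmd.writesArr, Cmd.writesGrades,
          Cmd.writesTriples]
  · simpa [Expr.eval] using hL
  · rintro s' t - ⟨T, hI, ht⟩
    exact ⟨T, hI, by simpa [Expr.cost] using ht⟩

end Incidence

end RAM

/-! ### The search of the collapsing algorithms -/

namespace RAM

section Search

variable {P : Type u}

/-- The invariant of a collapsing algorithm: `φ` maps every visited vertex to the root of its
search tree, where `adm e a b` says that the search may go along the edge `e` from `a` to `b`, and
`R` is a property of the roots. Edges that are removed from the edge set `E` lie in a tree. -/
structure SearchForest (n m : ℕ) (E : ℕ → Prop) (adm : ℕ → ℕ → ℕ → Prop) (R : ℕ → Prop)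
    (s : State P) : Prop where
  unvisited : ∀ u < n, s.arr .visited u = 0 → s.arr .phi u = u
  root_lt : ∀ u < n, s.arr .visited u ≠ 0 → s.arr .phi u < n
  root_visited : ∀ u < n, s.arr .visited u ≠ 0 → s.arr .visited (s.arr .phi u) ≠ 0
  root_root : ∀ u < n, s.arr .visited u ≠ 0 → s.arr .phi (s.arr .phi u) = s.arr .phi u
  root : ∀ u < n, s.arr .visited u ≠ 0 → R (s.arr .phi u)
  reach : ∀ u < n, s.arr .visited u ≠ 0 →
    Relation.ReflTransGen (fun a b => ∃ e, adm e a b) (s.arr .phi u) u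
  kept : ∀ e < m, s.arr .newEdges e = 1 → E e
  removed : ∀ e < m, E e → s.arr .newEdges e ≠ 1 → ∃ a b, adm e a b ∧ a < n ∧ b < n ∧
    s.arr .visited a ≠ 0 ∧ s.arr .visited b ≠ 0 ∧ s.arr .phi a = s.arr .phi b

/-- The invariant during a search from `v`: `vis₀` and `φ₀` are `visited` and `φ` at its
beginning, and the edges `(e, x)` from `u` in `L` are still to be considered for the stack. -/
structure SearchInv (n m : ℕ) (E : ℕ → Prop) (adm : ℕ → ℕ → ℕ → Prop) (R : ℕ → Prop)
    (vis₀ φ₀ : ℕ → ℕ) (v u : ℕ) (L : List (ℕ × ℕ)) (s : State P) : Prop where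
  forest : SearchForest n m E adm R s
  old : ∀ w < n, vis₀ w ≠ 0 → s.arr .visited w ≠ 0 ∧ s.arr .phi w = φ₀ w
  new : ∀ w < n, vis₀ w = 0 → s.arr .visited w ≠ 0 → s.arr .phi w = v
  stackV : ∀ k < s.reg .sp, s.arr .stackV k = v
  stack : ∀ k < s.reg .sp, s.arr .stackU k < n ∧ ((s.arr .stackE k = m ∧ s.arr .stackU k = v) ∨
    ∃ a < n, adm (s.arr .stackE k) a (s.arr .stackU k) ∧ s.arr .visited a ≠ 0 ∧ s.arr .phi a = v)
  pending : ∀ e a x, adm e a x → s.arr .visited a ≠ 0 → s.arr .visited x ≠ 0 ∨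
    (∃ k < s.reg .sp, s.arr .stackU k = x) ∨ (a = u ∧ (e, x) ∈ L)
  start : s.arr .visited v ≠ 0 ∨ ∃ k < s.reg .sp, s.arr .stackU k = v

variable {n m : ℕ} {E : ℕ → Prop} {adm : ℕ → ℕ → ℕ → Prop} {R : ℕ → Prop}
  {vis₀ φ₀ : ℕ → ℕ} {v u : ℕ} {L : List (ℕ × ℕ)} {s s' : State P}

theorem SearchForest.congr (h : SearchForest n m E adm R s)
    (h₁ : s'.arr .visited = s.arr .visited) (h₂ : s'.arr .phi = s.arr .phi)
    (h₃ : s'.arr .newEdges = s.arr .newEdges) : SearchForest n m E adm R s' := by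
  obtain ⟨a1, a2, a3, a4, a5, a6, a7, a8⟩ := h
  constructor <;> simpa only [h₁, h₂, h₃]

theorem SearchInv.congr (h : SearchInv n m E adm R vis₀ φ₀ v u L s)
    (h₁ : s'.arr = s.arr) (h₂ : s'.reg .sp = s.reg .sp) :
    SearchInv n m E adm R vis₀ φ₀ v u L s' := by
  obtain ⟨a1, a2, a3, a4, a5, a6, a7⟩ := h
  constructor
  · exact a1.congr (by rw [h₁]) (by rw [h₁]) (by rw [h₁])
  all_goals simpa only [h₁, h₂]

theorem SearchInv.skip {e x : ℕ} (h : SearchInv n m E adm R vis₀ φ₀ v u ((e, x) :: L) s)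
    (hn : ¬ adm e u x) : SearchInv n m E adm R vis₀ φ₀ v u L s := by
  refine ⟨h.1, h.2, h.3, h.4, h.5, fun e' a x' h' ha => ?_, h.7⟩
  have := h.pending e' a x' h' ha
  grind

theorem SearchInv.push {e x : ℕ} (h : SearchInv n m E adm R vis₀ φ₀ v u ((e, x) :: L) s)
    (ha : adm e u x) (hu : u < n) (hx : x < n) (hvis : s.arr .visited u ≠ 0)
    (hφ : s.arr .phi u = v)
    (h₁ : s'.reg .sp = s.reg .sp + 1)
    (h₂ : s'.arr .stackV = Function.update (s.arr .stackV) (s.reg .sp) v)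
    (h₃ : s'.arr .stackE = Function.update (s.arr .stackE) (s.reg .sp) e)
    (h₄ : s'.arr .stackU = Function.update (s.arr .stackU) (s.reg .sp) x)
    (h₅ : s'.arr .visited = s.arr .visited) (h₆ : s'.arr .phi = s.arr .phi)
    (h₇ : s'.arr .newEdges = s.arr .newEdges) :
    SearchInv n m E adm R vis₀ φ₀ v u L s' := by
  have hlift : ∀ y, (∃ k < s.reg .sp, s.arr .stackU k = y) →
      ∃ k < s'.reg .sp, s'.arr .stackU k = y := by
    rintro y ⟨k, hk, rfl⟩
    exact ⟨k, by omega, by rw [h₄, Function.update_of_ne (by omega)]⟩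
  have hnew : ∃ k < s'.reg .sp, s'.arr .stackU k = x := ⟨s.reg .sp, by omega, by simp [h₄]⟩
  refine ⟨h.1.congr h₅ h₆ h₇, by simpa only [h₅, h₆] using h.2, by simpa only [h₅, h₆] using h.3,
    fun k hk => ?_, fun k hk => ?_, fun e' a x' h' ha' => ?_, ?_⟩
  · by_cases hk' : k = s.reg .sp
    · simp [h₂, hk']
    · rw [h₂, Function.update_of_ne hk']; exact h.stackV k (by omega)
  · by_cases hk' : k = s.reg .sp
    · subst hk'
      rw [h₃, h₄, h₅, h₆, Function.update_self, Function.update_self]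
      exact ⟨hx, .inr ⟨u, hu, ha, hvis, hφ⟩⟩
    · rw [h₃, h₄, h₅, h₆, Function.update_of_ne hk', Function.update_of_ne hk']
      exact h.stack k (by omega)
  · rw [h₅] at ha' ⊢
    rcases h.pending e' a x' h' ha' with h1 | h1 | ⟨rfl, h1⟩
    · exact .inl h1
    · exact .inr (.inl (hlift _ h1))
    · rcases List.mem_cons.1 h1 with h2 | h2
      · obtain ⟨rfl, rfl⟩ := Prod.mk.inj h2
        exact .inr (.inl hnew)
      · exact .inr (.inr ⟨rfl, h2⟩)
  · rw [h₅]; exact h.start.imp id (hlift _)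

/-- The top of the stack is dropped if its vertex is visited already. -/
theorem SearchInv.drop (h : SearchInv n m E adm R vis₀ φ₀ v u [] s) {k : ℕ}
    (hk : s.reg .sp = k + 1) (hvis : s.arr .visited (s.arr .stackU k) ≠ 0)
    (h₁ : s'.reg .sp = k) (h₂ : s'.arr = s.arr) {u' : ℕ} :
    SearchInv n m E adm R vis₀ φ₀ v u' [] s' := by
  have hlift : ∀ y, (∃ j < s.reg .sp, s.arr .stackU j = y) →
      s.arr .visited y ≠ 0 ∨ ∃ j < s'.reg .sp, s.arr .stackU j = y := by
    rintro y ⟨j, hj, rfl⟩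
    by_cases hjk : j = k
    · exact .inl (hjk ▸ hvis)
    · exact .inr ⟨j, by omega, rfl⟩
  refine ⟨h.1.congr (by rw [h₂]) (by rw [h₂]) (by rw [h₂]), by simpa only [h₂] using h.2,
    by simpa only [h₂] using h.3, fun j hj => ?_, fun j hj => ?_, fun e a x ha hv => ?_, ?_⟩
  · rw [h₂]; exact h.stackV j (by omega)
  · rw [h₂]; exact h.stack j (by omega)
  · rw [h₂] at hv ⊢
    rcases h.pending e a x ha hv with h1 | h1 | ⟨_, h1⟩
    · exact .inl h1
    · exact (hlift _ h1).imp id .inl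
    · simp at h1
  · rw [h₂]
    exact h.start.elim .inl (hlift _)

/-- The top of the stack is popped and its vertex `u` is visited. -/
theorem SearchInv.visit (h : SearchInv n m E adm R vis₀ φ₀ v u [] s) {k : ℕ} {L : List (ℕ × ℕ)}
    (hR : R v) (hvn : v < n)
    (hadm : ∀ e a x, adm e a x → e < m ∧ a < n ∧ x < n)
    (hk : s.reg .sp = k + 1) {w e : ℕ} (hw : s.arr .stackU k = w) (he : s.arr .stackE k = e)
    (hvis : s.arr .visited w = 0)
    (hL : ∀ e x, adm e w x → (e, x) ∈ L)
    (h₁ : s'.reg .sp = k) (h₂ : s'.arr .stackV = s.arr .stackV)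
    (h₃ : s'.arr .stackE = s.arr .stackE) (h₄ : s'.arr .stackU = s.arr .stackU)
    (h₅ : s'.arr .visited = Function.update (s.arr .visited) w 1)
    (h₆ : s'.arr .phi = if e = m then s.arr .phi else Function.update (s.arr .phi) w v)
    (h₇ : s'.arr .newEdges =
      if e = m then s.arr .newEdges else Function.update (s.arr .newEdges) e 0) :
    SearchInv n m E adm R vis₀ φ₀ v w L s' ∧ s'.arr .phi w = v := by
  obtain ⟨hwn, hst⟩ := h.stack k (by omega)
  rw [hw] at hwn
  rw [hw, he] at hst
  have hv0 : vis₀ w = 0 := by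
    by_contra h0
    exact (h.old w hwn h0).1 hvis
  have hvis' : ∀ x, s'.arr .visited x ≠ 0 ↔ x = w ∨ s.arr .visited x ≠ 0 := by
    intro x
    by_cases hx : x = w <;> simp [h₅, hx]
  have hφ' : ∀ x, x ≠ w → s'.arr .phi x = s.arr .phi x := by
    intro x hx
    rw [h₆]
    split_ifs
    · rfl
    · rw [Function.update_of_ne hx]
  have hφw : s'.arr .phi w = v := by
    rcases hst with ⟨h1, rfl⟩ | ⟨a, han, ha, -⟩
    · rw [h₆, if_pos h1, h.forest.unvisited w hwn hvis]
    · have := (hadm _ _ _ ha).1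
      rw [h₆, if_neg (by omega), Function.update_self]
  have hv1 : s'.arr .visited v ≠ 0 := by
    rw [hvis']
    rcases hst with ⟨h1, rfl⟩ | ⟨a, han, ha, ha', rfl⟩
    · exact .inl rfl
    · exact .inr (h.forest.root_visited a han ha')
  have hv2 : s'.arr .phi v = v := by
    by_cases hvw : v = w
    · rw [hvw, hφw, hvw]
    · rw [hφ' v hvw]
      rcases hst with ⟨h1, rfl⟩ | ⟨a, han, ha, ha', rfl⟩
      · exact absurd rfl hvw
      · exact h.forest.root_root a han ha'
  have hreach : Relation.ReflTransGen (fun a b => ∃ e, adm e a b) v w := by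
    rcases hst with ⟨h1, rfl⟩ | ⟨a, han, ha, ha', rfl⟩
    · exact .refl
    · exact (h.forest.reach a han ha').tail ⟨_, ha⟩
  have hne : ∀ x, s.arr .visited x ≠ 0 → x ≠ w := by rintro x hx rfl; exact hx hvis
  refine ⟨⟨⟨fun x hx hxv => ?_, fun x hx hxv => ?_, fun x hx hxv => ?_, fun x hx hxv => ?_,
    fun x hx hxv => ?_, fun x hx hxv => ?_, fun e' he' hnew => ?_, fun e' he' hE hnew => ?_⟩,
    fun x hx h0 => ?_, fun x hx h0 hxv => ?_, fun j hj => ?_, fun j hj => ?_,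
    fun e' a x ha hav => ?_, .inl hv1⟩, hφw⟩
  · have h1 : ¬ (x = w ∨ s.arr .visited x ≠ 0) := by rw [← hvis']; simpa using hxv
    push Not at h1
    rw [hφ' x h1.1, h.forest.unvisited x hx h1.2]
  · rcases (hvis' x).1 hxv with rfl | h1
    · rwa [hφw]
    · rw [hφ' x (hne x h1)]; exact h.forest.root_lt x hx h1
  · rcases (hvis' x).1 hxv with rfl | h1
    · rwa [hφw]
    · rw [hφ' x (hne x h1), hvis']; exact .inr (h.forest.root_visited x hx h1)
  · rcases (hvis' x).1 hxv with rfl | h1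
    · rw [hφw, hv2]
    · rw [hφ' x (hne x h1), hφ' _ (hne _ (h.forest.root_visited x hx h1))]
      exact h.forest.root_root x hx h1
  · rcases (hvis' x).1 hxv with rfl | h1
    · rwa [hφw]
    · rw [hφ' x (hne x h1)]; exact h.forest.root x hx h1
  · rcases (hvis' x).1 hxv with rfl | h1
    · rwa [hφw]
    · rw [hφ' x (hne x h1)]; exact h.forest.reach x hx h1
  · apply h.forest.kept e' he'
    rw [h₇] at hnew
    split_ifs at hnew with hem
    · exact hnew
    · by_cases h1 : e' = e
      · simp [h1] at hnew
      · rwa [Function.update_of_ne h1] at hnew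
  · by_cases hold : s.arr .newEdges e' ≠ 1
    · obtain ⟨a, b, hab, han, hbn, ha, hb, hφ⟩ := h.forest.removed e' he' hE hold
      refine ⟨a, b, hab, han, hbn, (hvis' a).2 (.inr ha), (hvis' b).2 (.inr hb), ?_⟩
      rw [hφ' a (hne a ha), hφ' b (hne b hb), hφ]
    · push Not at hold
      have hee : e' = e := by
        by_contra h1
        apply hnew
        rw [h₇]
        split_ifs
        · exact hold
        · rwa [Function.update_of_ne h1]
      subst hee
      rcases hst with ⟨h1, rfl⟩ | ⟨a, han, ha, ha', hav⟩
      · omega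
      · refine ⟨a, w, ha, han, hwn, (hvis' a).2 (.inr ha'), (hvis' w).2 (.inl rfl), ?_⟩
        rw [hφ' a (hne a ha'), hφw, hav]
  · obtain ⟨h1, h2⟩ := h.old x hx h0
    exact ⟨(hvis' x).2 (.inr h1), by rw [hφ' x (hne x h1), h2]⟩
  · rcases (hvis' x).1 hxv with rfl | h1
    · exact hφw
    · rw [hφ' x (hne x h1)]; exact h.new x hx h0 h1
  · rw [h₂]; exact h.stackV j (by omega)
  · obtain ⟨h1, h2⟩ := h.stack j (by omega)
    rw [h₃, h₄]
    refine ⟨h1, h2.imp id ?_⟩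
    rintro ⟨a, han, ha, ha', hav⟩
    exact ⟨a, han, ha, (hvis' a).2 (.inr ha'), by rw [hφ' a (hne a ha'), hav]⟩
  · by_cases haw : a = w
    · exact .inr (.inr ⟨haw, hL e' x (haw ▸ ha)⟩)
    · have h0 : s.arr .visited a ≠ 0 := ((hvis' a).1 hav).resolve_left haw
      rw [hvis', h₄]
      rcases h.pending e' a x ha h0 with h1 | ⟨j, hj, h1⟩ | ⟨_, h1⟩
      · exact .inl (.inr h1)
      · by_cases hjk : j = k
        · subst hjk; exact .inl (.inl (h1 ▸ hw))
        · exact .inr (.inl ⟨j, by omega, h1⟩)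
      · simp at h1

end Search

section RunsSearch

variable {P : Type u}

/-- The potential of the vertices that are not yet visited: it pays for running through their
incidence lists, which happens only once. -/
def potential (n : ℕ) (inc : ℕ → List (ℕ × ℕ)) (vis : ℕ → ℕ) : ℕ :=
  ∑ u ∈ Finset.range n, if vis u = 0 then 100 + 100 * (inc u).length else 0

theorem potential_update {n : ℕ} (inc : ℕ → List (ℕ × ℕ)) {vis : ℕ → ℕ} {u : ℕ} (hu : u < n)
    (h : vis u = 0) :
    potential n inc (Function.update vis u 1) + (100 + 100 * (inc u).length) =
      potential n inc vis := by
  have hm : u ∈ Finset.range n := Finset.mem_range.2 hu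
  rw [potential, potential, ← Finset.add_sum_erase _ _ hm, ← Finset.add_sum_erase _ _ hm]
  have : ∑ x ∈ (Finset.range n).erase u,
      (if Function.update vis u 1 x = 0 then 100 + 100 * (inc x).length else 0) =
      ∑ x ∈ (Finset.range n).erase u, if vis x = 0 then 100 + 100 * (inc x).length else 0 := by
    refine Finset.sum_congr rfl fun x hx => ?_
    rw [Function.update_of_ne (Finset.ne_of_mem_erase hx)]
  rw [this]
  simp [h]
  omega

theorem potential_le {n m : ℕ} {inc : ℕ → List (ℕ × ℕ)} (vis : ℕ → ℕ)
    (h : ∑ u ∈ Finset.range n, (inc u).length ≤ 2 * m) :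
    potential n inc vis ≤ 200 * (n + m) := by
  calc potential n inc vis
      ≤ ∑ u ∈ Finset.range n, (100 + 100 * (inc u).length) :=
        Finset.sum_le_sum fun u _ => by split_ifs <;> omega
    _ = 100 * n + 100 * ∑ u ∈ Finset.range n, (inc u).length := by
        rw [Finset.sum_add_distrib, ← Finset.mul_sum]; simp [mul_comm]
    _ ≤ _ := by omega

variable [PartialOrder P]

/-- A search from `v` visits everything reachable, if the visited set was closed under admissible
edges before, and it gives all new vertices the root `v`. Its time is paid for by the potential of
the new vertices, up to a constant: a stack entry costs at most 40 steps, and an entry of an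
incidence list costs less than 60 steps beyond that. -/
theorem runs_search {n m : ℕ} {E : ℕ → Prop} {adm : ℕ → ℕ → ℕ → Prop} {R : ℕ → Prop}
    {s : State P} {inc : ℕ → List (ℕ × ℕ)} (admissible : Cond) (hcost : admissible.cost ≤ 20)
    (hlinked : ∀ u < n, ∃ b, LinkedList s b (s.arr .head u) (inc u))
    (hadm : ∀ (s' : State P) (e a x : ℕ), a < n → (e, x) ∈ inc a →
      s'.grades .vGrade = s.grades .vGrade → s'.grades .eGrade = s.grades .eGrade →
      s'.reg .e = e → s'.reg .u = a → s'.reg .x = x → (admissible.Holds s' ↔ adm e a x))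
    (hinc : ∀ e a x, adm e a x → (e, x) ∈ inc a)
    (hlt : ∀ e a x, adm e a x → e < m ∧ a < n ∧ x < n)
    (hm : s.reg .m = m) {v : ℕ} (hv : s.reg .v = v) (hvn : v < n) (hR : R v)
    (hF : SearchForest n m E adm R s)
    (hclosed : ∀ e a x, adm e a x → s.arr .visited a ≠ 0 → s.arr .visited x ≠ 0) :
    Runs (search admissible) s fun s' t =>
      SearchForest n m E adm R s' ∧
      (∀ e a x, adm e a x → s'.arr .visited a ≠ 0 → s'.arr .visited x ≠ 0) ∧
      s'.arr .visited v ≠ 0 ∧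
      (∀ w < n, s.arr .visited w ≠ 0 → s'.arr .visited w ≠ 0 ∧ s'.arr .phi w = s.arr .phi w) ∧
      (∀ w < n, s.arr .visited w = 0 → s'.arr .visited w ≠ 0 → s'.arr .phi w = v) ∧
      t + potential n inc (s'.arr .visited) ≤ potential n inc (s.arr .visited) + 100 := by
  simp only [search, push, runs_seq, runs_assign, runs_store, Expr.eval, Expr.cost]
  simp only [hm, hv, State.setReg_reg, State.setArr_reg,
    reduceCtorEq, if_true, if_false]
  refine (Runs.loop (fun s' T => s'.reg .v = v ∧
      SearchInv n m E adm R (s.arr .visited) (s.arr .phi) v 0 [] s' ∧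
      T + potential n inc (s'.arr .visited) + 40 * s'.reg .sp ≤
        potential n inc (s.arr .visited) + 40) (potential n inc (s.arr .visited) + 40)
      ⟨?_, ⟨?_, ?_, ?_, ?_, ?_, ?_, ?_⟩, ?_⟩ ?_ ?_).mono ?_
  · simp [hv]
  · exact hF.congr (by simp) (by simp) (by simp)
  · simp +contextual
  · simp +contextual
  · simp
  · simp [hvn]
  · intro e a x h
    simpa using fun h' => .inl (hclosed e a x h h')
  · simp
  · simp
  · rintro s' T ⟨-, -, h⟩; omega
  · rintro s' T hf ⟨hv', hI, hT⟩ hc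
    have hc' : 0 < s'.reg .sp := hc
    obtain ⟨k, hk⟩ : ∃ k, s'.reg .sp = k + 1 := ⟨s'.reg .sp - 1, by omega⟩
    simp only [pop, runs_seq, runs_assign, Expr.eval, Expr.cost]
    simp only [State.setReg_reg, State.setReg_arr, reduceCtorEq, if_true, if_false, hk,
      Nat.add_sub_cancel]
    rw [hI.stackV k (by omega)]
    obtain ⟨w, hw⟩ : ∃ w, s'.arr .stackU k = w := ⟨_, rfl⟩
    obtain ⟨e, he⟩ : ∃ e, s'.arr .stackE k = e := ⟨_, rfl⟩
    rw [hw, he]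
    have hwn : w < n := hw ▸ (hI.stack k (by omega)).1
    rw [runs_when]
    simp only [Cond.Holds, Cond.cost, Expr.eval, Expr.cost, State.setReg_reg, State.setReg_arr,
      if_true, reduceCtorEq, if_false]
    refine ⟨fun hvis => ?_, fun hvis => ⟨by simp, hI.drop hk (hw ▸ hvis) (by simp) (by simp), ?_⟩⟩
    swap
    · simp [hk] at hT ⊢; omega
    rw [runs_seq, runs_store, runs_seq]
    simp only [Expr.eval, Expr.cost, State.setReg_reg, reduceCtorEq, if_true, if_false]
    have hm' : s'.reg .m = m := (hf.reg .m rfl).trans (by simp [hm])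
    have htotal : Runs (when (.neg (.eq (.reg .e) (.reg .m)))
          (.store .phi (.reg .u) (.reg .v) ;; .store .newEdges (.reg .e) (.const 0)))
        (((((s'.setReg .sp k).setReg .v v).setReg .e e).setReg .u w).setArr .visited w 1)
        (fun s₁ t₁ => t₁ ≤ 10 ∧ s₁.reg .u = w ∧ s₁.reg .v = v ∧
          s₁.arr .visited = Function.update (s'.arr .visited) w 1 ∧
          SearchInv n m E adm R (s.arr .visited) (s.arr .phi) v w (inc w) s₁ ∧
          s₁.arr .phi w = v) := by
      have hfin := fun s'' => hI.visit (s' := s'') (w := w) (e := e) (L := inc w) hR hvn hlt hk hw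
        he hvis (fun e x => hinc e w x)
      rw [runs_when]
      simp only [runs_seq, runs_store, Cond.Holds, Cond.cost, Expr.eval, Expr.cost,
        State.setReg_reg, State.setArr_reg, hm', reduceCtorEq, if_true, if_false]
      refine ⟨fun h => ⟨by omega, by simp, by simp, by simp, ?_⟩,
        fun h => ⟨by omega, by simp, by simp, by simp, ?_⟩⟩
      · exact hfin _ (by simp) (by simp) (by simp) (by simp) (by simp) (by simp [h]) (by simp [h])
      · push Not at h
        exact hfin _ (by simp) (by simp) (by simp) (by simp) (by simp) (by simp [h]) (by simp [h])
    refine htotal.mono ?_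
    rintro s₁ t₁ hf₁ ⟨ht₁, hu₁, hv₁, hvis₁, hI₁, hφ₁⟩
    have hhead : ∀ a, a = .head ∨ a = .next ∨ a = .ptrEdge ∨ a = .ptrVert →
        s₁.arr a = s.arr a := by
      rintro a (rfl | rfl | rfl | rfl)
      all_goals
        rw [hf₁.arr _ rfl]
        exact hf.arr _ rfl
    have hg₁ : s₁.grades .vGrade = s.grades .vGrade := (hf₁.grades _ rfl).trans (hf.grades _ rfl)
    have hg₂ : s₁.grades .eGrade = s.grades .eGrade := (hf₁.grades _ rfl).trans (hf.grades _ rfl)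
    obtain ⟨b, hb⟩ := hlinked w hwn
    refine (Runs.forIncident (b := b) (L := inc w) ?_ rfl rfl rfl rfl
      (fun L s'' T' => s''.reg .v = v ∧ s''.reg .u = w ∧
        s''.arr .visited = Function.update (s'.arr .visited) w 1 ∧ s''.arr .phi w = v ∧
        SearchInv n m E adm R (s.arr .visited) (s.arr .phi) v w L s'' ∧
        T' + 40 * s''.reg .sp + 100 * L.length ≤ 10 + 40 * k + 100 * (inc w).length) ?_ ?_).mono ?_
    · rw [hu₁, hhead .head (by simp)]
      exact hb.mono le_rfl (by simp [hhead]) (by simp [hhead]) (by simp [hhead])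
    · intro q
      have hsp : s₁.reg .sp = k := (hf₁.reg .sp rfl).trans (by simp)
      refine ⟨by simpa using hv₁, by simpa using hu₁, hvis₁, hφ₁, hI₁.congr rfl (by simp), ?_⟩
      simp [hsp]
    · rintro e' x' L' s₂ T₂ hmem hf₂ ⟨hv₂, hu₂, hvis₂, hφ₂, hI₂, hT₂⟩
      rw [runs_when]
      have hiff := hadm ((s₂.setReg .e e').setReg .x x') e' w x' hwn hmem
        ((hf₂.grades .vGrade rfl).trans hg₁) ((hf₂.grades .eGrade rfl).trans hg₂) (by simp)
        (by simpa using hu₂) (by simp)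
      simp only [List.length_cons] at hT₂
      refine ⟨fun hh => ?_, fun hh q => ?_⟩
      · simp only [runs_seq, runs_assign, runs_store, Expr.eval, Expr.cost]
        intro q
        have ha := hiff.1 hh
        refine ⟨by simp [hv₂], by simp [hu₂], by simp [hvis₂], by simp [hφ₂], ?_, ?_⟩
        · refine hI₂.push ha hwn (hlt _ _ _ ha).2.2 (by simp [hvis₂]) hφ₂ ?_ ?_ ?_ ?_ ?_ ?_ ?_ <;>
            simp [hv₂]
        · simp; omega
      · refine ⟨by simp [hv₂], by simp [hu₂], by simp [hvis₂], by simp [hφ₂], ?_, ?_⟩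
        · exact (hI₂.skip fun h => hh (hiff.2 h)).congr rfl (by simp)
        · simp; omega
    · rintro s₂ t₂ hf₂ ⟨T₂, ⟨hv₂, hu₂, hvis₂, hφ₂, hI₂, hT₂⟩, ht₂⟩
      refine ⟨hv₂, ⟨hI₂.1, hI₂.2, hI₂.3, hI₂.4, hI₂.5, fun e a x h1 h2 => ?_, hI₂.7⟩, ?_⟩
      · have := hI₂.pending e a x h1 h2
        simpa using this
      · have hpot := potential_update inc hwn hvis
        rw [hvis₂]
        simp only [List.length_nil] at hT₂
        omega
  · rintro s' t hf ⟨T, ⟨hv', hI, hT⟩, hc, ht⟩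
    have hsp : s'.reg .sp = 0 := by simpa [Cond.Holds, Expr.eval] using hc
    refine ⟨hI.forest, fun e a x h1 h2 => ?_, ?_, hI.old, hI.new, ?_⟩
    · simpa [hsp] using hI.pending e a x h1 h2
    · simpa [hsp] using hI.start
    · simp only [Cond.cost, Expr.cost] at ht
      omega

end RunsSearch

end RAM

/-! ### Collapsing a graph along the search trees -/

namespace RAM

section Collapse

variable {P : Type u}

/-- The entry `i` of a list of grades, with a new bottom element as the value outside the list. -/
def gradeAt (L : List P) (i : ℕ) : WithBot P :=
  match L[i]? with
  | some p => p
  | none => ⊥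

theorem gradeAt_of_lt {L : List P} {i : ℕ} (h : i < L.length) :
    gradeAt L i = (L[i] : WithBot P) := by
  simp [gradeAt, h]

/-- The equivalence relation on vertices that is generated by the edges in `E` of grade at most
`r`: two vertices are related if they are joined by a path of such edges. -/
def Linked {Q : Type*} [LE Q] (m : ℕ) (src tgt : ℕ → ℕ) (f : ℕ → Q) (E : ℕ → Prop) (r : Q) :
    ℕ → ℕ → Prop :=
  Relation.EqvGen fun a b => ∃ e < m, E e ∧ f e ≤ r ∧ src e = a ∧ tgt e = b

theorem Linked.of_edge {Q : Type*} [LE Q] {m : ℕ} {src tgt : ℕ → ℕ} {f : ℕ → Q} {E : ℕ → Prop}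
    {r : Q} {e : ℕ} (he : e < m) (hE : E e) (hr : f e ≤ r) :
    Linked m src tgt f E r (src e) (tgt e) :=
  .rel _ _ ⟨e, he, hE, hr, rfl, rfl⟩

theorem Linked.mono {Q : Type*} [Preorder Q] {m : ℕ} {src tgt : ℕ → ℕ} {f : ℕ → Q}
    {E E' : ℕ → Prop} {r r' : Q} {a b : ℕ} (h : Linked m src tgt f E r a b)
    (hE : ∀ e < m, E e → E' e) (hr : r ≤ r') :
    Linked m src tgt f E' r' a b :=
  Relation.EqvGen.mono
    (fun _ _ ⟨e, he, h1, h2, h3⟩ => ⟨e, he, hE e he h1, h2.trans hr, h3⟩) a b h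

variable [PartialOrder P]

theorem holds_conj (s : State P) (c d : Cond) :
    (Cond.conj c d).Holds s ↔ c.Holds s ∧ d.Holds s := Iff.rfl

theorem holds_neg (s : State P) (c : Cond) : (Cond.neg c).Holds s ↔ ¬ c.Holds s := Iff.rfl

theorem holds_gle {s : State P} {l l' : GList} {i j : Expr}
    (hi : i.eval s < (s.grades l).length) (hj : j.eval s < (s.grades l').length) :
    (Cond.gle l i l' j).Holds s ↔
      gradeAt (s.grades l) (i.eval s) ≤ gradeAt (s.grades l') (j.eval s) := by
  simp [Cond.Holds, gradeAt_of_lt, hi, hj]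

theorem holds_geq {s : State P} {l l' : GList} {i j : Expr}
    (hi : i.eval s < (s.grades l).length) (hj : j.eval s < (s.grades l').length) :
    (geq l i l' j).Holds s ↔
      gradeAt (s.grades l) (i.eval s) = gradeAt (s.grades l') (j.eval s) := by
  rw [geq, holds_conj, holds_gle hi hj, holds_gle hj hi, le_antisymm_iff]

theorem holds_glt {s : State P} {l l' : GList} {i j : Expr}
    (hi : i.eval s < (s.grades l).length) (hj : j.eval s < (s.grades l').length) :
    (glt l i l' j).Holds s ↔
      gradeAt (s.grades l) (i.eval s) < gradeAt (s.grades l') (j.eval s) := by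
  rw [glt, holds_conj, holds_neg, holds_gle hi hj, holds_gle hj hi, lt_iff_le_not_ge]

variable (P) in
/-- A filtered graph whose vertices and edges are the indices of two lists of grades. -/
structure ListedGraph where
  LV : List P
  LE : List P
  src : ℕ → ℕ
  tgt : ℕ → ℕ
  src_lt : ∀ e < LE.length, src e < LV.length
  tgt_lt : ∀ e < LE.length, tgt e < LV.length
  src_le : ∀ e < LE.length, gradeAt LV (src e) ≤ gradeAt LE e
  tgt_le : ∀ e < LE.length, gradeAt LV (tgt e) ≤ gradeAt LE e

namespace ListedGraph

/-- The number of vertices. -/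
abbrev n (D : ListedGraph P) : ℕ := D.LV.length

/-- The number of edges. -/
abbrev m (D : ListedGraph P) : ℕ := D.LE.length

/-- The grades of the vertices. -/
abbrev fV (D : ListedGraph P) : ℕ → WithBot P := gradeAt D.LV

/-- The grades of the edges. -/
abbrev fE (D : ListedGraph P) : ℕ → WithBot P := gradeAt D.LE

end ListedGraph

/-- The current graph of the state `s` is obtained from `D` by collapsing every vertex `u` to the
representative `φ u`, which is joined to `u` by a path of edges of grade at most the grade of `u`.
Only edges whose endpoints have the same representative have been removed. -/
structure Collapsed (D : ListedGraph P) (φ : ℕ → ℕ) (s : State P) : Prop where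
  reg_n : s.reg .n = D.n
  reg_m : s.reg .m = D.m
  vGrade : s.grades .vGrade = D.LV
  eGrade : s.grades .eGrade = D.LE
  verts : ∀ u < D.n, s.arr .verts u = 1 ↔ φ u = u
  map_lt : ∀ u < D.n, φ u < D.n
  map_map : ∀ u < D.n, φ (φ u) = φ u
  grade_le : ∀ u < D.n, D.fV (φ u) ≤ D.fV u
  linked : ∀ u < D.n, Linked D.m D.src D.tgt D.fE (fun _ => True) (D.fV u) (φ u) u
  src : ∀ e < D.m, s.arr .src e = φ (D.src e)
  tgt : ∀ e < D.m, s.arr .tgt e = φ (D.tgt e)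
  removed : ∀ e < D.m, s.arr .edges e ≠ 1 → φ (D.src e) = φ (D.tgt e)

variable {D : ListedGraph P} {φ : ℕ → ℕ} {s s' : State P}

theorem Collapsed.congr (h : Collapsed D φ s) (h₁ : s'.reg .n = s.reg .n)
    (h₂ : s'.reg .m = s.reg .m) (h₃ : s'.grades .vGrade = s.grades .vGrade)
    (h₄ : s'.grades .eGrade = s.grades .eGrade) (h₅ : s'.arr .verts = s.arr .verts)
    (h₆ : s'.arr .src = s.arr .src) (h₇ : s'.arr .tgt = s.arr .tgt)
    (h₈ : s'.arr .edges = s.arr .edges) : Collapsed D φ s' := by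
  obtain ⟨a1, a2, a3, a4, a5, a6, a7, a8, a9, a10, a11, a12⟩ := h
  constructor <;> simpa only [h₁, h₂, h₃, h₄, h₅, h₆, h₇, h₈]

theorem Collapsed.src_lt (h : Collapsed D φ s) {e : ℕ} (he : e < D.m) : s.arr .src e < D.n := by
  rw [h.src e he]; exact h.map_lt _ (D.src_lt e he)

theorem Collapsed.tgt_lt (h : Collapsed D φ s) {e : ℕ} (he : e < D.m) : s.arr .tgt e < D.n := by
  rw [h.tgt e he]; exact h.map_lt _ (D.tgt_lt e he)

theorem Collapsed.src_le (h : Collapsed D φ s) {e : ℕ} (he : e < D.m) :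
    D.fV (s.arr .src e) ≤ D.fE e := by
  rw [h.src e he]; exact (h.grade_le _ (D.src_lt e he)).trans (D.src_le e he)

theorem Collapsed.tgt_le (h : Collapsed D φ s) {e : ℕ} (he : e < D.m) :
    D.fV (s.arr .tgt e) ≤ D.fE e := by
  rw [h.tgt e he]; exact (h.grade_le _ (D.tgt_lt e he)).trans (D.tgt_le e he)

/-- The endpoints of an edge of the current graph are joined by a path in the original graph. -/
theorem Collapsed.linked_of_joins (h : Collapsed D φ s) {e a b : ℕ} (he : e < D.m)
    (hj : Joins (s.arr .src) (s.arr .tgt) e a b) :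
    Linked D.m D.src D.tgt D.fE (fun _ => True) (D.fE e) a b := by
  have key : Linked D.m D.src D.tgt D.fE (fun _ => True) (D.fE e) (s.arr .src e)
      (s.arr .tgt e) := by
    rw [h.src e he, h.tgt e he]
    refine .trans _ _ _ ((h.linked _ (D.src_lt e he)).mono (fun _ _ => id) (D.src_le e he)) ?_
    refine .trans _ _ _ (Linked.of_edge he trivial le_rfl) (.symm _ _ ?_)
    exact (h.linked _ (D.tgt_lt e he)).mono (fun _ _ => id) (D.tgt_le e he)
  rcases hj with ⟨rfl, rfl⟩ | ⟨rfl, rfl⟩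
  · exact key
  · exact .symm _ _ key

theorem Collapsed.map_of_joins (h : Collapsed D φ s) {e a b : ℕ} (he : e < D.m)
    (hj : Joins (s.arr .src) (s.arr .tgt) e a b) : φ a = a ∧ φ b = b := by
  have h1 : φ (s.arr .src e) = s.arr .src e := by
    rw [h.src e he]; exact h.map_map _ (D.src_lt e he)
  have h2 : φ (s.arr .tgt e) = s.arr .tgt e := by
    rw [h.tgt e he]; exact h.map_map _ (D.tgt_lt e he)
  rcases hj with ⟨rfl, rfl⟩ | ⟨rfl, rfl⟩
  · exact ⟨h1, h2⟩
  · exact ⟨h2, h1⟩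

theorem Collapsed.joins_lt (h : Collapsed D φ s) {e a b : ℕ} (he : e < D.m)
    (hj : Joins (s.arr .src) (s.arr .tgt) e a b) : a < D.n ∧ b < D.n := by
  rcases hj with ⟨rfl, rfl⟩ | ⟨rfl, rfl⟩
  · exact ⟨h.src_lt he, h.tgt_lt he⟩
  · exact ⟨h.tgt_lt he, h.src_lt he⟩

theorem runs_prepare (h : Collapsed D φ s) :
    Runs prepare s fun s' t => t ≤ 200 * (D.n + D.m + 1) ∧ Collapsed D φ s' ∧
      (∃ inc, Incidence s' D.n D.m (fun e => s'.arr .edges e = 1) inc) ∧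
      (∀ u < D.n, s'.arr .phi u = u) ∧ (∀ u < D.n, s'.arr .visited u = 0) ∧
      ∀ e < D.m, s'.arr .newEdges e = s'.arr .edges e := by
  rw [prepare, runs_seq]
  refine (Runs.forTo D.n (fun i s' T => T ≤ 2 + 20 * i ∧ ∀ u < i, s'.arr .phi u = u)
    h.reg_n (by simp) rfl rfl (by simp) ?_).mono ?_
  · rintro i s' T hi hr hf ⟨hT, hI⟩
    rw [runs_store]
    simp only [Expr.eval, Expr.cost, State.setReg_arr, State.setArr_arr, hr, if_true]
    refine ⟨by omega, fun u hu => ?_⟩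
    by_cases h : u = i
    · simp [h]
    · rw [Function.update_of_ne h]; exact hI u (by omega)
  rintro s₁ t₁ hf₁ ⟨T₁, ⟨hT₁, hφ₁⟩, ht₁⟩
  rw [runs_seq]
  refine (Runs.forTo D.n (fun i s' T => T ≤ 2 + 20 * i ∧ ∀ u < i, s'.arr .visited u = 0)
    ((hf₁.reg .n rfl).trans h.reg_n) (by simp) rfl rfl (by simp) ?_).mono ?_
  · rintro i s' T hi hr hf ⟨hT, hI⟩
    rw [runs_store]
    simp only [Expr.eval, Expr.cost, State.setReg_arr, State.setArr_arr, hr, if_true]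
    refine ⟨by omega, fun u hu => ?_⟩
    by_cases h : u = i
    · simp [h]
    · rw [Function.update_of_ne h]; exact hI u (by omega)
  rintro s₂ t₂ hf₂ ⟨T₂, ⟨hT₂, hvis₂⟩, ht₂⟩
  rw [runs_seq]
  refine (Runs.forTo D.m (fun i s' T => T ≤ 2 + 20 * i ∧
    ∀ u < i, s'.arr .newEdges u = s'.arr .edges u)
    ((hf₂.reg .m rfl).trans ((hf₁.reg .m rfl).trans h.reg_m)) (by simp) rfl rfl (by simp)
    ?_).mono ?_
  · rintro i s' T hi hr hf ⟨hT, hI⟩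
    rw [runs_store]
    simp only [Expr.eval, Expr.cost, State.setReg_arr, State.setArr_arr, hr, if_true,
      reduceCtorEq, if_false]
    refine ⟨by omega, fun u hu => ?_⟩
    by_cases h : u = i
    · simp [h]
    · rw [Function.update_of_ne h]; exact hI u (by omega)
  rintro s₃ t₃ hf₃ ⟨T₃, ⟨hT₃, hnew₃⟩, ht₃⟩
  have h₃ : Collapsed D φ s₃ := by
    refine ((h.congr (s' := s₁) ?_ ?_ ?_ ?_ ?_ ?_ ?_ ?_).congr (s' := s₂) ?_ ?_ ?_ ?_ ?_ ?_ ?_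
      ?_).congr ?_ ?_ ?_ ?_ ?_ ?_ ?_ ?_
    all_goals first
      | exact hf₁.reg _ rfl | exact hf₁.grades _ rfl | exact hf₁.arr _ rfl
      | exact hf₂.reg _ rfl | exact hf₂.grades _ rfl | exact hf₂.arr _ rfl
      | exact hf₃.reg _ rfl | exact hf₃.grades _ rfl | exact hf₃.arr _ rfl
  refine (runs_buildIncidence .edges rfl s₃ D.n D.m h₃.reg_n h₃.reg_m
    fun e he => ⟨h₃.src_lt he, h₃.tgt_lt he⟩).mono ?_
  rintro s₄ t₄ hf₄ ⟨ht₄, inc, hinc⟩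
  refine ⟨by omega, ?_, ⟨inc, ?_⟩, fun u hu => ?_, fun u hu => ?_, fun e he => ?_⟩
  · refine h₃.congr ?_ ?_ ?_ ?_ ?_ ?_ ?_ ?_
    all_goals first
      | exact hf₄.reg _ rfl | exact hf₄.grades _ rfl | exact hf₄.arr _ rfl
  · rwa [hf₄.arr .edges rfl]
  · rw [hf₄.arr .phi rfl, hf₃.arr .phi rfl, hf₂.arr .phi rfl]; exact hφ₁ u hu
  · rw [hf₄.arr .visited rfl, hf₃.arr .visited rfl]; exact hvis₂ u hu
  · rw [hf₄.arr .newEdges rfl, hf₄.arr .edges rfl]; exact hnew₃ e he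

/-- The contraction composes the representatives `φ` with the roots of the search trees. The search
goes up in the grading and along edges of the grade of their upper endpoint, so a root is connected
to the vertices of its tree at their own grades. -/
theorem runs_contract {adm : ℕ → ℕ → ℕ → Prop} {R : ℕ → Prop}
    (h : Collapsed D φ s)
    (hF : SearchForest D.n D.m (fun e => s.arr .edges e = 1) adm R s)
    (hadm : ∀ e a b, adm e a b → e < D.m ∧ Joins (s.arr .src) (s.arr .tgt) e a b ∧
      D.fE e = D.fV b ∧ D.fV a ≤ D.fV b)
    (hR : ∀ u, R u → φ u = u) :
    Runs contract s fun s' t => t ≤ 100 * (D.n + D.m + 1) ∧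
      Collapsed D (fun u => s.arr .phi (φ u)) s' := by
  rw [contract, runs_seq]
  refine (Runs.forTo D.n (fun i s' T => T ≤ 2 + 40 * i ∧
    ∀ u, s'.arr .verts u = if u < i ∧ s.arr .phi u ≠ u then 0 else s.arr .verts u)
    h.reg_n (by simp) rfl rfl (by simp) ?_).mono ?_
  · rintro i s' T hi hr hf ⟨hT, hI⟩
    have hp : s'.arr .phi = s.arr .phi := hf.arr .phi rfl
    rw [runs_when, runs_store]
    simp only [Expr.eval, Expr.cost, Cond.cost, Cond.Holds, State.setReg_arr, State.setArr_arr, hr,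
      if_true, hp]
    refine ⟨fun hc => ⟨by omega, fun u => ?_⟩, fun hc => ⟨by omega, fun u => ?_⟩⟩
    · by_cases h : u = i
      · subst h; simp [hc]
      · rw [Function.update_of_ne h, hI u]; grind
    · rw [hI u]
      grind
  rintro s₁ t₁ hf₁ ⟨T₁, ⟨hT₁, hv₁⟩, ht₁⟩
  have e₁ : s₁.arr .src = s.arr .src := hf₁.arr _ rfl
  have e₂ : s₁.arr .tgt = s.arr .tgt := hf₁.arr _ rfl
  refine (Runs.forTo D.m (fun i s' T => T ≤ 2 + 40 * i ∧
    (∀ e < i, s'.arr .edges e = s.arr .newEdges e ∧ s'.arr .src e = s.arr .phi (s.arr .src e) ∧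
      s'.arr .tgt e = s.arr .phi (s.arr .tgt e)) ∧
    ∀ e, i ≤ e → s'.arr .src e = s.arr .src e ∧ s'.arr .tgt e = s.arr .tgt e)
    ((hf₁.reg .m rfl).trans h.reg_m) (by simp) rfl rfl (by simp [e₁, e₂]) ?_).mono ?_
  · rintro i s' T hi hr hf ⟨hT, hI, hI'⟩
    have hp : s'.arr .phi = s.arr .phi := (hf.arr .phi rfl).trans (hf₁.arr .phi rfl)
    have hne : s'.arr .newEdges = s.arr .newEdges :=
      (hf.arr .newEdges rfl).trans (hf₁.arr .newEdges rfl)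
    simp only [runs_seq, runs_store, Expr.eval, Expr.cost, State.setReg_arr, State.setArr_arr,
      State.setArr_reg, hr, if_true, hp, reduceCtorEq, if_false, hne]
    refine ⟨by omega, fun e he => ?_, fun e he => ?_⟩
    · by_cases h : e = i
      · subst h; simp [hI' e le_rfl]
      · simp only [Function.update_of_ne h]; exact hI e (by omega)
    · simp only [Function.update_of_ne (show e ≠ i by omega)]; exact hI' e (by omega)
  rintro s₂ t₂ hf₂ ⟨T₂, ⟨hT₂, he₂, -⟩, ht₂⟩
  have hverts₂ : s₂.arr .verts = s₁.arr .verts := hf₂.arr _ rfl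
  have hstep : ∀ a b, (∃ e, adm e a b) → D.fV a ≤ D.fV b ∧
      Linked D.m D.src D.tgt D.fE (fun _ => True) (D.fV b) a b := by
    rintro a b ⟨e, ha⟩
    obtain ⟨h1, h2, h3, h4⟩ := hadm e a b ha
    exact ⟨h4, h3 ▸ h.linked_of_joins h1 h2⟩
  have hpath : ∀ a b, Relation.ReflTransGen (fun a b => ∃ e, adm e a b) a b → D.fV a ≤ D.fV b ∧
      Linked D.m D.src D.tgt D.fE (fun _ => True) (D.fV b) a b := by
    intro a b hab
    induction hab with
    | refl => exact ⟨le_rfl, .refl _⟩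
    | tail _ hbc ih =>
      obtain ⟨h1, h2⟩ := hstep _ _ hbc
      exact ⟨ih.1.trans h1, .trans _ _ _ (ih.2.mono (fun _ _ => id) h1) h2⟩
  -- the properties of `phi` at a single vertex, visited or not
  have hphi : ∀ w < D.n, s.arr .phi w < D.n ∧ s.arr .phi (s.arr .phi w) = s.arr .phi w ∧
      D.fV (s.arr .phi w) ≤ D.fV w ∧
      Linked D.m D.src D.tgt D.fE (fun _ => True) (D.fV w) (s.arr .phi w) w ∧
      (s.arr .phi w = w ∨ φ (s.arr .phi w) = s.arr .phi w) := by
    intro w hw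
    by_cases hvis : s.arr .visited w = 0
    · have h1 := hF.unvisited w hw hvis
      refine ⟨by omega, by rw [h1, h1], by rw [h1], by rw [h1]; exact .refl _, .inl h1⟩
    · obtain ⟨h1, h2⟩ := hpath _ _ (hF.reach w hw hvis)
      exact ⟨hF.root_lt w hw hvis, hF.root_root w hw hvis, h1, h2, .inr (hR _ (hF.root w hw hvis))⟩
  have hfix : ∀ u < D.n, φ (s.arr .phi (φ u)) = s.arr .phi (φ u) := by
    intro u hu
    rcases (hphi _ (h.map_lt u hu)).2.2.2.2 with h1 | h1
    · rw [h1, h.map_map u hu]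
    · exact h1
  refine ⟨by omega, ?_⟩
  refine ⟨?_, ?_, ?_, ?_, fun u hu => ?_, fun u hu => ?_, fun u hu => ?_, fun u hu => ?_,
    fun u hu => ?_, fun e he => ?_, fun e he => ?_, fun e he hrem => ?_⟩
  · rw [hf₂.reg .n rfl, hf₁.reg .n rfl, h.reg_n]
  · rw [hf₂.reg .m rfl, hf₁.reg .m rfl, h.reg_m]
  · rw [hf₂.grades _ rfl, hf₁.grades _ rfl, h.vGrade]
  · rw [hf₂.grades _ rfl, hf₁.grades _ rfl, h.eGrade]
  · rw [hverts₂, hv₁ u]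
    have h1 := h.verts u hu
    have h2 := hfix u hu
    have h3 := (hphi _ (h.map_lt u hu)).2.1
    have h4 := h.map_map u hu
    split_ifs with hc
    · simp only [false_iff]
      intro h5
      apply hc.2
      rw [h5] at h3
      exact h3
    · have hc' : s.arr .phi u = u := by
        by_contra h0; exact hc ⟨hu, h0⟩
      rw [h1]
      constructor
      · intro h5; rw [h5, hc']
      · intro h5; rw [h5] at h2; exact h2
  · exact (hphi _ (h.map_lt u hu)).1
  · rw [hfix u hu, (hphi _ (h.map_lt u hu)).2.1]
  · exact (hphi _ (h.map_lt u hu)).2.2.1.trans (h.grade_le u hu)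
  · exact .trans _ _ _ ((hphi _ (h.map_lt u hu)).2.2.2.1.mono (fun _ _ => id) (h.grade_le u hu))
      (h.linked u hu)
  · rw [(he₂ e he).2.1, h.src e he]
  · rw [(he₂ e he).2.2, h.tgt e he]
  · rw [(he₂ e he).1] at hrem
    by_cases hE : s.arr .edges e = 1
    · obtain ⟨a, b, hab, -, -, -, -, hφ⟩ := hF.removed e he hE hrem
      have hj := (hadm e a b hab).2.1
      rw [Joins, h.src e he, h.tgt e he] at hj
      rcases hj with ⟨rfl, rfl⟩ | ⟨rfl, rfl⟩
      · exact hφ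
      · exact hφ.symm
    · rw [h.removed e he hE]

end Collapse

end RAM

/-! ### The local and the vertex-minimal collapse -/

namespace RAM

section VertexCollapse

variable {P : Type u}

theorem SearchForest.initial {n m : ℕ} {E : ℕ → Prop} (adm : ℕ → ℕ → ℕ → Prop) (R : ℕ → Prop)
    {s : State P} (h₁ : ∀ u < n, s.arr .phi u = u) (h₂ : ∀ u < n, s.arr .visited u = 0)
    (h₃ : ∀ e < m, s.arr .newEdges e = 1 ↔ E e) : SearchForest n m E adm R s where
  unvisited u hu _ := h₁ u hu
  root_lt u hu h := absurd (h₂ u hu) h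
  root_visited u hu h := absurd (h₂ u hu) h
  root_root u hu h := absurd (h₂ u hu) h
  root u hu h := absurd (h₂ u hu) h
  reach u hu h := absurd (h₂ u hu) h
  kept e he h := (h₃ e he).1 h
  removed e he h h' := absurd ((h₃ e he).2 h) h'

variable [PartialOrder P] {D : ListedGraph P} {φ : ℕ → ℕ} {s : State P}

/-- A search from the vertex `v` in a collapsing algorithm, along the edges of the current graph
that satisfy the condition `g` on their grade and endpoints. -/
theorem runs_search_of_collapsed {s₁ : State P} {inc : ℕ → List (ℕ × ℕ)} {R : ℕ → Prop}
    {adm : ℕ → ℕ → ℕ → Prop} (g : ℕ → ℕ → ℕ → Prop) (admissible : Cond)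
    (hadmdef : ∀ e a x, adm e a x ↔
      (e < D.m ∧ s.arr .edges e = 1 ∧ Joins (s.arr .src) (s.arr .tgt) e a x) ∧ g e a x)
    (hcost : admissible.cost ≤ 20) (h : Collapsed D φ s)
    (hinc : Incidence s D.n D.m (fun e => s.arr .edges e = 1) inc)
    (hg : ∀ (s' : State P), s'.grades .vGrade = D.LV → s'.grades .eGrade = D.LE →
      s'.reg .e < D.m → s'.reg .u < D.n → s'.reg .x < D.n →
      (admissible.Holds s' ↔ g (s'.reg .e) (s'.reg .u) (s'.reg .x)))
    (hm : s₁.reg .m = s.reg .m)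
    (ha : ∀ a, a = .head ∨ a = .next ∨ a = .ptrEdge ∨ a = .ptrVert → s₁.arr a = s.arr a)
    (hl : ∀ l, l = .vGrade ∨ l = .eGrade → s₁.grades l = s.grades l)
    {v : ℕ} (hv : s₁.reg .v = v) (hvn : v < D.n) (hR : R v)
    (hF : SearchForest D.n D.m (fun e => s.arr .edges e = 1) adm R s₁)
    (hclosed : ∀ e a x, adm e a x → s₁.arr .visited a ≠ 0 → s₁.arr .visited x ≠ 0) :
    Runs (search admissible) s₁ fun s' t =>
      SearchForest D.n D.m (fun e => s.arr .edges e = 1) adm R s' ∧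
      (∀ e a x, adm e a x → s'.arr .visited a ≠ 0 → s'.arr .visited x ≠ 0) ∧
      s'.arr .visited v ≠ 0 ∧
      (∀ w < D.n, s₁.arr .visited w ≠ 0 →
        s'.arr .visited w ≠ 0 ∧ s'.arr .phi w = s₁.arr .phi w) ∧
      (∀ w < D.n, s₁.arr .visited w = 0 → s'.arr .visited w ≠ 0 → s'.arr .phi w = v) ∧
      t + potential D.n inc (s'.arr .visited) ≤ potential D.n inc (s₁.arr .visited) + 100 := by
  have hlt : ∀ e a x, adm e a x → e < D.m ∧ a < D.n ∧ x < D.n := by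
    intro e a x hax
    obtain ⟨⟨h1, -, h2⟩, -⟩ := (hadmdef e a x).1 hax
    exact ⟨h1, h.joins_lt h1 h2⟩
  refine runs_search admissible hcost (fun w hw => ?_) ?_ ?_ hlt (hm.trans h.reg_m) hv hvn hR hF
    hclosed
  · obtain ⟨b, hb⟩ := hinc.linked w hw
    refine ⟨b, ?_⟩
    rw [ha .head (by simp)]
    exact hb.mono le_rfl (by simp [ha]) (by simp [ha]) (by simp [ha])
  · rintro s' e a x han hmem h1 h2 rfl rfl rfl
    have h3 := (hinc.mem _ han _ _).1 hmem
    rw [hadmdef, hg s' (by rw [h1, hl _ (by simp), h.vGrade]) (by rw [h2, hl _ (by simp), h.eGrade])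
      h3.1 han (h.joins_lt h3.1 h3.2.2).2]
    simp only [h3, true_and]
  · intro e a x hax
    exact (hinc.mem _ (hlt _ _ _ hax).2.1 _ _).2 ((hadmdef e a x).1 hax).1

/-- After the local collapse, every edge that has the same grade as both of its endpoints is a
loop. -/
theorem runs_localCollapse (h : Collapsed D φ s) :
    Runs localCollapse s fun s' t => t ≤ 1000 * (D.n + D.m + 1) ∧ ∃ ψ, Collapsed D ψ s' ∧
      ∀ e < D.m, D.fE e = D.fV (ψ (D.src e)) → D.fE e = D.fV (ψ (D.tgt e)) →
        ψ (D.src e) = ψ (D.tgt e) := by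
  rw [localCollapse, runs_seq]
  refine (runs_prepare h).mono ?_
  rintro s₁ t₁ - ⟨ht₁, h₁, ⟨inc, hinc⟩, hφ₁, hvis₁, hnew₁⟩
  let g : ℕ → ℕ → ℕ → Prop := fun e a x => D.fE e = D.fV x ∧ D.fV x = D.fV a
  let adm : ℕ → ℕ → ℕ → Prop := fun e a x =>
    (e < D.m ∧ s₁.arr .edges e = 1 ∧ Joins (s₁.arr .src) (s₁.arr .tgt) e a x) ∧ g e a x
  have hsymm : ∀ e a x, adm e a x → adm e x a := by
    rintro e a x ⟨⟨h1, h2, h3⟩, h4, h5⟩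
    exact ⟨⟨h1, h2, h3.symm⟩, h4.trans h5, h5.symm⟩
  have hlt : ∀ e a x, adm e a x → a < D.n ∧ x < D.n := fun e a x hax =>
    h₁.joins_lt hax.1.1 hax.1.2.2
  let R : ℕ → Prop := fun u => φ u = u
  have hpot := potential_le (s₁.arr .visited) hinc.sum
  rw [runs_seq]
  refine (Runs.forTo D.n (fun i s' T =>
    SearchForest D.n D.m (fun e => s₁.arr .edges e = 1) adm R s' ∧
    (∀ e a x, adm e a x → s'.arr .visited a ≠ 0 → s'.arr .visited x ≠ 0) ∧
    (∀ e a x, adm e a x → s'.arr .visited a ≠ 0 → s'.arr .phi a = s'.arr .phi x) ∧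
    (∀ w < i, φ w = w → s'.arr .visited w ≠ 0) ∧
    T + potential D.n inc (s'.arr .visited) ≤
      potential D.n inc (s₁.arr .visited) + 2 + 200 * i)
    h₁.reg_n (by simp) rfl rfl ⟨?_, ?_, ?_, by simp, ?_⟩ ?_).mono ?_
  · exact .initial _ _ hφ₁ hvis₁ fun e he => by
      simp only [State.setReg_arr, hnew₁ e he]
  · exact fun e a x hax h0 => absurd (hvis₁ a (hlt _ _ _ hax).1) h0
  · exact fun e a x hax h0 => absurd (hvis₁ a (hlt _ _ _ hax).1) h0
  · simp only [State.setReg_arr]; omega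
  · rintro i s' T hi hr hf ⟨hF, hcl, hco, hvis, hT⟩
    have hverts : s'.arr .verts = s₁.arr .verts := hf.arr _ rfl
    rw [runs_when]
    simp only [RAM.mem, Expr.eval, Expr.cost, Cond.cost, Cond.Holds, hr, hverts, h₁.verts i hi]
    refine ⟨fun hc => ?_, fun hc => ⟨hF.congr rfl rfl rfl, hcl, hco, fun w hw hφw => ?_, ?_⟩⟩
    · rw [runs_seq, runs_assign]
      simp only [Expr.eval, Expr.cost, hr]
      refine (runs_search_of_collapsed (s₁ := s'.setReg .v i) (adm := adm) (R := R) g _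
        (fun _ _ _ => Iff.rfl) ?_ h₁ hinc ?_ (hf.reg .m rfl) ?_ ?_ (v := i) ?_ hi hc
        (hF.congr rfl rfl rfl) hcl).mono ?_
      · decide
      · intro s'' g1 g2 g3 g4 g5
        have e1 : (Expr.reg .e).eval s'' < (s''.grades .eGrade).length := by rw [g2]; exact g3
        have e2 : (Expr.reg .u).eval s'' < (s''.grades .vGrade).length := by rw [g1]; exact g4
        have e3 : (Expr.reg .x).eval s'' < (s''.grades .vGrade).length := by rw [g1]; exact g5
        rw [holds_conj, holds_geq e1 e3, holds_geq e3 e2, g1, g2]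
        rfl
      · rintro a (rfl | rfl | rfl | rfl) <;> exact hf.arr _ rfl
      · rintro l (rfl | rfl) <;> exact hf.grades _ rfl
      · simp
      · rintro s₂ t₂ - ⟨hF₂, hcl₂, hv₂, hold, hnew, ht₂⟩
        simp only [State.setReg_arr] at hold hnew ht₂
        refine ⟨hF₂.congr rfl rfl rfl, hcl₂, fun e a x hax ha => ?_, fun w hw hφw => ?_, ?_⟩
        · obtain ⟨han, hxn⟩ := hlt e a x hax
          show s₂.arr .phi a = s₂.arr .phi x
          by_cases h0 : s'.arr .visited a = 0
          · -- the neighbour is new as well, since admissibility is symmetric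
            have h0' : s'.arr .visited x = 0 := by
              by_contra h2; exact hcl e x a (hsymm _ _ _ hax) h2 h0
            rw [hnew a han h0 ha, hnew x hxn h0' (hcl₂ e a x hax ha)]
          · rw [(hold a han h0).2, (hold x hxn (hcl e a x hax h0)).2, hco e a x hax h0]
        · show s₂.arr .visited w ≠ 0
          by_cases hwi : w = i
          · rwa [hwi]
          · exact (hold w (by omega) (hvis w (by omega) hφw)).1
        · simp only [State.setReg_arr]; omega
    · have : w ≠ i := fun hwi => hc (hwi ▸ hφw)
      exact hvis w (by omega) hφw
    · simp only [State.setReg_arr]; omega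
  · rintro s₂ t₂ hf₂ ⟨T₂, ⟨hF, hcl, hco, hvis, hT₂⟩, ht₂⟩
    have h₂ : Collapsed D φ s₂ := h₁.congr (hf₂.reg _ rfl) (hf₂.reg _ rfl) (hf₂.grades _ rfl)
      (hf₂.grades _ rfl) (hf₂.arr _ rfl) (hf₂.arr _ rfl) (hf₂.arr _ rfl) (hf₂.arr _ rfl)
    have g1 : s₂.arr .edges = s₁.arr .edges := hf₂.arr _ rfl
    have g2 : s₂.arr .src = s₁.arr .src := hf₂.arr _ rfl
    have g3 : s₂.arr .tgt = s₁.arr .tgt := hf₂.arr _ rfl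
    refine (runs_contract (adm := adm) (R := R) h₂ (by rwa [g1]) ?_ (fun u hu => hu)).mono ?_
    · rintro e a b ⟨⟨a1, a2, a3⟩, a4, a5⟩
      rw [g2, g3]
      exact ⟨a1, a3, a4, a5.ge⟩
    · rintro s₃ t₃ - ⟨ht₃, h₃⟩
      refine ⟨by omega, _, h₃, fun e he e1 e2 => ?_⟩
      by_cases hE : s₁.arr .edges e = 1
      · have hS := D.src_lt e he
        have hT := D.tgt_lt e he
        have hpath : ∀ a b, Relation.ReflTransGen (fun a b => ∃ e, adm e a b) a b →
            D.fV a ≤ D.fV b := by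
          intro a b hab
          induction hab with
          | refl => exact le_rfl
          | tail _ hbc ih =>
            obtain ⟨e', -, -, h5⟩ := hbc
            exact ih.trans h5.ge
        -- the representatives of the endpoints have the grade of the edge already before the search
        have key : ∀ u < D.n, D.fV u ≤ D.fE e → D.fE e = D.fV (s₂.arr .phi (φ u)) →
            D.fE e = D.fV (φ u) := by
          intro u hu hle heq
          refine le_antisymm ?_ ((h.grade_le u hu).trans hle)
          rw [heq]
          have hφu := h.map_lt u hu
          by_cases h0 : s₂.arr .visited (φ u) = 0
          · rw [hF.unvisited _ hφu h0]
          · have hre := hF.reach _ hφu h0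
            exact hpath _ _ hre
        have k1 := key _ hS (D.src_le e he) e1
        have k2 := key _ hT (D.tgt_le e he) e2
        refine hco e _ _ ⟨⟨he, hE, .inl ⟨h₁.src e he, h₁.tgt e he⟩⟩, k2, k2.symm.trans k1⟩ ?_
        exact hvis _ (h.map_lt _ hS) (h.map_map _ hS)
      · rw [h₁.removed e he hE]

/-- The second half of the vertex-minimal collapse. The roots of its searches are the vertices
without an edge of their own grade to a vertex of smaller grade, and every other vertex lies in a
search tree. Hence an edge between distinct new representatives `ψ a`, `ψ b` has a larger grade than
both: if it had the grade of `ψ a`, then `ψ a = φ a` would be a root, so the other end of the edge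
would not have smaller grade, and the edge would have been contracted by the local collapse. -/
theorem runs_collapseFromMinimal (h : Collapsed D φ s)
    (hloc : ∀ e < D.m, D.fE e = D.fV (φ (D.src e)) → D.fE e = D.fV (φ (D.tgt e)) →
        φ (D.src e) = φ (D.tgt e)) :
    Runs (prepare ;; forTo .i (.reg .n) (when (mem .verts (.reg .i))
      (.assign .v (.reg .i) ;; .assign .u (.reg .v) ;; .assign .flag (.const 0) ;;
        forIncident (when (.conj (geq .eGrade (.reg .e) .vGrade (.reg .v))
          (glt .vGrade (.reg .x) .vGrade (.reg .v))) (.assign .flag (.const 1))) ;;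
        when (.eq (.reg .flag) (.const 0))
          (search (.conj (geq .eGrade (.reg .e) .vGrade (.reg .x))
            (glt .vGrade (.reg .u) .vGrade (.reg .x)))))) ;; contract) s
      fun s' t => t ≤ 2000 * (D.n + D.m + 1) ∧ ∃ ψ, Collapsed D ψ s' ∧
        ∀ e < D.m, ψ (D.src e) = ψ (D.tgt e) ∨
          (D.fV (ψ (D.src e)) < D.fE e ∧ D.fV (ψ (D.tgt e)) < D.fE e) := by
  rw [runs_seq]
  refine (runs_prepare h).mono ?_
  rintro s₁ t₁ - ⟨ht₁, h₁, ⟨inc, hinc⟩, hφ₁, hvis₁, hnew₁⟩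
  let g : ℕ → ℕ → ℕ → Prop := fun e a x => D.fE e = D.fV x ∧ D.fV a < D.fV x
  let adm : ℕ → ℕ → ℕ → Prop := fun e a x =>
    (e < D.m ∧ s₁.arr .edges e = 1 ∧ Joins (s₁.arr .src) (s₁.arr .tgt) e a x) ∧ g e a x
  have hlt : ∀ e a x, adm e a x → a < D.n ∧ x < D.n := fun e a x hax =>
    h₁.joins_lt hax.1.1 hax.1.2.2
  let R : ℕ → Prop := fun u => φ u = u ∧ ∀ e a, ¬ adm e a u
  have hpot := potential_le (s₁.arr .visited) hinc.sum
  rw [runs_seq]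
  refine (Runs.forTo D.n (fun i s' T =>
    SearchForest D.n D.m (fun e => s₁.arr .edges e = 1) adm R s' ∧
    (∀ e a x, adm e a x → s'.arr .visited a ≠ 0 → s'.arr .visited x ≠ 0) ∧
    (∀ w < i, R w → s'.arr .visited w ≠ 0) ∧
    T + potential D.n inc (s'.arr .visited) ≤
      potential D.n inc (s₁.arr .visited) + 2 + 200 * i +
        100 * ∑ u ∈ Finset.range i, (inc u).length)
    h₁.reg_n (by simp) rfl rfl ⟨?_, ?_, by simp, ?_⟩ ?_).mono ?_
  · exact .initial _ _ hφ₁ hvis₁ fun e he => by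
      simp only [State.setReg_arr, hnew₁ e he]
  · exact fun e a x hax h0 => absurd (hvis₁ a (hlt _ _ _ hax).1) h0
  · simp only [State.setReg_arr]; omega
  · rintro i s' T hi hr hf ⟨hF, hcl, hvis, hT⟩
    have hverts : s'.arr .verts = s₁.arr .verts := hf.arr _ rfl
    have hsum : ∑ u ∈ Finset.range (i + 1), (inc u).length =
        ∑ u ∈ Finset.range i, (inc u).length + (inc i).length := Finset.sum_range_succ _ _
    rw [runs_when]
    simp only [RAM.mem, Expr.eval, Expr.cost, Cond.cost, Cond.Holds, hr, hverts, h₁.verts i hi]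
    refine ⟨fun hc => ?_, fun hc => ⟨hF.congr rfl rfl rfl, hcl, fun w hw hRw => ?_, ?_⟩⟩
    · simp only [runs_seq, runs_assign, Expr.eval, Expr.cost, hr, State.setReg_reg, if_true]
      obtain ⟨b, hb⟩ := hinc.linked i hi
      have hhead : ∀ a, a = .head ∨ a = .next ∨ a = .ptrEdge ∨ a = .ptrVert →
          s'.arr a = s₁.arr a := by
        rintro a (rfl | rfl | rfl | rfl) <;> exact hf.arr _ rfl
      have hgr : ∀ l, l = .vGrade ∨ l = .eGrade → s'.grades l = s₁.grades l := by
        rintro l (rfl | rfl) <;> exact hf.grades _ rfl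
      refine (Runs.forIncident (b := b) (L := inc i) ?_ rfl rfl rfl rfl
        (fun L s'' T' => (∀ e x, (e, x) ∈ inc i → adm e x i → s''.reg .flag ≠ 0 ∨ (e, x) ∈ L) ∧
          (s''.reg .flag ≠ 0 → ∃ e x, adm e x i) ∧
          T' + 100 * L.length ≤ 100 * (inc i).length + 3) ?_ ?_).mono ?_
      · simp only [State.setReg_arr, State.setReg_reg, if_true, reduceCtorEq, if_false]
        rw [hhead .head (by simp)]
        exact hb.mono le_rfl (by simp [hhead]) (by simp [hhead]) (by simp [hhead])
      · intro q
        refine ⟨fun e x hex _ => .inr hex, ?_, by omega⟩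
        simp
      · rintro e x L' s₂ T₂ hmem hf₂ ⟨hI₁, hI₂, hT₂⟩
        have hex := (hinc.mem i hi e x).1 hmem
        have hxn := (h₁.joins_lt hex.1 hex.2.2).2
        have g1 : s₂.grades .vGrade = D.LV :=
          (hf₂.grades _ rfl).trans ((hgr _ (by simp)).trans h₁.vGrade)
        have g2 : s₂.grades .eGrade = D.LE :=
          (hf₂.grades _ rfl).trans ((hgr _ (by simp)).trans h₁.eGrade)
        have g3 : s₂.reg .v = i := (hf₂.reg .v rfl).trans (by simp)
        have e1 : (Expr.reg .e).eval ((s₂.setReg .e e).setReg .x x) <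
            (((s₂.setReg .e e).setReg .x x).grades .eGrade).length := by
          simp only [Expr.eval, State.setReg_grades, g2]; simpa using hex.1
        have e2 : (Expr.reg .v).eval ((s₂.setReg .e e).setReg .x x) <
            (((s₂.setReg .e e).setReg .x x).grades .vGrade).length := by
          simp only [Expr.eval, State.setReg_grades, g1]; simpa [g3] using hi
        have e3 : (Expr.reg .x).eval ((s₂.setReg .e e).setReg .x x) <
            (((s₂.setReg .e e).setReg .x x).grades .vGrade).length := by
          simp only [Expr.eval, State.setReg_grades, g1]; simpa using hxn
        have hiff : (Cond.conj (geq .eGrade (.reg .e) .vGrade (.reg .v))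
            (glt .vGrade (.reg .x) .vGrade (.reg .v))).Holds
            ((s₂.setReg .e e).setReg .x x) ↔ adm e x i := by
          rw [holds_conj, holds_geq e1 e2, holds_glt e3 e2]
          simp only [Expr.eval, State.setReg_grades, State.setReg_reg, g1, g2, g3, if_true,
            reduceCtorEq, if_false]
          exact ⟨fun hh => ⟨⟨hex.1, hex.2.1, hex.2.2.symm⟩, hh⟩, fun hh => hh.2⟩
        simp only [List.length_cons] at hT₂
        rw [runs_when, hiff, runs_assign]
        refine ⟨fun hh q => ⟨?_, ?_, ?_⟩, fun hh q => ⟨?_, ?_, ?_⟩⟩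
        · simp [Expr.eval]
        · exact fun _ => ⟨e, x, hh⟩
        · simp only [geq, glt, Cond.cost, Expr.cost]; omega
        · intro e' x' hmem' hadm'
          simp only [State.setReg_reg, reduceCtorEq, if_false]
          rcases hI₁ e' x' hmem' hadm' with h3 | h3
          · exact .inl h3
          · rcases List.mem_cons.1 h3 with h4 | h4
            · obtain ⟨rfl, rfl⟩ := Prod.mk.inj h4
              exact absurd hadm' hh
            · exact .inr h4
        · simpa using hI₂
        · simp only [geq, glt, Cond.cost, Expr.cost]; omega
      · rintro s₂ t₂ hf₂ ⟨T₂, ⟨hI₁, hI₂, hT₂⟩, ht₂⟩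
        have k1 : s₂.arr = s'.arr := by
          funext a; exact hf₂.arr a (by cases a <;> rfl)
        simp only [List.length_nil] at hT₂
        rw [runs_when]
        simp only [Cond.Holds, Expr.eval, Cond.cost, Expr.cost]
        have hflag : s₂.reg .flag = 0 ↔ R i := by
          constructor
          · intro h0
            refine ⟨hc, fun e a hax => ?_⟩
            have := hI₁ e a ((hinc.mem i hi e a).2
              ⟨hax.1.1, hax.1.2.1, hax.1.2.2.symm⟩) hax
            simp [h0] at this
          · rintro ⟨-, hno⟩
            by_contra h0
            obtain ⟨e, x, hax⟩ := hI₂ h0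
            exact hno e x hax
        refine ⟨fun h0 => ?_, fun h0 => ?_⟩
        · refine (runs_search_of_collapsed (s₁ := s₂) (adm := adm) (R := R) g _
            (fun _ _ _ => Iff.rfl) ?_ h₁ hinc ?_ ((hf₂.reg .m rfl).trans (hf.reg .m rfl)) ?_ ?_
            (v := i) ?_ hi (hflag.1 h0)
            (hF.congr (by rw [k1]) (by rw [k1]) (by rw [k1])) (by rw [k1]; exact hcl)).mono ?_
          · decide
          · intro s'' g1 g2 g3 g4 g5
            have e1 : (Expr.reg .e).eval s'' < (s''.grades .eGrade).length := by rw [g2]; exact g3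
            have e2 : (Expr.reg .u).eval s'' < (s''.grades .vGrade).length := by rw [g1]; exact g4
            have e3 : (Expr.reg .x).eval s'' < (s''.grades .vGrade).length := by rw [g1]; exact g5
            rw [holds_conj, holds_geq e1 e3, holds_glt e2 e3, g1, g2]
            rfl
          · intro a ha; rw [k1, hhead a ha]
          · rintro l hl
            rw [← hgr l hl]
            rcases hl with rfl | rfl <;> exact hf₂.grades _ rfl
          · exact (hf₂.reg .v rfl).trans (by simp)
          · rintro s₃ t₃ - ⟨hF₃, hcl₃, hv₃, hold, -, ht₃⟩
            rw [k1] at hold ht₃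
            refine ⟨hF₃.congr rfl rfl rfl, hcl₃, fun w hw hRw => ?_, ?_⟩
            · show s₃.arr .visited w ≠ 0
              by_cases hwi : w = i
              · rwa [hwi]
              · exact (hold w (by omega) (hvis w (by omega) hRw)).1
            · simp only [State.setReg_arr]; omega
        · refine ⟨hF.congr ?_ ?_ ?_, ?_, fun w hw hRw => ?_, ?_⟩
          · simp only [State.setReg_arr, k1]
          · simp only [State.setReg_arr, k1]
          · simp only [State.setReg_arr, k1]
          · simp only [State.setReg_arr, k1]; exact hcl
          · have hwi : w ≠ i := fun hwi => h0 (hflag.2 (hwi ▸ hRw))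
            simp only [State.setReg_arr, k1]
            exact hvis w (by omega) hRw
          · simp only [State.setReg_arr, k1]; omega
    · have : w ≠ i := fun hwi => hc (hwi ▸ hRw.1)
      exact hvis w (by omega) hRw
    · simp only [State.setReg_arr]; omega
  · rintro s₂ t₂ hf₂ ⟨T₂, ⟨hF, hcl, hvis, hT₂⟩, ht₂⟩
    have h₂ : Collapsed D φ s₂ := h₁.congr (hf₂.reg _ rfl) (hf₂.reg _ rfl) (hf₂.grades _ rfl)
      (hf₂.grades _ rfl) (hf₂.arr _ rfl) (hf₂.arr _ rfl) (hf₂.arr _ rfl) (hf₂.arr _ rfl)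
    have g1 : s₂.arr .edges = s₁.arr .edges := hf₂.arr _ rfl
    have g2 : s₂.arr .src = s₁.arr .src := hf₂.arr _ rfl
    have g3 : s₂.arr .tgt = s₁.arr .tgt := hf₂.arr _ rfl
    have hsum := hinc.sum
    refine (runs_contract (adm := adm) (R := R) h₂ (by rwa [g1]) ?_ (fun u hu => hu.1)).mono ?_
    · rintro e a b ⟨⟨a1, a2, a3⟩, a4, a5⟩
      rw [g2, g3]
      exact ⟨a1, a3, a4, a5.le⟩
    rintro s₃ t₃ - ⟨ht₃, h₃⟩
    refine ⟨by omega, _, h₃, fun e he => ?_⟩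
    -- every vertex is reached from a root, by induction on its grade
    have hall : ∀ u : Fin D.n, φ u = u → s₂.arr .visited u ≠ 0 := by
      have hwf : WellFounded fun a b : Fin D.n => D.fV a < D.fV b :=
        haveI : IsTrans (Fin D.n) fun a b => D.fV a < D.fV b := ⟨fun _ _ _ => lt_trans⟩
        haveI : Std.Irrefl fun a b : Fin D.n => D.fV a < D.fV b := ⟨fun _ => lt_irrefl _⟩
        Finite.wellFounded_of_trans_of_irrefl _
      intro u
      induction u using hwf.induction with
      | _ u ih =>
        intro hu
        by_cases hR : R u
        · exact hvis u u.2 hR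
        · have : ∃ e a, adm e a u := by
            by_contra hno
            push Not at hno
            exact hR ⟨hu, hno⟩
          obtain ⟨e, a, hax⟩ := this
          refine hcl e a u hax (ih ⟨a, (hlt _ _ _ hax).1⟩ hax.2.2 ?_)
          exact (h₁.map_of_joins hax.1.1 hax.1.2.2).1
    have hpath : ∀ a b, Relation.ReflTransGen (fun a b => ∃ e, adm e a b) a b →
        a = b ∨ D.fV a < D.fV b := by
      intro a b hab
      induction hab with
      | refl => exact .inl rfl
      | tail _ hbc ih =>
        obtain ⟨e', -, -, h5⟩ := hbc
        rcases ih with rfl | ih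
        · exact .inr h5
        · exact .inr (ih.trans h5)
    by_cases hE : s₁.arr .edges e = 1
    swap
    · exact .inl (congrArg (s₂.arr .phi) (h₁.removed e he hE))
    by_cases hab : φ (D.src e) = φ (D.tgt e)
    · exact .inl (congrArg (s₂.arr .phi) hab)
    have hS := D.src_lt e he
    have hT := D.tgt_lt e he
    have hphi : ∀ u < D.n, (s₂.arr .phi (φ u) = φ u ∧ R (φ u)) ∨
        D.fV (s₂.arr .phi (φ u)) < D.fV (φ u) := by
      intro u hu
      have hv := hall ⟨φ u, h.map_lt u hu⟩ (h.map_map u hu)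
      rcases hpath _ _ (hF.reach _ (h.map_lt u hu) hv) with h1 | h1
      · exact .inl ⟨h1, h1 ▸ hF.root _ (h.map_lt u hu) hv⟩
      · exact .inr h1
    have key : ∀ a b, a < D.n → b < D.n → D.fV a ≤ D.fE e → D.fV b ≤ D.fE e →
        Joins (s₁.arr .src) (s₁.arr .tgt) e (φ a) (φ b) →
        ¬ (D.fE e = D.fV (φ a) ∧ D.fE e = D.fV (φ b)) →
        D.fV (s₂.arr .phi (φ a)) < D.fE e := by
      intro a b ha hb hae hbe hj hne
      have ha' := (h.grade_le a ha).trans hae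
      have hb' := (h.grade_le b hb).trans hbe
      rcases hphi a ha with ⟨h1, h2⟩ | h1
      · rw [h1]
        refine lt_of_le_of_ne ha' fun heq => ?_
        refine h2.2 e (φ b) ⟨⟨he, hE, hj.symm⟩, heq.symm, ?_⟩
        rw [heq]
        exact lt_of_le_of_ne hb' fun heq' => hne ⟨heq.symm, heq'.symm⟩
      · exact h1.trans_le ha'
    have hj : Joins (s₁.arr .src) (s₁.arr .tgt) e (φ (D.src e)) (φ (D.tgt e)) :=
      .inl ⟨h₁.src e he, h₁.tgt e he⟩
    exact .inr ⟨key _ _ hS hT (D.src_le e he) (D.tgt_le e he) hj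
        fun hh => hab (hloc e he hh.1 hh.2),
      key _ _ hT hS (D.tgt_le e he) (D.src_le e he) hj.symm
        fun hh => hab (hloc e he hh.2 hh.1)⟩

theorem runs_assoc (a b c : Cmd) (s : State P) (Q : State P → ℕ → Prop) :
    Runs (a ;; b ;; c) s Q ↔ Runs ((a ;; b) ;; c) s Q := by
  simp only [runs_seq, Nat.add_assoc]

/-- The indices below `N` at which an array has the value `1`. -/
def selected (N : ℕ) (a : ℕ → ℕ) : List ℕ := (List.range N).filter fun i => a i = 1

theorem selected_succ (N : ℕ) (a : ℕ → ℕ) :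
    selected (N + 1) a = selected N a ++ if a N = 1 then [N] else [] := by
  rw [selected, List.range_succ, List.filter_append]
  by_cases h : a N = 1 <;> simp [selected, h]

theorem mem_selected {N : ℕ} {a : ℕ → ℕ} {i : ℕ} : i ∈ selected N a ↔ i < N ∧ a i = 1 := by
  simp [selected]

theorem nodup_selected (N : ℕ) (a : ℕ → ℕ) : (selected N a).Nodup :=
  List.nodup_range.filter _

/-- The input in the state `s` is the graph `D`. -/
structure HoldsInput (D : ListedGraph P) (s : State P) : Prop where
  reg_n : s.reg .n = D.n
  reg_m : s.reg .m = D.m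
  vGrade : s.grades .vGrade = D.LV
  eGrade : s.grades .eGrade = D.LE
  src : s.arr .src = D.src
  tgt : s.arr .tgt = D.tgt

theorem runs_vertexCollapse (h : HoldsInput D s) :
    Runs vertexCollapse s fun s' t => t ≤ 4000 * (D.n + D.m + 1) ∧ ∃ φ, Collapsed D φ s' ∧
      (∀ e < D.m, φ (D.src e) = φ (D.tgt e) ∨
        (D.fV (φ (D.src e)) < D.fE e ∧ D.fV (φ (D.tgt e)) < D.fE e)) ∧
      s'.grades .reducedBeta = (selected D.n (s'.arr .verts)).filterMap (D.LV[·]?) := by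
  rw [vertexCollapse, runs_seq]
  refine (Runs.forTo D.n (fun i s' T => T ≤ 2 + 20 * i ∧ ∀ u < i, s'.arr .verts u = 1)
    h.reg_n (by simp) rfl rfl (by simp) ?_).mono ?_
  · rintro i s' T hi hr hf ⟨hT, hI⟩
    rw [runs_store]
    simp only [Expr.eval, Expr.cost, State.setReg_arr, State.setArr_arr, hr, if_true]
    refine ⟨by omega, fun u hu => ?_⟩
    by_cases h : u = i
    · simp [h]
    · rw [Function.update_of_ne h]; exact hI u (by omega)
  rintro s₁ t₁ hf₁ ⟨T₁, ⟨hT₁, hv₁⟩, ht₁⟩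
  rw [runs_seq]
  refine (Runs.forTo D.m (fun i s' T => T ≤ 2 + 20 * i ∧ ∀ u < i, s'.arr .edges u = 1)
    ((hf₁.reg .m rfl).trans h.reg_m) (by simp) rfl rfl (by simp) ?_).mono ?_
  · rintro i s' T hi hr hf ⟨hT, hI⟩
    rw [runs_store]
    simp only [Expr.eval, Expr.cost, State.setReg_arr, State.setArr_arr, hr, if_true]
    refine ⟨by omega, fun u hu => ?_⟩
    by_cases h : u = i
    · simp [h]
    · rw [Function.update_of_ne h]; exact hI u (by omega)
  rintro s₂ t₂ hf₂ ⟨T₂, ⟨hT₂, he₂⟩, ht₂⟩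
  have h₂ : Collapsed D (fun u => u) s₂ := {
    reg_n := by rw [hf₂.reg .n rfl, hf₁.reg .n rfl, h.reg_n]
    reg_m := by rw [hf₂.reg .m rfl, hf₁.reg .m rfl, h.reg_m]
    vGrade := by rw [hf₂.grades _ rfl, hf₁.grades _ rfl, h.vGrade]
    eGrade := by rw [hf₂.grades _ rfl, hf₁.grades _ rfl, h.eGrade]
    verts := fun u hu => by simp [hf₂.arr .verts rfl, hv₁ u hu]
    map_lt := fun u hu => hu
    map_map := fun u hu => rfl
    grade_le := fun u hu => le_rfl
    linked := fun u hu => Relation.EqvGen.refl _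
    src := fun e he => by rw [hf₂.arr .src rfl, hf₁.arr .src rfl, h.src]
    tgt := fun e he => by rw [hf₂.arr .tgt rfl, hf₁.arr .tgt rfl, h.tgt]
    removed := fun e he h0 => absurd (he₂ e he) h0 }
  rw [runs_seq]
  refine (runs_localCollapse h₂).mono ?_
  rintro s₃ t₃ - ⟨ht₃, φ, h₃, hloc⟩
  rw [runs_assoc, runs_assoc, runs_seq]
  refine Runs.mono ((runs_assoc _ _ _ _ _).1 (runs_collapseFromMinimal h₃ hloc)) ?_
  rintro s₄ t₄ - ⟨ht₄, ψ, h₄, hmin⟩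
  rw [runs_seq, runs_clear]
  refine (Runs.forTo (s := s₄.setGrades .reducedBeta []) D.n (fun i s' T => T ≤ 2 + 20 * i ∧
    s'.grades .reducedBeta = (selected i (s₄.arr .verts)).filterMap (D.LV[·]?))
    h₄.reg_n (by simp) rfl rfl (by simp [selected]) ?_).mono ?_
  · rintro i s' T hi hr hf ⟨hT, hI⟩
    have g1 : s'.arr .verts = s₄.arr .verts := hf.arr _ rfl
    have g2 : s'.grades .vGrade = D.LV := (hf.grades _ rfl).trans h₄.vGrade
    rw [runs_when, runs_append]
    simp only [RAM.mem, Expr.eval, Expr.cost, Cond.cost, Cond.Holds, hr, g1, g2, selected_succ]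
    refine ⟨fun hc => ⟨D.LV[i], by simp [hi], by omega, ?_⟩, fun hc => ⟨by omega, ?_⟩⟩
    · simp [hc, hI, hi]
    · simp [hc, hI]
  · rintro s₅ t₅ hf₅ ⟨T₅, ⟨hT₅, hI⟩, ht₅⟩
    refine ⟨by omega, ψ, h₄.congr (hf₅.reg _ rfl) (hf₅.reg _ rfl) (hf₅.grades _ rfl)
      (hf₅.grades _ rfl) (hf₅.arr _ rfl) (hf₅.arr _ rfl) (hf₅.arr _ rfl) (hf₅.arr _ rfl), hmin, ?_⟩
    rw [hI, hf₅.arr .verts rfl]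
    rfl

end VertexCollapse

end RAM

/-! ### Breadth-first search -/

namespace RAM

section BreadthFirst

variable {P : Type u}

/-- The invariant of the breadth-first search from `a`, where `adm e b x` says that the edge `e`
joins `b` and `x`. The first `qfront` entries of the queue have been processed, except for the edges
`(e, x)` in `L` at the entry number `f`. -/
structure QueueInv (n : ℕ) (adm : ℕ → ℕ → ℕ → Prop) (a f : ℕ) (L : List (ℕ × ℕ)) (s : State P) :
    Prop where
  zero_or_one : ∀ u < n, s.arr .visited u = 0 ∨ s.arr .visited u = 1
  reach : ∀ u < n, s.arr .visited u = 1 →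
    Relation.ReflTransGen (fun b x => ∃ e, adm e b x) a u
  queue : ∀ k < s.reg .qback, s.arr .queue k < n ∧ s.arr .visited (s.arr .queue k) = 1
  queued : ∀ u < n, s.arr .visited u = 1 → ∃ k < s.reg .qback, s.arr .queue k = u
  processed : ∀ k < s.reg .qfront, ∀ e x, adm e (s.arr .queue k) x →
    s.arr .visited x = 1 ∨ (k = f ∧ (e, x) ∈ L)
  le : s.reg .qfront ≤ s.reg .qback
  start : s.arr .visited a = 1

variable {n : ℕ} {adm : ℕ → ℕ → ℕ → Prop} {a f : ℕ} {L : List (ℕ × ℕ)} {s s' : State P}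

theorem QueueInv.congr (h : QueueInv n adm a f L s) (h₁ : s'.arr = s.arr)
    (h₂ : s'.reg .qfront = s.reg .qfront) (h₃ : s'.reg .qback = s.reg .qback) :
    QueueInv n adm a f L s' := by
  obtain ⟨a1, a2, a3, a4, a5, a6, a7⟩ := h
  constructor <;> simpa only [h₁, h₂, h₃]

theorem QueueInv.skip {e x : ℕ} (h : QueueInv n adm a f ((e, x) :: L) s)
    (hx : s.arr .visited x = 1) : QueueInv n adm a f L s := by
  refine ⟨h.1, h.2, h.3, h.4, fun k hk e' x' hax => ?_, h.6, h.7⟩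
  have := h.processed k hk e' x' hax
  grind

theorem QueueInv.enqueue {e x : ℕ} (h : QueueInv n adm a f ((e, x) :: L) s)
    (hf : f < s.reg .qback) (hadm : adm e (s.arr .queue f) x) (hx : x < n)
    (h₁ : s'.reg .qfront = s.reg .qfront) (h₂ : s'.reg .qback = s.reg .qback + 1)
    (h₃ : s'.arr .visited = Function.update (s.arr .visited) x 1)
    (h₄ : s'.arr .queue = Function.update (s.arr .queue) (s.reg .qback) x) :
    QueueInv n adm a f L s' := by
  have hq : ∀ k < s.reg .qback, s'.arr .queue k = s.arr .queue k := by
    intro k hk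
    rw [h₄, Function.update_of_ne (by omega)]
  have hq' : s'.arr .queue (s.reg .qback) = x := by rw [h₄, Function.update_self]
  have hv : ∀ u, s'.arr .visited u = 1 ↔ u = x ∨ s.arr .visited u = 1 := by
    intro u
    by_cases hu : u = x <;> simp [h₃, hu]
  have hle := h.le
  refine ⟨fun u hu => ?_, fun u hu hu' => ?_, fun k hk => ?_, fun u hu hu' => ?_,
    fun k hk e' x' hax => ?_, by omega, (hv a).2 (.inr h.start)⟩
  · by_cases hux : u = x
    · simp [h₃, hux]
    · rw [h₃, Function.update_of_ne hux]; exact h.zero_or_one u hu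
  · rcases (hv u).1 hu' with rfl | h1
    · obtain ⟨h2, h3⟩ := h.queue f hf
      exact (h.reach _ h2 h3).tail ⟨e, hadm⟩
    · exact h.reach u hu h1
  · by_cases hkq : k = s.reg .qback
    · rw [hkq, hq', hv]; exact ⟨hx, .inl rfl⟩
    · rw [hq k (by omega), hv]
      exact ⟨(h.queue k (by omega)).1, .inr (h.queue k (by omega)).2⟩
  · rcases (hv u).1 hu' with rfl | h1
    · exact ⟨s.reg .qback, by omega, hq'⟩
    · obtain ⟨k, hk, rfl⟩ := h.queued u hu h1
      exact ⟨k, by omega, hq k hk⟩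
  · rw [hq k (by omega)] at hax
    rw [hv]
    have := h.processed k (by omega) e' x' hax
    grind

variable [PartialOrder P]

/-- The breadth-first search marks the vertices that are reached from the first endpoint of the
edge in the register `i`. The time is paid for by the potential of the unvisited vertices; the
potential of a vertex in the queue is released when it leaves the queue. -/
theorem runs_breadthFirst {n m i : ℕ} {s : State P} (hn : s.reg .n = n) (hm : s.reg .m = m)
    (hi : s.reg .i = i) (him : i < m) (hst : ∀ e < m, s.arr .src e < n ∧ s.arr .tgt e < n)
    (hlow : ∀ e < m, s.arr .lowEdges e = 1 →
      s.arr .lowVerts (s.arr .src e) = 1 ∧ s.arr .lowVerts (s.arr .tgt e) = 1) :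
    Runs breadthFirst s fun s' t => t ≤ 1000 * (n + m + 1) ∧ ∀ u < n, s'.arr .visited u = 1 ↔
      Relation.ReflTransGen (fun b x => ∃ e, e < m ∧ s.arr .lowEdges e = 1 ∧
        Joins (s.arr .src) (s.arr .tgt) e b x) (s.arr .src i) u := by
  rw [breadthFirst, runs_seq]
  refine (runs_buildIncidence .lowEdges rfl s n m hn hm hst).mono ?_
  rintro s₁ t₁ hf₁ ⟨ht₁, inc, hinc⟩
  rw [runs_seq]
  refine (Runs.forTo n (fun i s' T => T ≤ 2 + 20 * i ∧ ∀ u < i, s'.arr .visited u = 0)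
    ((hf₁.reg .n rfl).trans hn) (by simp) rfl rfl (by simp) ?_).mono ?_
  · rintro i s' T hi hr hf ⟨hT, hI⟩
    rw [runs_store]
    simp only [Expr.eval, Expr.cost, State.setReg_arr, State.setArr_arr, hr, if_true]
    refine ⟨by omega, fun u hu => ?_⟩
    by_cases h : u = i
    · simp [h]
    · rw [Function.update_of_ne h]; exact hI u (by omega)
  rintro s₂ t₂ hf₂ ⟨T₂, ⟨hT₂, hv₂⟩, ht₂⟩
  let adm : ℕ → ℕ → ℕ → Prop := fun e b x =>
    e < m ∧ s.arr .lowEdges e = 1 ∧ Joins (s.arr .src) (s.arr .tgt) e b x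
  have hlt : ∀ e b x, adm e b x → b < n ∧ x < n := by
    rintro e b x ⟨h1, -, h2⟩
    have h3 := hst e h1
    rcases h2 with ⟨rfl, rfl⟩ | ⟨rfl, rfl⟩
    · exact h3
    · exact h3.symm
  have hinc₂ : ∀ b < n, ∀ e x, (e, x) ∈ inc b ↔ adm e b x := by
    intro b hb e x
    rw [hinc.mem b hb e x, hf₁.arr .src rfl, hf₁.arr .tgt rfl]
  have hr₂ : s₂.reg .i = i := (hf₂.reg .i rfl).trans ((hf₁.reg .i rfl).trans hi)
  have hs₂ : s₂.arr .src = s.arr .src := (hf₂.arr .src rfl).trans (hf₁.arr .src rfl)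
  obtain ⟨a, ha⟩ : ∃ a, s.arr .src i = a := ⟨_, rfl⟩
  have han : a < n := ha ▸ (hst i him).1
  simp only [runs_seq, runs_store, runs_assign, Expr.eval, Expr.cost,
    State.setArr_reg, State.setArr_arr, reduceCtorEq, if_false, hr₂, hs₂, ha]
  have hpot := potential_le (s₂.arr .visited) hinc.sum
  refine (Runs.loop (fun s' T => QueueInv n adm a 0 [] s' ∧
    T + potential n inc (s'.arr .visited) +
      ∑ k ∈ Finset.Ico (s'.reg .qfront) (s'.reg .qback),
        (100 + 100 * (inc (s'.arr .queue k)).length) ≤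
      potential n inc (s₂.arr .visited)) (potential n inc (s₂.arr .visited))
    ⟨⟨?_, ?_, ?_, ?_, ?_, ?_, ?_⟩, ?_⟩ ?_ ?_).mono ?_
  · intro u hu
    by_cases hua : u = a
    · simp [hua]
    · simp [hua, hv₂ u hu]
  · intro u hu
    by_cases hua : u = a
    · rw [hua]; exact fun _ => .refl
    · simp [hua, hv₂ u hu]
  · simp [han]
  · intro u hu
    by_cases hua : u = a
    · simp [hua]
    · simp [hua, hv₂ u hu]
  · simp
  · simp
  · simp
  · have := potential_update inc han (hv₂ a han)
    simp
    omega
  · rintro s' T ⟨-, h⟩; omega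
  · rintro s' T hf ⟨hI, hT⟩ hc
    have hc' : s'.reg .qfront < s'.reg .qback := hc
    obtain ⟨q, hq⟩ : ∃ q, s'.reg .qfront = q := ⟨_, rfl⟩
    obtain ⟨w, hw⟩ : ∃ w, s'.arr .queue q = w := ⟨_, rfl⟩
    have hwn : w < n := hw ▸ (hI.queue q (by omega)).1
    simp only [runs_seq, runs_assign, Expr.eval, Expr.cost, State.setReg_reg,
      reduceCtorEq, if_false, hq, hw]
    have hhead : ∀ b, b = .head ∨ b = .next ∨ b = .ptrEdge ∨ b = .ptrVert →
        s'.arr b = s₁.arr b := by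
      rintro b (rfl | rfl | rfl | rfl)
      all_goals exact (hf.arr _ rfl).trans (hf₂.arr _ rfl)
    obtain ⟨b, hb⟩ := hinc.linked w hwn
    refine (Runs.forIncident (b := b) (L := inc w) ?_ rfl rfl rfl rfl
      (fun L s'' T' => QueueInv n adm a q L s'' ∧ s''.reg .qfront = q + 1 ∧ q < s''.reg .qback ∧
        s''.arr .queue q = w ∧
        T' + 100 * L.length + potential n inc (s''.arr .visited) +
          ∑ k ∈ Finset.Ico (q + 1) (s''.reg .qback), (100 + 100 * (inc (s''.arr .queue k)).length)
          ≤ potential n inc (s'.arr .visited) + 3 + 100 * (inc w).length +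
            ∑ k ∈ Finset.Ico (q + 1) (s'.reg .qback), (100 + 100 * (inc (s'.arr .queue k)).length))
        ?_ ?_).mono ?_
    · simp only [State.setReg_arr, State.setReg_reg, reduceCtorEq, if_false, if_true]
      rw [hhead .head (by simp)]
      exact hb.mono le_rfl (by simp [hhead]) (by simp [hhead]) (by simp [hhead])
    · intro p
      refine ⟨⟨hI.1, hI.2, ?_, ?_, ?_, ?_, hI.7⟩, by simp, ?_, hw, ?_⟩
      · simpa using hI.queue
      · simpa using hI.queued
      · intro k hk e x hax
        simp only [State.setReg_reg, State.setReg_arr, reduceCtorEq, if_false, if_true] at hk hax ⊢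
        by_cases hkq : k = q
        · rw [hkq, hw] at hax
          exact .inr ⟨hkq, (hinc₂ w hwn e x).2 hax⟩
        · have := hI.processed k (by omega) e x hax
          exact .inl (by simpa using this)
      · simp only [State.setReg_reg, reduceCtorEq, if_false, if_true]; omega
      · simp only [State.setReg_reg, reduceCtorEq, if_false]; omega
      · simp; omega
    · rintro e x L' s₃ T₃ hmem hf₃ ⟨hI₃, hq₃, hqb₃, hw₃, hT₃⟩
      have hax := (hinc₂ w hwn e x).1 hmem
      have hxn := (hlt _ _ _ hax).2
      have hlv : s₃.arr .lowVerts x = 1 := by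
        rw [hf₃.arr .lowVerts rfl]
        have h1 : s'.arr .lowVerts = s.arr .lowVerts :=
          (hf.arr _ rfl).trans ((hf₂.arr .lowVerts rfl).trans (hf₁.arr .lowVerts rfl))
        simp only [State.setReg_arr, h1]
        have h2 := hlow e hax.1 hax.2.1
        rcases hax.2.2 with ⟨h3, rfl⟩ | ⟨rfl, h3⟩
        · exact h2.2
        · exact h2.1
      rw [runs_when, holds_conj]
      simp only [RAM.mem, runs_seq, runs_store, runs_assign, Cond.Holds, Cond.cost, Expr.eval,
        Expr.cost, State.setReg_reg, State.setReg_arr, State.setArr_arr, State.setArr_reg,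
        reduceCtorEq, if_true, if_false, hlv, true_and]
      simp only [List.length_cons] at hT₃
      refine ⟨fun h0 p => ?_, fun h0 p => ?_⟩
      · refine ⟨hI₃.enqueue hqb₃ (hw₃ ▸ hax) hxn (by simp) (by simp) (by simp) (by simp),
          by simp [hq₃], by omega, ?_, ?_⟩
        · rw [Function.update_of_ne (by omega)]; exact hw₃
        · have h1 := potential_update inc hxn h0
          rw [Finset.sum_Ico_succ_top (by omega), Function.update_self]
          have h2 : ∑ k ∈ Finset.Ico (q + 1) (s₃.reg .qback), (100 + 100 * (inc
              (Function.update (s₃.arr .queue) (s₃.reg .qback) x k)).length) =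
              ∑ k ∈ Finset.Ico (q + 1) (s₃.reg .qback),
                (100 + 100 * (inc (s₃.arr .queue k)).length) := by
            refine Finset.sum_congr rfl fun k hk => ?_
            rw [Function.update_of_ne (by have := (Finset.mem_Ico.1 hk).2; omega)]
          rw [h2]
          omega
      · have h1 := (hI₃.zero_or_one x hxn).resolve_left h0
        refine ⟨(hI₃.skip h1).congr rfl (by simp) (by simp), by simp [hq₃], by omega, hw₃, by omega⟩
    · rintro s₃ t₃ hf₃ ⟨T₃, ⟨hI₃, hq₃, hqb₃, hw₃, hT₃⟩, ht₃⟩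
      refine ⟨⟨hI₃.1, hI₃.2, hI₃.3, hI₃.4, ?_, hI₃.6, hI₃.7⟩, ?_⟩
      · intro k hk e x hax
        simpa using hI₃.processed k hk e x hax
      · rw [hq, Finset.sum_eq_sum_Ico_succ_bot (by omega : q < s'.reg .qback), hw] at hT
        rw [hq₃]
        simp only [List.length_nil, Cond.cost, Expr.cost] at hT₃ ⊢
        omega
  · rintro s₃ t₃ hf₃ ⟨T₃, ⟨hI, hT⟩, hc, ht₃⟩
    have hc' : s₃.reg .qback ≤ s₃.reg .qfront := by simpa [Cond.Holds, Expr.eval] using hc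
    simp only [Cond.cost, Expr.cost] at ht₃
    refine ⟨by omega, fun u hu => ⟨fun h => hI.reach u hu h, fun h => ?_⟩⟩
    have key : u < n ∧ s₃.arr .visited u = 1 := by
      induction h with
      | refl => exact ⟨han, hI.start⟩
      | @tail c d _ hbc ih =>
        obtain ⟨e, hax⟩ := hbc
        obtain ⟨h1, h2⟩ := ih (hlt e _ _ hax).1
        obtain ⟨k, hk, rfl⟩ := hI.queued _ h1 h2
        have := hI.processed k (by omega) e _ hax
        exact ⟨(hlt e _ _ hax).2, by simpa using this⟩
    exact key.2

end BreadthFirst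

end RAM

/-! ### The deletion of edges and the output -/

namespace RAM

section Linked

variable {Q : Type*} {m : ℕ} {src tgt : ℕ → ℕ} {f : ℕ → Q} {E : ℕ → Prop} {r : Q}

theorem Linked.congr [LE Q] {src' tgt' : ℕ → ℕ} {E' : ℕ → Prop} {a b : ℕ}
    (h : Linked m src tgt f E r a b) (hs : ∀ e < m, src e = src' e) (ht : ∀ e < m, tgt e = tgt' e)
    (hE : ∀ e < m, E e → E' e) : Linked m src' tgt' f E' r a b :=
  Relation.EqvGen.mono (fun _ _ ⟨e, he, h1, h2, h3, h4⟩ =>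
    ⟨e, he, hE e he h1, h2, (hs e he).symm.trans h3, (ht e he).symm.trans h4⟩) a b h

theorem linked_iff_reflTransGen [LE Q] {E' : ℕ → Prop} (hE : ∀ e < m, E' e ↔ E e ∧ f e ≤ r)
    (a b : ℕ) : Linked m src tgt f E r a b ↔
      Relation.ReflTransGen (fun b x => ∃ e, e < m ∧ E' e ∧ Joins src tgt e b x) a b := by
  have hsymm : Std.Symm fun b x => ∃ e, e < m ∧ E' e ∧ Joins src tgt e b x :=
    ⟨fun _ _ ⟨e, h1, h2, h3⟩ => ⟨e, h1, h2, h3.symm⟩⟩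
  constructor
  · intro h
    induction h with
    | rel x y h =>
      obtain ⟨e, he, h1, h2, h3, h4⟩ := h
      exact .single ⟨e, he, (hE e he).2 ⟨h1, h2⟩, .inl ⟨h3, h4⟩⟩
    | refl x => exact .refl
    | symm x y _ ih => exact Relation.ReflTransGen.stdSymm.symm _ _ ih
    | trans x y z _ _ ih ih' => exact ih.trans ih'
  · intro h
    induction h with
    | refl => exact .refl _
    | tail _ h ih =>
      obtain ⟨e, he, h1, h2⟩ := h
      obtain ⟨h3, h4⟩ := (hE e he).1 h1
      refine .trans _ _ _ ih ?_
      rcases h2 with ⟨rfl, rfl⟩ | ⟨rfl, rfl⟩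
      · exact Linked.of_edge he h3 h4
      · exact .symm _ _ (Linked.of_edge he h3 h4)

/-- An edge whose endpoints are joined by other edges of at most its grade is superfluous. -/
theorem Linked.erase [Preorder Q] {i a b : ℕ}
    (hi : Linked m src tgt f (fun e => E e ∧ e ≠ i) (f i) (src i) (tgt i))
    (h : Linked m src tgt f E r a b) : Linked m src tgt f (fun e => E e ∧ e ≠ i) r a b := by
  induction h with
  | rel x y h =>
    obtain ⟨e, he, h1, h2, rfl, rfl⟩ := h
    by_cases hei : e = i
    · subst hei
      exact hi.mono (fun _ _ => id) h2
    · exact Linked.of_edge he ⟨h1, hei⟩ h2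
  | refl x => exact .refl _
  | symm x y _ ih => exact .symm _ _ ih
  | trans x y z _ _ ih ih' => exact .trans _ _ _ ih ih'

end Linked

section Presentation

variable {P : Type u} [PartialOrder P] {D : ListedGraph P} {φ : ℕ → ℕ} {s : State P}

theorem runs_lowVerts (hn : s.reg .n = D.n) (hV : s.grades .vGrade = D.LV)
    (hE : s.grades .eGrade = D.LE) {i : ℕ} (hi : s.reg .i = i) (him : i < D.m) :
    Runs (forTo .j (.reg .n) (.branch
        (.conj (mem .verts (.reg .j)) (.gle .vGrade (.reg .j) .eGrade (.reg .i)))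
        (.store .lowVerts (.reg .j) (.const 1)) (.store .lowVerts (.reg .j) (.const 0)))) s
      fun s' t => t ≤ 100 * (D.n + 1) ∧
        ∀ u < D.n, s'.arr .lowVerts u = 1 ↔ s.arr .verts u = 1 ∧ D.fV u ≤ D.fE i := by
  refine (Runs.forTo D.n (fun j s' T => T ≤ 2 + 50 * j ∧
    ∀ u < j, s'.arr .lowVerts u = 1 ↔ s.arr .verts u = 1 ∧ D.fV u ≤ D.fE i)
    hn (by simp) rfl rfl (by simp) ?_).mono ?_
  · rintro j s' T hj hr hf ⟨hT, hI⟩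
    have g1 : s'.grades .vGrade = D.LV := (hf.grades _ rfl).trans hV
    have g2 : s'.grades .eGrade = D.LE := (hf.grades _ rfl).trans hE
    have g3 : s'.reg .i = i := (hf.reg _ rfl).trans hi
    have g4 : s'.arr .verts = s.arr .verts := hf.arr _ rfl
    rw [runs_branch, holds_conj, holds_gle (by simpa [Expr.eval, g1, hr] using hj)
      (by simpa [Expr.eval, g2, g3] using him)]
    simp only [runs_store, RAM.mem, Cond.Holds, Cond.cost, Expr.eval, Expr.cost, hr, g1, g2, g3, g4,
      State.setReg_arr, State.setArr_arr, if_true]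
    refine ⟨fun hc => ⟨by omega, fun u hu => ?_⟩, fun hc => ⟨by omega, fun u hu => ?_⟩⟩ <;>
    · by_cases huj : u = j
      · subst huj; simp [hc]
      · rw [Function.update_of_ne huj]; exact hI u (by omega)
  · rintro s' t - ⟨T, ⟨hT, hI⟩, ht⟩
    exact ⟨by omega, hI⟩

theorem runs_lowEdges (hm : s.reg .m = D.m) (hE : s.grades .eGrade = D.LE) {i : ℕ}
    (hi : s.reg .i = i) (him : i < D.m) :
    Runs (forTo .j (.reg .m) (.branch
        (.conj (.conj (mem .edges (.reg .j)) (.gle .eGrade (.reg .j) .eGrade (.reg .i)))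
          (.neg (.eq (.reg .j) (.reg .i))))
        (.store .lowEdges (.reg .j) (.const 1)) (.store .lowEdges (.reg .j) (.const 0)))) s
      fun s' t => t ≤ 100 * (D.m + 1) ∧
        ∀ e < D.m, s'.arr .lowEdges e = 1 ↔ (s.arr .edges e = 1 ∧ e ≠ i) ∧ D.fE e ≤ D.fE i := by
  refine (Runs.forTo D.m (fun j s' T => T ≤ 2 + 50 * j ∧
    ∀ e < j, s'.arr .lowEdges e = 1 ↔ (s.arr .edges e = 1 ∧ e ≠ i) ∧ D.fE e ≤ D.fE i)
    hm (by simp) rfl rfl (by simp) ?_).mono ?_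
  · rintro j s' T hj hr hf ⟨hT, hI⟩
    have g2 : s'.grades .eGrade = D.LE := (hf.grades _ rfl).trans hE
    have g3 : s'.reg .i = i := (hf.reg _ rfl).trans hi
    have g4 : s'.arr .edges = s.arr .edges := hf.arr _ rfl
    rw [runs_branch, holds_conj, holds_conj, holds_gle (by simpa [Expr.eval, g2, hr] using hj)
      (by simpa [Expr.eval, g2, g3] using him)]
    simp only [runs_store, RAM.mem, Cond.Holds, Cond.cost, Expr.eval, Expr.cost, hr, g2, g3, g4,
      State.setReg_arr, State.setArr_arr, if_true]
    refine ⟨fun hc => ⟨by omega, fun u hu => ?_⟩, fun hc => ⟨by omega, fun u hu => ?_⟩⟩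
    all_goals
      by_cases huj : u = j
      · subst huj; rw [Function.update_self]; grind
      · rw [Function.update_of_ne huj]; exact hI u (by omega)
  · rintro s' t - ⟨T, ⟨hT, hI⟩, ht⟩
    exact ⟨by omega, hI⟩

/-- The deletion of edges keeps the connectivity at every grade, and no remaining edge joins two
vertices that are already joined by other remaining edges of at most its grade. -/
theorem runs_deleteEdges (h : Collapsed D φ s) :
    Runs (forTo .i (.reg .m) (when (mem .edges (.reg .i))
      (forTo .j (.reg .n) (.branch
        (.conj (mem .verts (.reg .j)) (.gle .vGrade (.reg .j) .eGrade (.reg .i)))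
        (.store .lowVerts (.reg .j) (.const 1)) (.store .lowVerts (.reg .j) (.const 0))) ;;
      forTo .j (.reg .m) (.branch
        (.conj (.conj (mem .edges (.reg .j)) (.gle .eGrade (.reg .j) .eGrade (.reg .i)))
          (.neg (.eq (.reg .j) (.reg .i))))
        (.store .lowEdges (.reg .j) (.const 1)) (.store .lowEdges (.reg .j) (.const 0))) ;;
      breadthFirst ;;
      when (mem .visited (.arr .tgt (.reg .i))) (.store .edges (.reg .i) (.const 0))))) s
    fun s' t => t ≤ 2000 * (D.n + D.m + 1) * (D.m + 1) ∧
      (∀ e < D.m, Linked D.m (s.arr .src) (s.arr .tgt) D.fE (fun d => s'.arr .edges d = 1) (D.fE e)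
        (s.arr .src e) (s.arr .tgt e)) ∧
      ∀ e < D.m, s'.arr .edges e = 1 → ¬ Linked D.m (s.arr .src) (s.arr .tgt) D.fE
        (fun d => s'.arr .edges d = 1 ∧ d ≠ e) (D.fE e) (s.arr .src e) (s.arr .tgt e) := by
  refine (Runs.forTo D.m (fun i s' T => T ≤ 2 + 1500 * (D.n + D.m + 1) * i ∧
      (∀ e < D.m, Linked D.m (s.arr .src) (s.arr .tgt) D.fE (fun d => s'.arr .edges d = 1) (D.fE e)
        (s.arr .src e) (s.arr .tgt e)) ∧
      (∀ e < D.m, s'.arr .edges e = 1 → s.arr .edges e = 1) ∧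
      ∀ e < i, s'.arr .edges e = 1 → ¬ Linked D.m (s.arr .src) (s.arr .tgt) D.fE
        (fun d => s'.arr .edges d = 1 ∧ d ≠ e) (D.fE e) (s.arr .src e) (s.arr .tgt e))
    h.reg_m (by simp) rfl rfl ⟨by simp, ?_, by simp, by simp⟩ ?_).mono ?_
  · intro e he
    by_cases hE : s.arr .edges e = 1
    · exact Linked.of_edge he hE le_rfl
    · rw [h.src e he, h.tgt e he, h.removed e he hE]; exact .refl _
  · rintro i s' T hi hr hf ⟨hT, hI₁, hI₂, hI₃⟩
    have hexp : 1500 * (D.n + D.m + 1) * (i + 1) =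
        1500 * (D.n + D.m + 1) * i + 1500 * (D.n + D.m + 1) := by ring
    have g1 : s'.arr .src = s.arr .src := hf.arr _ rfl
    have g2 : s'.arr .tgt = s.arr .tgt := hf.arr _ rfl
    have g3 : s'.arr .verts = s.arr .verts := hf.arr _ rfl
    have hn' : s'.reg .n = D.n := (hf.reg _ rfl).trans h.reg_n
    have hm' : s'.reg .m = D.m := (hf.reg _ rfl).trans h.reg_m
    have hV' : s'.grades .vGrade = D.LV := (hf.grades _ rfl).trans h.vGrade
    have hE' : s'.grades .eGrade = D.LE := (hf.grades _ rfl).trans h.eGrade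
    rw [runs_when]
    simp only [RAM.mem, Expr.eval, Expr.cost, Cond.cost, Cond.Holds, hr]
    refine ⟨fun hc => ?_, fun hc => ⟨?_, hI₁, hI₂, fun e he h1 => ?_⟩⟩
    · rw [runs_seq]
      refine (runs_lowVerts hn' hV' hE' hr hi).mono ?_
      rintro s₁ t₁ hf₁ ⟨ht₁, hlv₁⟩
      rw [runs_seq]
      refine (runs_lowEdges ((hf₁.reg _ rfl).trans hm') ((hf₁.grades _ rfl).trans hE')
        ((hf₁.reg _ rfl).trans hr) hi).mono ?_
      rintro s₂ t₂ hf₂ ⟨ht₂, hle₂⟩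
      have hr₂ : s₂.reg .i = i := (hf₂.reg _ rfl).trans ((hf₁.reg _ rfl).trans hr)
      have k1 : s₂.arr .src = s.arr .src := (hf₂.arr _ rfl).trans ((hf₁.arr _ rfl).trans g1)
      have k2 : s₂.arr .tgt = s.arr .tgt := (hf₂.arr _ rfl).trans ((hf₁.arr _ rfl).trans g2)
      have k3 : s₂.arr .lowVerts = s₁.arr .lowVerts := hf₂.arr _ rfl
      have k4 : s₁.arr .edges = s'.arr .edges := hf₁.arr _ rfl
      rw [k4] at hle₂
      rw [runs_seq]
      refine (runs_breadthFirst (n := D.n) (m := D.m)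
        ((hf₂.reg _ rfl).trans ((hf₁.reg _ rfl).trans hn'))
        ((hf₂.reg _ rfl).trans ((hf₁.reg _ rfl).trans hm')) hr₂ hi ?_ ?_).mono ?_
      · intro e he
        rw [k1, k2]
        exact ⟨h.src_lt he, h.tgt_lt he⟩
      · intro e he hle
        have h1 := (hle₂ e he).1 hle
        have h2 := h.map_of_joins he (.inl ⟨rfl, rfl⟩)
        rw [k1, k2, k3, hlv₁ _ (h.src_lt he), hlv₁ _ (h.tgt_lt he), g3, h.verts _ (h.src_lt he),
          h.verts _ (h.tgt_lt he)]
        exact ⟨⟨h2.1, (h.src_le he).trans h1.2⟩, ⟨h2.2, (h.tgt_le he).trans h1.2⟩⟩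
      · rintro s₃ t₃ hf₃ ⟨ht₃, hvis⟩
        have hr₃ : s₃.reg .i = i := (hf₃.reg _ rfl).trans hr₂
        have k5 : s₃.arr .tgt = s.arr .tgt := (hf₃.arr _ rfl).trans k2
        have k6 : s₃.arr .edges = s'.arr .edges :=
          (hf₃.arr _ rfl).trans ((hf₂.arr _ rfl).trans k4)
        have hiff := hvis _ (h.tgt_lt hi)
        rw [k1, k2, ← linked_iff_reflTransGen (f := D.fE) (r := D.fE i)
          (E := fun e => s'.arr .edges e = 1 ∧ e ≠ i) hle₂] at hiff
        rw [runs_when, runs_store]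
        simp only [Expr.eval, Expr.cost, Cond.cost, Cond.Holds, hr₃, k5, hiff, State.setReg_arr,
          State.setArr_arr, if_true, k6]
        refine ⟨fun hl => ⟨?_, fun e he => ?_, fun e he h1 => ?_, fun e he h1 => ?_⟩,
          fun hl => ⟨?_, hI₁, hI₂, fun e he h1 => ?_⟩⟩
        · omega
        · refine (Linked.erase hl (hI₁ e he)).mono (fun d hd hd' => ?_) le_rfl
          rw [Function.update_of_ne hd'.2]; exact hd'.1
        · by_cases hei : e = i
          · subst hei; exact hI₂ e he hc
          · rw [Function.update_of_ne hei] at h1; exact hI₂ e he h1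
        · have hei : e ≠ i := by
            rintro rfl; simp at h1
          rw [Function.update_of_ne hei] at h1
          refine fun hl' => hI₃ e (by omega) h1 (hl'.mono (fun d hd hd' => ⟨?_, hd'.2⟩) le_rfl)
          by_cases hdi : d = i
          · rw [hdi]; exact hc
          · rw [Function.update_of_ne hdi] at hd'; exact hd'.1
        · omega
        · by_cases hei : e = i
          · subst hei; exact hl
          · exact hI₃ e (by omega) h1
    · omega
    · have hei : e ≠ i := by
        rintro rfl; exact hc h1
      exact hI₃ e (by omega) h1
  · rintro s' t - ⟨T, ⟨hT, hI₁, hI₂, hI₃⟩, ht⟩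
    refine ⟨?_, hI₁, hI₃⟩
    have : 2000 * (D.n + D.m + 1) * (D.m + 1) = 1500 * (D.n + D.m + 1) * D.m +
      (500 * (D.n + D.m + 1) * D.m + 2000 * (D.n + D.m + 1)) := by ring
    omega

end Presentation

section Output

theorem length_filterMap_getElem? {P : Type*} (L : List P) {l : List ℕ}
    (h : ∀ i ∈ l, i < L.length) :
    (l.filterMap (L[·]?)).length = l.length := by
  induction l with
  | nil => rfl
  | cons a l ih =>
    have ha : a < L.length := h a (by simp)
    have := ih fun i hi => h i (by simp [hi])
    simp [ha, this]

theorem getElem_filterMap_getElem? {P : Type*} (L : List P) {l : List ℕ}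
    (h : ∀ i ∈ l, i < L.length) (k : ℕ) (hk : k < l.length) :
    (l.filterMap (L[·]?))[k]? = L[l[k]]? := by
  induction l generalizing k with
  | nil => simp at hk
  | cons a l ih =>
    have ha : a < L.length := h a (by simp)
    cases k with
    | zero => simp [ha]
    | succ k =>
      have := ih (fun i hi => h i (by simp [hi])) k (by simpa using hk)
      simp [ha, this]

variable {P : Type u} [PartialOrder P]

/-- `φ` maps the vertices to representatives of smaller or equal grade without changing connected
components, and every edge is collapsed or has a grade above those of its new endpoints. -/
structure IsVertexMinimal (D : ListedGraph P) (φ : ℕ → ℕ) : Prop where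
  map_lt : ∀ u < D.n, φ u < D.n
  map_map : ∀ u < D.n, φ (φ u) = φ u
  grade_le : ∀ u < D.n, D.fV (φ u) ≤ D.fV u
  linked : ∀ u < D.n, Linked D.m D.src D.tgt D.fE (fun _ => True) (D.fV u) (φ u) u
  edge : ∀ e < D.m, φ (D.src e) = φ (D.tgt e) ∨
    (D.fV (φ (D.src e)) < D.fE e ∧ D.fV (φ (D.tgt e)) < D.fE e)

/-- The edges in `es` generate, at every grade, the same connected components of representatives
as all edges, and none of them can be omitted. -/
structure IsEdgeMinimal (D : ListedGraph P) (φ : ℕ → ℕ) (es : List ℕ) : Prop where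
  nodup : es.Nodup
  lt : ∀ e ∈ es, e < D.m
  linked : ∀ e < D.m, Linked D.m (fun d => φ (D.src d)) (fun d => φ (D.tgt d)) D.fE (· ∈ es)
    (D.fE e) (φ (D.src e)) (φ (D.tgt e))
  not_linked : ∀ e ∈ es, ¬ Linked D.m (fun d => φ (D.src d)) (fun d => φ (D.tgt d)) D.fE
    (fun d => d ∈ es ∧ d ≠ e) (D.fE e) (φ (D.src e)) (φ (D.tgt e))

/-- The list `vs` enumerates the representatives. -/
structure IsRepresentativeList (D : ListedGraph P) (φ : ℕ → ℕ) (vs : List ℕ) : Prop where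
  nodup : vs.Nodup
  mem : ∀ u, u ∈ vs ↔ u < D.n ∧ φ u = u

variable {D : ListedGraph P} {φ : ℕ → ℕ} {s : State P}

theorem Collapsed.isRepresentativeList (h : Collapsed D φ s) :
    IsRepresentativeList D φ (selected D.n (s.arr .verts)) := by
  refine ⟨nodup_selected _ _, fun u => ?_⟩
  rw [mem_selected]
  exact and_congr_right fun hu => h.verts u hu

theorem Collapsed.isVertexMinimal (h : Collapsed D φ s)
    (hedge : ∀ e < D.m, φ (D.src e) = φ (D.tgt e) ∨
      (D.fV (φ (D.src e)) < D.fE e ∧ D.fV (φ (D.tgt e)) < D.fE e)) : IsVertexMinimal D φ :=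
  ⟨h.map_lt, h.map_map, h.grade_le, h.linked, hedge⟩

/-- The entries of the columns of the edges in `es`, where `row u` is the row of the vertex `u`. -/
def matrixTriples (D : ListedGraph P) (φ : ℕ → ℕ) (row : ℕ → ℕ) (es : List ℕ) :
    List (ℕ × ℕ × ℤ) :=
  es.zipIdx.flatMap fun e =>
    [(row (φ (D.src e.1)), e.2 + 1, -1), (row (φ (D.tgt e.1)), e.2 + 1, 1)]

theorem runs_listVertices (hn : s.reg .n = D.n) (hV : s.grades .vGrade = D.LV)
    (h₀ : s.grades .beta0 = []) :
    Runs (forTo .i (.reg .n) (when (mem .verts (.reg .i))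
      (.append .beta0 .vGrade (.reg .i) ;; .store .rowIdx (.reg .i) (.length .beta0)))) s
    fun s' t => t ≤ 100 * (D.n + 1) ∧
      s'.grades .beta0 = (selected D.n (s.arr .verts)).filterMap (D.LV[·]?) ∧
      ∀ (k : ℕ) (hk : k < (selected D.n (s.arr .verts)).length),
        s'.arr .rowIdx ((selected D.n (s.arr .verts))[k]) = k + 1 := by
  refine (Runs.forTo D.n (fun i s' T => T ≤ 2 + 50 * i ∧
      s'.grades .beta0 = (selected i (s.arr .verts)).filterMap (D.LV[·]?) ∧
      ∀ (k : ℕ) (hk : k < (selected i (s.arr .verts)).length),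
        s'.arr .rowIdx ((selected i (s.arr .verts))[k]) = k + 1)
    hn (by simp) rfl rfl ⟨by simp, by simpa [selected] using h₀, ?_⟩ ?_).mono ?_
  · intro k hk
    simp [selected] at hk
  · rintro i s' T hi hr hf ⟨hT, hI₁, hI₂⟩
    have g1 : s'.arr .verts = s.arr .verts := hf.arr _ rfl
    have g2 : s'.grades .vGrade = D.LV := (hf.grades _ rfl).trans hV
    have hlen := length_filterMap_getElem? D.LV (l := selected i (s.arr .verts))
      fun j hj => (mem_selected.1 hj).1.trans hi
    rw [runs_when]
    simp only [runs_seq, runs_append, runs_store, RAM.mem, Expr.eval, Expr.cost, Cond.cost,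
      Cond.Holds, hr, g1, g2, State.setReg_arr, State.setReg_grades, State.setArr_grades,
      State.setGrades_arr, State.setGrades_reg, State.setGrades_grades, State.setArr_arr, if_true]
    refine ⟨fun hc => ⟨D.LV[i], by simp [hi], by omega, ?_, fun k hk => ?_⟩,
      fun hc => ⟨by omega, ?_, fun k hk => ?_⟩⟩
    · simp [selected_succ, hc, hI₁, hi]
    · simp only [selected_succ, hc, if_true, List.length_append, List.length_singleton] at hk ⊢
      by_cases hk' : k < (selected i (s.arr .verts)).length
      · rw [List.getElem_append_left hk']
        have := (mem_selected.1 (List.getElem_mem hk')).1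
        rw [Function.update_of_ne (by omega)]
        exact hI₂ k hk'
      · have hkl : k = (selected i (s.arr .verts)).length := by omega
        subst hkl
        simp [hI₁, hlen]
    · simp [selected_succ, hc, hI₁]
    · simp only [selected_succ, hc, if_false, List.append_nil] at hk ⊢
      exact hI₂ k hk
  · rintro s' t - ⟨T, ⟨hT, hI⟩, ht⟩
    exact ⟨by omega, hI⟩

theorem runs_listEdges (hm : s.reg .m = D.m) (hE : s.grades .eGrade = D.LE)
    (h₀ : s.grades .beta1 = []) (h₁ : s.triples = [])
    (hs : ∀ e < D.m, s.arr .src e = φ (D.src e)) (ht : ∀ e < D.m, s.arr .tgt e = φ (D.tgt e)) :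
    Runs (forTo .i (.reg .m) (when (mem .edges (.reg .i))
      (.append .beta1 .eGrade (.reg .i) ;;
        .appendTriple (.arr .rowIdx (.arr .src (.reg .i))) (.length .beta1) (-1) ;;
        .appendTriple (.arr .rowIdx (.arr .tgt (.reg .i))) (.length .beta1) 1))) s
    fun s' t => t ≤ 100 * (D.m + 1) ∧
      s'.grades .beta1 = (selected D.m (s.arr .edges)).filterMap (D.LE[·]?) ∧
      s'.triples = matrixTriples D φ (s.arr .rowIdx) (selected D.m (s.arr .edges)) := by
  refine (Runs.forTo D.m (fun i s' T => T ≤ 2 + 50 * i ∧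
      s'.grades .beta1 = (selected i (s.arr .edges)).filterMap (D.LE[·]?) ∧
      s'.triples = matrixTriples D φ (s.arr .rowIdx) (selected i (s.arr .edges)))
    hm (by simp) rfl rfl ⟨by simp, by simpa [selected] using h₀,
      by simpa [selected, matrixTriples] using h₁⟩ ?_).mono ?_
  · rintro i s' T hi hr hf ⟨hT, hI₁, hI₂⟩
    have g1 : s'.arr .edges = s.arr .edges := hf.arr _ rfl
    have g2 : s'.grades .eGrade = D.LE := (hf.grades _ rfl).trans hE
    have g3 : s'.arr .src = s.arr .src := hf.arr _ rfl
    have g4 : s'.arr .tgt = s.arr .tgt := hf.arr _ rfl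
    have g5 : s'.arr .rowIdx = s.arr .rowIdx := hf.arr _ rfl
    have hlen := length_filterMap_getElem? D.LE (l := selected i (s.arr .edges))
      fun j hj => (mem_selected.1 hj).1.trans hi
    rw [runs_when]
    simp only [runs_seq, runs_append, runs_appendTriple, RAM.mem, Expr.eval, Expr.cost, Cond.cost,
      Cond.Holds, hr, g1, g2, g3, g4, g5, State.setReg_grades, State.setReg_triples,
      State.setGrades_arr, State.setGrades_reg, State.setGrades_grades, State.setGrades_triples,
      if_true]
    refine ⟨fun hc => ⟨D.LE[i], by simp [hi], by omega, ?_, ?_⟩, fun hc => ⟨by omega, ?_, ?_⟩⟩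
    · simp [selected_succ, hc, hI₁, hi]
    · simp [selected_succ, hc, hI₁, hI₂, hlen, matrixTriples, List.zipIdx_append, hs i hi, ht i hi]
    · simp [selected_succ, hc, hI₁]
    · simp [selected_succ, hc, hI₂]
  · rintro s' t - ⟨T, ⟨hT, hI⟩, ht⟩
    exact ⟨by omega, hI⟩

theorem runs_presentation (h : HoldsInput D s) :
    Runs presentation s fun s' t => t ≤ 7000 * (D.n + D.m + 1) ^ 2 ∧ ∃ φ vs es row,
      IsVertexMinimal D φ ∧ IsRepresentativeList D φ vs ∧ IsEdgeMinimal D φ es ∧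
      (∀ (k : ℕ) (hk : k < vs.length), row vs[k] = k + 1) ∧
      s'.grades .beta0 = vs.filterMap (D.LV[·]?) ∧ s'.grades .beta1 = es.filterMap (D.LE[·]?) ∧
      s'.triples = matrixTriples D φ row es := by
  simp only [presentation]
  rw [runs_seq, runs_clear, runs_seq, runs_clear, runs_seq, runs_clearTriples, runs_seq]
  refine Runs.mono (s := { (s.setGrades .beta0 []).setGrades .beta1 [] with triples := [] })
    (runs_vertexCollapse (D := D) ⟨h.reg_n, h.reg_m, ?_, ?_, h.src, h.tgt⟩) ?_
  · simpa using h.vGrade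
  · simpa using h.eGrade
  rintro s₁ t₁ hf₁ ⟨ht₁, φ, h₁, hmin, -⟩
  rw [runs_seq]
  refine (runs_deleteEdges h₁).mono ?_
  rintro s₂ t₂ hf₂ ⟨ht₂, hl, hnl⟩
  rw [runs_seq]
  refine (runs_listVertices (D := D) ((hf₂.reg _ rfl).trans h₁.reg_n)
    ((hf₂.grades _ rfl).trans h₁.vGrade)
    ((hf₂.grades _ rfl).trans ((hf₁.grades _ rfl).trans (by simp)))).mono ?_
  rintro s₃ t₃ hf₃ ⟨ht₃, hβ₃, hrow⟩
  have k1 : s₃.arr .src = s₁.arr .src := (hf₃.arr _ rfl).trans (hf₂.arr _ rfl)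
  have k2 : s₃.arr .tgt = s₁.arr .tgt := (hf₃.arr _ rfl).trans (hf₂.arr _ rfl)
  have k3 : s₃.arr .edges = s₂.arr .edges := hf₃.arr _ rfl
  have k4 : s₂.arr .verts = s₁.arr .verts := hf₂.arr _ rfl
  refine (runs_listEdges (D := D) (φ := φ)
    ((hf₃.reg _ rfl).trans ((hf₂.reg _ rfl).trans h₁.reg_m))
    ((hf₃.grades _ rfl).trans ((hf₂.grades _ rfl).trans h₁.eGrade))
    ((hf₃.grades _ rfl).trans ((hf₂.grades _ rfl).trans ((hf₁.grades _ rfl).trans (by simp)))) ?_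
    (by rw [k1]; exact h₁.src) (by rw [k2]; exact h₁.tgt)).mono ?_
  · rw [hf₃.triples rfl, hf₂.triples rfl, hf₁.triples rfl]
  · rintro s₄ t₄ hf₄ ⟨ht₄, hβ₄, htr⟩
    rw [k3] at hβ₄ htr
    rw [k4] at hβ₃ hrow
    refine ⟨?_, φ, _, _, s₃.arr .rowIdx, h₁.isVertexMinimal hmin, h₁.isRepresentativeList,
      ⟨nodup_selected D.m (s₂.arr .edges), fun e he => (mem_selected.1 he).1, fun e he => ?_,
        fun e he hl' => ?_⟩, hrow, (hf₄.grades _ rfl).trans hβ₃, hβ₄, htr⟩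
    · have : 2000 * (D.n + D.m + 1) * (D.m + 1) ≤ 2000 * (D.n + D.m + 1) * (D.n + D.m + 1) :=
        Nat.mul_le_mul le_rfl (by omega)
      have : D.n + D.m + 1 ≤ (D.n + D.m + 1) ^ 2 := Nat.le_self_pow (by norm_num) _
      have : 2000 * (D.n + D.m + 1) * (D.n + D.m + 1) = 2000 * (D.n + D.m + 1) ^ 2 := by ring
      omega
    · rw [← h₁.src e he, ← h₁.tgt e he]
      exact (hl e he).congr h₁.src h₁.tgt fun d hd hE => mem_selected.2 ⟨hd, hE⟩
    · obtain ⟨he', hE⟩ := mem_selected.1 he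
      rw [← h₁.src e he', ← h₁.tgt e he'] at hl'
      refine hnl e he' hE (hl'.congr (fun d hd => (h₁.src d hd).symm)
        (fun d hd => (h₁.tgt d hd).symm) fun d hd hE => ⟨(mem_selected.1 hE.1).2, hE.2⟩)

end Output

end RAM

/-! ### Free persistence modules and minimal presentations -/

section FreeModules

variable {k : Type v} [Field k] {P : Type u} [PartialOrder P]

namespace freeModule

variable {I J : Type} {g : I → P} {g' : J → P} {M N : PersistenceModule k P}

/-- The component at `r` of a morphism from a free module, as a linear map on finitely supported
functions. -/
noncomputable def appHom (π : freeModule k g ⟶ M) (r : P) :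
    ({i : I // g i ≤ r} →₀ k) →ₗ[k] M.obj r := (π.app r).hom

theorem _root_.IsSurjective.appHom {π : freeModule k g ⟶ M} (h : IsSurjective π) (r : P) :
    Function.Surjective (appHom π r) := h r

/-- The structure map of a free module from `r` to `s`. -/
noncomputable def shift (k : Type v) [Field k] (g : I → P) {r s : P} (h : r ≤ s) :
    ({i : I // g i ≤ r} →₀ k) →ₗ[k] ({i : I // g i ≤ s} →₀ k) :=
  Finsupp.lmapDomain k k fun i => ⟨i.1, i.2.trans h⟩

@[simp] theorem shift_single {r s : P} (h : r ≤ s) (i : {i : I // g i ≤ r}) (a : k) :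
    shift k g h (Finsupp.single i a) = Finsupp.single ⟨i.1, i.2.trans h⟩ a := by
  simp [shift, Finsupp.mapDomain_single]

theorem appHom_shift (π : freeModule k g ⟶ M) {r s : P} (h : r ≤ s)
    (x : {i : I // g i ≤ r} →₀ k) :
    appHom π s (shift k g h x) = (M.map (homOfLE h)).hom (appHom π r x) :=
  congrArg (fun f => f.hom x) (π.naturality (homOfLE h))

theorem appHom_single (π : freeModule k g ⟶ M) {r : P} (i : {i : I // g i ≤ r}) (a : k) :
    appHom π r (Finsupp.single i a) =
      a • (M.map (homOfLE i.2)).hom (appHom π (g i) (Finsupp.single ⟨i, le_rfl⟩ 1)) := by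
  rw [← appHom_shift, shift_single, ← map_smul, Finsupp.smul_single, smul_eq_mul, mul_one]

/-- The component at `r` of the morphism from a free module that maps the generators to the
elements `x i`. -/
noncomputable def descHom (x : ∀ i, M.obj (g i)) (r : P) :
    ({i : I // g i ≤ r} →₀ k) →ₗ[k] M.obj r :=
  Finsupp.linearCombination k fun i : {i : I // g i ≤ r} => (M.map (homOfLE i.2)).hom (x i.1)

theorem descHom_single (x : ∀ i, M.obj (g i)) {r : P} (i : {i : I // g i ≤ r}) (a : k) :
    descHom x r (Finsupp.single i a) = a • (M.map (homOfLE i.2)).hom (x i) :=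
  Finsupp.linearCombination_single _ _ _

theorem descHom_shift (x : ∀ i, M.obj (g i)) {r s : P} (h : r ≤ s) :
    descHom x s ∘ₗ shift k g h = (M.map (homOfLE h)).hom ∘ₗ descHom x r := by
  refine Finsupp.lhom_ext fun i a => ?_
  have e : homOfLE i.2 ≫ homOfLE h = homOfLE (i.2.trans h) := rfl
  rw [LinearMap.comp_apply, LinearMap.comp_apply, shift_single, descHom_single, descHom_single,
    map_smul, ← e, M.map_comp]
  rfl

/-- A morphism from a free module is given by the images of the generators. -/
noncomputable def desc (x : ∀ i, M.obj (g i)) : freeModule k g ⟶ M where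
  app r := ModuleCat.ofHom (descHom x r)
  naturality _ _ h := ModuleCat.hom_ext (descHom_shift x (leOfHom h))

theorem appHom_desc_single (x : ∀ i, M.obj (g i)) {r : P} (i : {i : I // g i ≤ r}) (a : k) :
    appHom (desc x) r (Finsupp.single i a) = a • (M.map (homOfLE i.2)).hom (x i) :=
  descHom_single x i a

theorem hom_ext {π π' : freeModule k g ⟶ M}
    (h : ∀ i, appHom π (g i) (Finsupp.single ⟨i, le_rfl⟩ 1) =
      appHom π' (g i) (Finsupp.single ⟨i, le_rfl⟩ 1)) : π = π' := by
  ext r y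
  change appHom π r y = appHom π' r y
  induction y using Finsupp.induction_linear with
  | zero => simp
  | add a b ha hb => rw [map_add, map_add, ha, hb]
  | single i a => rw [appHom_single π i a, appHom_single π' i a, h]

/-- Free modules are projective. -/
theorem exists_lift (π : M ⟶ N) (hπ : IsSurjective π) (f : freeModule k g ⟶ N) :
    ∃ α : freeModule k g ⟶ M, α ≫ π = f := by
  choose x hx using fun i => hπ (g i) (appHom f (g i) (Finsupp.single ⟨i, le_rfl⟩ 1))
  refine ⟨desc x, hom_ext fun i => ?_⟩
  rw [← hx i]
  change (π.app (g i)).hom (appHom (desc x) (g i) (Finsupp.single ⟨i, le_rfl⟩ 1)) = _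
  rw [appHom_desc_single, one_smul]
  have : (homOfLE (le_refl (g i))) = 𝟙 (g i) := rfl
  simp only [this, M.map_id]
  rfl

/-- The component at `r` of a morphism of free modules, as a linear map between spaces of finitely
supported functions. -/
noncomputable def component (α : freeModule k g' ⟶ freeModule k g) (r : P) :
    ({j : J // g' j ≤ r} →₀ k) →ₗ[k] ({i : I // g i ≤ r} →₀ k) := (α.app r).hom

theorem component_shift (α : freeModule k g' ⟶ freeModule k g) {r s : P} (h : r ≤ s)
    (x : {j : J // g' j ≤ r} →₀ k) :
    component α s (shift k g' h x) = shift k g h (component α r x) :=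
  appHom_shift α h x

end freeModule

open freeModule

/-- The kernel of a morphism from a free module is contained in the radical: at the grade `r`, the
elements of the kernel do not involve the generators of grade `r`. -/
def HasRadicalKernel {I : Type} {g : I → P} {M : PersistenceModule k P} (π : freeModule k g ⟶ M) :
    Prop :=
  ∀ (r : P) (x : {i : I // g i ≤ r} →₀ k), appHom π r x = 0 →
    ∀ (i : I) (hi : g i = r), x ⟨i, hi.le⟩ = 0

variable {I J : Type} [Finite I] [Finite J] {g : I → P} {g' : J → P} {M : PersistenceModule k P}

/-- A surjection from a free module with kernel in the radical has the least possible number of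
generators of every grade: the generators of grade `r` are independent modulo the images of
the structure maps from grades below `r`. -/
theorem HasRadicalKernel.gradeCount_le {π : freeModule k g ⟶ M} (hπ : IsSurjective π)
    (hrad : HasRadicalKernel π) {π' : freeModule k g' ⟶ M} (hπ' : IsSurjective π') (r : P) :
    gradeCount g r ≤ gradeCount g' r := by
  have hs : Function.Surjective (appHom π r) := hπ r
  obtain ⟨σ, hσ⟩ := (appHom π r).exists_rightInverse_of_surjective (LinearMap.range_eq_top.2 hs)
  have hinj : Function.Injective (fun i : {i : I // g i = r} =>
      (⟨i.1, i.2.le⟩ : {i : I // g i ≤ r})) := fun a b h => Subtype.ext (congrArg (·.1) h)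
  let p : ({i : I // g i ≤ r} →₀ k) →ₗ[k] ({i : I // g i = r} →₀ k) :=
    Finsupp.lcomapDomain _ hinj
  have hp : ∀ x i, p x i = x ⟨i.1, i.2.le⟩ := fun x i => rfl
  -- `p` factors through `appHom π r`
  let ρ : M.obj r →ₗ[k] ({i : I // g i = r} →₀ k) := p ∘ₗ σ
  have hρ : ∀ x, ρ (appHom π r x) = p x := by
    intro x
    have h0 : appHom π r (x - σ (appHom π r x)) = 0 := by
      rw [map_sub, sub_eq_zero]
      exact (congrArg (fun f => f (appHom π r x)) hσ).symm
    have h1 : p (x - σ (appHom π r x)) = 0 := by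
      ext i
      exact hrad r _ h0 i.1 i.2
    rw [map_sub, sub_eq_zero] at h1
    exact h1.symm
  have hρs : Function.Surjective ρ := by
    intro y
    refine ⟨appHom π r (Finsupp.mapDomain (fun i => ⟨i.1, i.2.le⟩) y), ?_⟩
    rw [hρ]
    ext i
    rw [hp]
    exact Finsupp.mapDomain_apply hinj y i
  have hlow : ∀ (q : P) (h : q < r) (y : M.obj q), ρ ((M.map (homOfLE h.le)).hom y) = 0 := by
    intro q h y
    obtain ⟨z, rfl⟩ := hπ.appHom q y
    rw [← appHom_shift, hρ]
    ext i
    rw [hp]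
    refine Finsupp.mapDomain_of_notMem_range _ _ ?_
    rintro ⟨j, hj⟩
    have h2 : j.1 = i.1 := congrArg (·.1) hj
    have h3 := j.2
    rw [h2, i.2] at h3
    exact h.not_ge h3
  let Θ : ({j : J // g' j = r} →₀ k) →ₗ[k] ({i : I // g i = r} →₀ k) :=
    Finsupp.linearCombination k fun j =>
      ρ (appHom π' r (Finsupp.single ⟨j.1, j.2.le⟩ 1))
  have hΘ : Function.Surjective Θ := by
    intro y
    obtain ⟨z, rfl⟩ := hρs y
    obtain ⟨x, rfl⟩ := hπ'.appHom r z
    change ρ (appHom π' r x) ∈ LinearMap.range Θ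
    induction x using Finsupp.induction_linear with
    | zero => rw [map_zero, map_zero]; exact Submodule.zero_mem _
    | add a b ha hb => rw [map_add, map_add]; exact Submodule.add_mem _ ha hb
    | single j a =>
      rcases j.2.eq_or_lt with hj | hj
      · refine ⟨Finsupp.single ⟨j.1, hj⟩ a, ?_⟩
        rw [Finsupp.linearCombination_single, ← map_smul, ← map_smul, Finsupp.smul_single,
          smul_eq_mul, mul_one]
      · rw [appHom_single, map_smul, hlow _ hj, smul_zero]
        exact Submodule.zero_mem _
  have := Fintype.ofFinite {i : I // g i = r}
  have := Fintype.ofFinite {j : J // g' j = r}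
  have h := LinearMap.finrank_le_finrank_of_surjective hΘ
  rwa [Module.finrank_finsupp_self, Module.finrank_finsupp_self, ← Nat.card_eq_fintype_card,
    ← Nat.card_eq_fintype_card] at h

end FreeModules

section GradeCount

variable {P : Type u}

theorem finite_support_gradeCount {I : Type} [Finite I] (g : I → P) :
    (Function.support (gradeCount g)).Finite := by
  refine (Set.finite_range g).subset fun r hr => ?_
  by_contra h
  refine hr (Nat.card_eq_zero.2 (.inl ⟨fun i => h ⟨i.1, i.2⟩⟩))

theorem eq_of_le_of_finsum_le {β β' : P → ℕ} (hβ : (Function.support β').Finite)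
    (h : ∀ r, β r ≤ β' r) (hs : ∑ᶠ r, β' r ≤ ∑ᶠ r, β r) : β = β' := by
  have hsub : Function.support β ⊆ hβ.toFinset := fun r hr => by
    have := h r
    simp only [Function.mem_support, Set.Finite.coe_toFinset] at hr ⊢
    omega
  rw [finsum_eq_sum_of_support_subset β hsub,
    finsum_eq_sum_of_support_subset β' (s := hβ.toFinset) (by simp)] at hs
  have := (Finset.sum_eq_sum_iff_of_le fun r _ => h r).1
    (le_antisymm (Finset.sum_le_sum fun r _ => h r) hs)
  funext r
  by_cases hr : r ∈ hβ.toFinset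
  · exact this r hr
  · have h1 : β' r = 0 := by simpa using hr
    have := h r
    omega

end GradeCount

section ProjectiveCovers

open freeModule

variable {k : Type v} [Field k] {P : Type u} [PartialOrder P] {L M N : PersistenceModule k P}

theorem IsSurjective.comp {f : L ⟶ M} {g : M ⟶ N} (hf : IsSurjective f) (hg : IsSurjective g) :
    IsSurjective (f ≫ g) := fun r => (hg r).comp (hf r)

theorem isSurjective_of_isIso (f : M ⟶ N) [IsIso f] : IsSurjective f := fun r =>
  ((ConcreteCategory.isIso_iff_bijective (f.app r)).1 inferInstance).2

theorem IsFreeWithTable.finite_support {C : PersistenceModule k P} {β : P → ℕ}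
    (h : IsFreeWithTable C β) : (Function.support β).Finite := by
  obtain ⟨l, g, -, rfl⟩ := h
  exact finite_support_gradeCount g

variable {l : ℕ} {g : Fin l → P} {π : freeModule k g ⟶ M}

theorem HasRadicalKernel.le_table (hrad : HasRadicalKernel π) (hπ : IsSurjective π)
    {C : PersistenceModule k P} {β : P → ℕ} (hC : IsFreeWithTable C β) {π' : C ⟶ M}
    (hπ' : IsSurjective π') (r : P) : gradeCount g r ≤ β r := by
  obtain ⟨l', g', ⟨e⟩, rfl⟩ := hC
  exact hrad.gradeCount_le hπ ((isSurjective_of_isIso e.inv).comp hπ') r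

theorem HasRadicalKernel.isProjectiveCover (hrad : HasRadicalKernel π) (hπ : IsSurjective π) :
    IsProjectiveCover π := by
  refine ⟨hπ, gradeCount g, ⟨l, g, ⟨Iso.refl _⟩, rfl⟩, fun C' π' β' hπ' hC' => ?_⟩
  exact finsum_le_finsum' (finite_support_gradeCount g) hC'.finite_support
    (hrad.le_table hπ hC' hπ')

theorem HasRadicalKernel.isBettiZero (hrad : HasRadicalKernel π) (hπ : IsSurjective π) :
    IsBettiZero M (gradeCount g) := by
  refine ⟨⟨_, π, hrad.isProjectiveCover hπ⟩, fun C π' ⟨hπ', β, hC, hmin⟩ => ?_⟩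
  have h := eq_of_le_of_finsum_le hC.finite_support (hrad.le_table hπ hC hπ')
    (hmin _ π _ hπ ⟨l, g, ⟨Iso.refl _⟩, rfl⟩)
  rwa [h]

theorem IsProjectiveCover.comp_isIso {C : PersistenceModule k P} {f : C ⟶ M}
    (h : IsProjectiveCover f) (e : M ⟶ N) [IsIso e] : IsProjectiveCover (f ≫ e) := by
  obtain ⟨hf, β, hC, hmin⟩ := h
  refine ⟨hf.comp (isSurjective_of_isIso e), β, hC, fun C' π' β' hπ' hC' => ?_⟩
  exact hmin C' (π' ≫ inv e) β' (hπ'.comp (isSurjective_of_isIso _)) hC'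

theorem nonempty_equiv_of_gradeCount_eq {I J : Type} [Finite I] [Finite J] {g : I → P} {g' : J → P}
    (h : gradeCount g = gradeCount g') (r : P) : Nonempty ({i // g i ≤ r} ≃ {j // g' j ≤ r}) := by
  let e : ∀ q, {i // g i = q} ≃ {j // g' j = q} := fun q => (Finite.card_eq.1 (congrFun h q)).some
  let E : I ≃ J := ((Equiv.sigmaFiberEquiv g).symm.trans (Equiv.sigmaCongrRight e)).trans
    (Equiv.sigmaFiberEquiv g')
  have hE : ∀ i, g' (E i) = g i := fun i => (e (g i) ⟨i, rfl⟩).2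
  exact ⟨E.subtypeEquiv fun i => by rw [hE]⟩

/-- A projective cover of `M` factors through every surjection with kernel in the radical, by an
isomorphism. -/
theorem HasRadicalKernel.exists_isIso (hrad : HasRadicalKernel π) (hπ : IsSurjective π)
    {C : PersistenceModule k P} {d : C ⟶ M} (hd : IsProjectiveCover d) :
    ∃ α : C ⟶ freeModule k g, IsIso α ∧ α ≫ π = d := by
  obtain ⟨l', g', ⟨e⟩, hg'⟩ := (hrad.isBettiZero hπ).2 C d hd
  obtain ⟨α, hα⟩ := exists_lift π hπ (e.inv ≫ d)
  have hcomp : ∀ r x, appHom π r (component α r x) = appHom (e.inv ≫ d) r x := by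
    intro r x
    rw [← hα]
    rfl
  -- every generator lies in the image of `α`, by induction on its grade
  have hgen : ∀ i, Finsupp.single ⟨i, le_rfl⟩ 1 ∈ LinearMap.range (component α (g i)) := by
    have hwf : WellFounded fun a b : Fin l => g a < g b :=
      haveI : IsTrans (Fin l) fun a b => g a < g b := ⟨fun _ _ _ => lt_trans⟩
      haveI : Std.Irrefl fun a b : Fin l => g a < g b := ⟨fun _ => lt_irrefl _⟩
      Finite.wellFounded_of_trans_of_irrefl _
    intro i
    induction i using hwf.induction with
    | _ i ih =>
      have hsub : ∀ x : {j // g j ≤ g i} →₀ k, (∀ j (hj : g j = g i), x ⟨j, hj.le⟩ = 0) →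
          x ∈ LinearMap.range (component α (g i)) := by
        intro x hx
        rw [← Finsupp.sum_single x]
        refine Submodule.sum_mem _ fun j hj => ?_
        have hlt : g j < g i := j.2.lt_of_ne fun h => (Finsupp.mem_support_iff.1 hj) (hx j.1 h)
        obtain ⟨y, hy⟩ := ih j.1 hlt
        refine ⟨x j • shift k g' hlt.le y, ?_⟩
        rw [map_smul, component_shift, hy]
        rw [shift_single, Finsupp.smul_single, smul_eq_mul, mul_one]
      obtain ⟨y, hy⟩ := ((isSurjective_of_isIso e.inv).comp hd.1).appHom (g i)
        (appHom π (g i) (Finsupp.single ⟨i, le_rfl⟩ 1))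
      have h0 : appHom π (g i) (Finsupp.single ⟨i, le_rfl⟩ 1 - component α (g i) y) = 0 := by
        rw [map_sub, sub_eq_zero, ← hy]
        exact (hcomp _ _).symm
      have h1 := hsub _ (hrad (g i) _ h0)
      have h2 := Submodule.add_mem _ h1 (LinearMap.mem_range_self (component α (g i)) y)
      rwa [sub_add_cancel] at h2
  have hsurj : ∀ r, Function.Surjective (component α r) := by
    intro r x
    change x ∈ LinearMap.range (component α r)
    rw [← Finsupp.sum_single x]
    refine Submodule.sum_mem _ fun j hj => ?_
    obtain ⟨y, hy⟩ := hgen j.1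
    refine ⟨x j • shift k g' j.2 y, ?_⟩
    rw [map_smul, component_shift, hy]
    rw [shift_single, Finsupp.smul_single, smul_eq_mul, mul_one]
  have hbij : ∀ r, Function.Bijective (component α r) := by
    intro r
    obtain ⟨eq⟩ := nonempty_equiv_of_gradeCount_eq hg' r
    classical
    have hfin : Module.finrank k ({i // g' i ≤ r} →₀ k) = Module.finrank k ({i // g i ≤ r} →₀ k) :=
      (Finsupp.domLCongr eq).finrank_eq
    exact ⟨(LinearMap.injective_iff_surjective_of_finrank_eq_finrank hfin).2 (hsurj r), hsurj r⟩
  have hiso : IsIso α := by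
    rw [NatTrans.isIso_iff_isIso_app]
    intro r
    rw [ConcreteCategory.isIso_iff_bijective]
    exact hbij r
  refine ⟨e.hom ≫ α, inferInstance, ?_⟩
  rw [Category.assoc, hα, Iso.hom_inv_id_assoc]

variable {l₁ : ℕ} {g₁ : Fin l₁ → P} {d : freeModule k g₁ ⟶ freeModule k g}

/-- A pointwise exact sequence of free modules with radical kernels is a minimal presentation. -/
theorem HasRadicalKernel.minimalPresentation (hrad : HasRadicalKernel π) (hπ : IsSurjective π)
    (hrad₁ : HasRadicalKernel d)
    (hexact : ∀ r x, appHom π r x = 0 ↔ ∃ y, component d r y = x) :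
    IsMinimalPresentation d π ∧ IsBettiOne M (gradeCount g₁) := by
  have w : d ≫ π = 0 := by
    ext r x
    exact (hexact r (component d r x)).2 ⟨x, rfl⟩
  have hι : ∀ r, Function.Injective ((kernel.ι π).app r).hom := fun r =>
    (ModuleCat.mono_iff_injective _).1 inferInstance
  have hlift : ∀ r x, ((kernel.ι π).app r).hom (((kernel.lift π d w).app r).hom x) =
      component d r x := by
    intro r x
    have := kernel.lift_ι π d w
    exact congrArg (fun f => (f.app r).hom x) this
  have hsurj : IsSurjective (kernel.lift π d w) := by
    intro r y
    have h0 : appHom π r (((kernel.ι π).app r).hom y) = 0 :=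
      congrArg (fun f => (f.app r).hom y) (kernel.condition π)
    obtain ⟨x, hx⟩ := (hexact r _).1 h0
    exact ⟨x, hι r ((hlift r x).trans hx)⟩
  have hrad' : HasRadicalKernel (kernel.lift π d w) := by
    intro r x hx i hi
    refine hrad₁ r x ((hlift r x).symm.trans ?_) i hi
    change ((kernel.ι π).app r).hom (appHom (kernel.lift π d w) r x) = 0
    rw [hx, map_zero]
  have hmin : IsMinimalPresentation d π :=
    ⟨hrad.isProjectiveCover hπ, w, hrad'.isProjectiveCover hsurj⟩
  refine ⟨hmin, ⟨_, _, d, π, hmin⟩, ?_⟩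
  rintro C₁ C₀ d₁ d₀ ⟨hd₀, w', hd₁⟩
  obtain ⟨α, hα, hαπ⟩ := hrad.exists_isIso hπ hd₀
  let κ : kernel d₀ ≅ kernel π := kernel.mapIso d₀ π (asIso α) (Iso.refl M) (by simp [hαπ])
  exact (hrad'.isBettiZero hsurj).2 C₁ _ (hd₁.comp_isIso κ.hom)

end ProjectiveCovers

/-! ### Presentations of the homology of a graph -/

section GraphHomology

open freeModule

/-- The equivalence relation on the vertices that is generated by the edges in `S` of grade at most
`r`. -/
def Connected {V E Q : Type*} [LE Q] (src tgt : E → V) (f : E → Q) (S : E → Prop) (r : Q) :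
    V → V → Prop :=
  Relation.EqvGen fun a b => ∃ e, S e ∧ f e ≤ r ∧ src e = a ∧ tgt e = b

theorem Connected.mono {V E Q : Type*} [Preorder Q] {src tgt : E → V} {f : E → Q} {S : E → Prop}
    {r r' : Q} {a b : V} (h : Connected src tgt f S r a b) (hr : r ≤ r') :
    Connected src tgt f S r' a b :=
  Relation.EqvGen.mono (fun _ _ ⟨e, h1, h2, h3⟩ => ⟨e, h1, h2.trans hr, h3⟩) a b h

variable {k : Type v} [Field k] {P : Type u} [PartialOrder P] {I J V E : Type}

open Classical in
/-- The basis vector of `i` in the component of a free module at `r`, or `0` if `i` does not have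
grade at most `r`. -/
noncomputable def basisVector (k : Type v) [Field k] (g : I → P) (r : P) (i : I) :
    {i : I // g i ≤ r} →₀ k :=
  if h : g i ≤ r then Finsupp.single ⟨i, h⟩ 1 else 0

theorem basisVector_of_le {g : I → P} {r : P} {i : I} (h : g i ≤ r) :
    basisVector k g r i = Finsupp.single ⟨i, h⟩ 1 := dif_pos h

theorem basisVector_apply [DecidableEq I] (g : I → P) (r : P) (i : I) (i' : {i : I // g i ≤ r}) :
    basisVector k g r i i' = if i'.1 = i then 1 else 0 := by
  by_cases h : g i ≤ r
  · rw [basisVector_of_le h, Finsupp.single_apply]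
    simp [Subtype.ext_iff, eq_comm]
  · rw [basisVector, dif_neg h]
    have : i'.1 ≠ i := by rintro rfl; exact h i'.2
    simp [this]

theorem shift_basisVector {g : I → P} {r s : P} (h : r ≤ s) {i : I} (hi : g i ≤ r) :
    shift k g h (basisVector k g r i) = basisVector k g s i := by
  rw [basisVector_of_le hi, basisVector_of_le (hi.trans h), shift_single]

/-- Connected vertices are homologous. -/
theorem Connected.sub_mem_range {g : I → P} {f : J → P} {src tgt : J → I} {S : J → Prop} {r : P}
    (T : ({j : J // f j ≤ r} →₀ k) →ₗ[k] ({i : I // g i ≤ r} →₀ k))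
    (hT : ∀ j, T (Finsupp.single j 1) =
      basisVector k g r (tgt j.1) - basisVector k g r (src j.1)) {a b : I}
    (h : Connected src tgt f S r a b) :
    basisVector k g r b - basisVector k g r a ∈ LinearMap.range T := by
  induction h with
  | rel a b h =>
    obtain ⟨e, -, he, rfl, rfl⟩ := h
    exact ⟨_, hT ⟨e, he⟩⟩
  | refl a => rw [sub_self]; exact Submodule.zero_mem _
  | symm a b _ ih => rw [← neg_sub]; exact Submodule.neg_mem _ ih
  | trans a b c _ _ ih ih' =>
    have := Submodule.add_mem _ ih' ih
    rwa [sub_add_sub_cancel] at this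

namespace FilteredGraph

/-- The first endpoint of an edge. -/
abbrev fst {P : Type u} [PartialOrder P] (G : FilteredGraph P V E) (e : E) : V := (G.bd e).1

/-- The second endpoint of an edge. -/
abbrev snd {P : Type u} [PartialOrder P] (G : FilteredGraph P V E) (e : E) : V := (G.bd e).2

/-- The vertices `i` with the grades `g i` are representatives of the vertices of `G`: `q` maps a
vertex to its representative, which has a smaller or equal grade and lies in the same component
of the subgraph at the grade of the vertex; `ι` embeds the representatives into the vertices. An
edge between distinct representatives has a larger grade than both. -/
structure IsReduction (G : FilteredGraph P V E) (g : I → P) (q : V → I) (ι : I → V) : Prop where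
  grade : ∀ i, G.gV (ι i) = g i
  map_incl : ∀ i, q (ι i) = i
  le : ∀ v, g (q v) ≤ G.gV v
  connected : ∀ v, Connected G.fst G.snd G.gE (fun _ => True) (G.gV v) (ι (q v)) v
  edge : ∀ e, q (G.fst e) = q (G.snd e) ∨ (g (q (G.fst e)) < G.gE e ∧ g (q (G.snd e)) < G.gE e)

variable (k) in
/-- The homology class of a combination of vertices of grade at most `r`. -/
noncomputable def cls (G : FilteredGraph P V E) (r : P) :
    ({x : V // G.gV x ≤ r} →₀ k) →ₗ[k] (G.H0 k).obj r :=
  (LinearMap.range (G.boundary k r)).mkQ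

theorem cls_surjective (G : FilteredGraph P V E) (r : P) : Function.Surjective (G.cls k r) :=
  Submodule.mkQ_surjective _

theorem cls_eq_zero {G : FilteredGraph P V E} {r : P} {x : {x : V // G.gV x ≤ r} →₀ k} :
    G.cls k r x = 0 ↔ x ∈ LinearMap.range (G.boundary k r) :=
  Submodule.Quotient.mk_eq_zero _

theorem map_cls (G : FilteredGraph P V E) {r s : P} (h : r ≤ s) (x : {x : V // G.gV x ≤ r} →₀ k) :
    ((G.H0 k).map (homOfLE h)).hom (G.cls k r x) = G.cls k s (shift k G.gV h x) := rfl

theorem boundary_single (G : FilteredGraph P V E) {r : P} (e : {e : E // G.gE e ≤ r}) :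
    G.boundary k r (Finsupp.single e 1) =
      basisVector k G.gV r (G.snd e.1) - basisVector k G.gV r (G.fst e.1) := by
  rw [boundary, Finsupp.linearCombination_single, one_smul, basisVector_of_le, basisVector_of_le]

namespace IsReduction

variable {G : FilteredGraph P V E} {g : I → P} {q : V → I} {ι : I → V}

theorem cls_eq (h : G.IsReduction g q ι) {r : P} {v : V} (hv : G.gV v ≤ r) :
    G.cls k r (basisVector k G.gV r v) = G.cls k r (basisVector k G.gV r (ι (q v))) := by
  rw [← sub_eq_zero, ← map_sub, cls_eq_zero]
  exact ((h.connected v).mono hv).sub_mem_range _ G.boundary_single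

variable (k) in
/-- The morphism from the free module on the representatives to the homology of the graph. -/
noncomputable def cover (h : G.IsReduction g q ι) : freeModule k g ⟶ G.H0 k :=
  desc fun i => G.cls k (g i) (Finsupp.single ⟨ι i, (h.grade i).le⟩ 1)

variable (k) in
/-- The inclusion of the representatives of grade at most `r`. -/
noncomputable def incl (h : G.IsReduction g q ι) (r : P) :
    ({i : I // g i ≤ r} →₀ k) →ₗ[k] ({x : V // G.gV x ≤ r} →₀ k) :=
  Finsupp.lmapDomain k k fun i => ⟨ι i.1, (h.grade i.1).le.trans i.2⟩

variable (k) in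
/-- The map that replaces the vertices of grade at most `r` by their representatives. -/
noncomputable def proj (h : G.IsReduction g q ι) (r : P) :
    ({x : V // G.gV x ≤ r} →₀ k) →ₗ[k] ({i : I // g i ≤ r} →₀ k) :=
  Finsupp.lmapDomain k k fun x => ⟨q x.1, (h.le x.1).trans x.2⟩

theorem proj_incl (h : G.IsReduction g q ι) (r : P) (x : {i : I // g i ≤ r} →₀ k) :
    h.proj k r (h.incl k r x) = x := by
  induction x using Finsupp.induction_linear with
  | zero => simp
  | add a b ha hb => rw [map_add, map_add, ha, hb]
  | single i a => simp [proj, incl, Finsupp.mapDomain_single, h.map_incl]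

theorem proj_basisVector (h : G.IsReduction g q ι) {r : P} {v : V} (hv : G.gV v ≤ r) :
    h.proj k r (basisVector k G.gV r v) = basisVector k g r (q v) := by
  rw [basisVector_of_le hv, basisVector_of_le ((h.le v).trans hv)]
  simp [proj, Finsupp.mapDomain_single]

theorem incl_basisVector (h : G.IsReduction g q ι) {r : P} {i : I} (hi : g i ≤ r) :
    h.incl k r (basisVector k g r i) = basisVector k G.gV r (ι i) := by
  rw [basisVector_of_le hi, basisVector_of_le ((h.grade i).le.trans hi)]
  simp [incl, Finsupp.mapDomain_single]

theorem appHom_cover (h : G.IsReduction g q ι) (r : P) (x : {i : I // g i ≤ r} →₀ k) :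
    appHom (h.cover k) r x = G.cls k r (h.incl k r x) := by
  induction x using Finsupp.induction_linear with
  | zero => simp
  | add a b ha hb => rw [map_add, map_add, map_add, ha, hb]
  | single i a =>
    rw [cover, appHom_desc_single, map_cls, shift_single, ← map_smul, Finsupp.smul_single,
      smul_eq_mul, mul_one]
    simp [incl, Finsupp.mapDomain_single]

theorem cover_surjective (h : G.IsReduction g q ι) : IsSurjective (h.cover k) := by
  intro r y
  obtain ⟨x, rfl⟩ := G.cls_surjective r y
  change G.cls k r x ∈ LinearMap.range (appHom (h.cover k) r)
  induction x using Finsupp.induction_linear with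
  | zero => rw [map_zero]; exact Submodule.zero_mem _
  | add a b ha hb => rw [map_add]; exact Submodule.add_mem _ ha hb
  | single v a =>
    have hs : Finsupp.single v a = a • basisVector k G.gV r v.1 := by
      rw [basisVector_of_le v.2, Finsupp.smul_single, smul_eq_mul, mul_one]
    have hq := (h.le v.1).trans v.2
    refine ⟨a • basisVector k g r (q v.1), ?_⟩
    rw [hs, map_smul, map_smul, h.cls_eq v.2, appHom_cover, h.incl_basisVector hq]

/-- The kernel of the covering is spanned by the differences of the representatives of the
endpoints of edges. -/
theorem appHom_cover_eq_zero (h : G.IsReduction g q ι) {r : P} {x : {i : I // g i ≤ r} →₀ k} :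
    appHom (h.cover k) r x = 0 ↔ x ∈ Submodule.span k {y | ∃ e, G.gE e ≤ r ∧
      y = basisVector k g r (q (G.snd e)) - basisVector k g r (q (G.fst e))} := by
  rw [appHom_cover, cls_eq_zero]
  constructor
  · rintro ⟨c, hc⟩
    rw [← h.proj_incl r x, ← hc]
    clear hc
    induction c using Finsupp.induction_linear with
    | zero => rw [map_zero, map_zero]; exact Submodule.zero_mem _
    | add a b ha hb => rw [map_add, map_add]; exact Submodule.add_mem _ ha hb
    | single e a =>
      have hs : Finsupp.single e a = a • Finsupp.single e (1 : k) := by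
        rw [Finsupp.smul_single, smul_eq_mul, mul_one]
      rw [hs, map_smul, map_smul, boundary_single, map_sub,
        h.proj_basisVector ((G.fst_le _).trans e.2), h.proj_basisVector ((G.snd_le _).trans e.2)]
      exact Submodule.smul_mem _ _ (Submodule.subset_span ⟨e.1, e.2, rfl⟩)
  · intro hx
    induction hx using Submodule.span_induction with
    | zero => rw [map_zero]; exact Submodule.zero_mem _
    | add a b _ _ ha hb => rw [map_add]; exact Submodule.add_mem _ ha hb
    | smul a x _ hx => rw [map_smul]; exact Submodule.smul_mem _ _ hx
    | mem y hy =>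
      obtain ⟨e, he, rfl⟩ := hy
      have h0 := (G.fst_le e).trans he
      have h1 := (G.snd_le e).trans he
      rw [map_sub, h.incl_basisVector ((h.le _).trans h0), h.incl_basisVector ((h.le _).trans h1),
        ← cls_eq_zero, map_sub, ← h.cls_eq h0, ← h.cls_eq h1, ← map_sub, cls_eq_zero,
        ← G.boundary_single ⟨e, he⟩]
      exact LinearMap.mem_range_self _ _

theorem cover_hasRadicalKernel (h : G.IsReduction g q ι) : HasRadicalKernel (h.cover k) := by
  intro r x hx i hi
  rw [h.appHom_cover_eq_zero] at hx
  induction hx using Submodule.span_induction with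
  | zero => rfl
  | add a b _ _ ha hb => rw [Finsupp.add_apply, ha, hb, add_zero]
  | smul a x _ hx => rw [Finsupp.smul_apply, hx, smul_zero]
  | mem y hy =>
    obtain ⟨e, he, rfl⟩ := hy
    rcases h.edge e with h1 | ⟨h1, h2⟩
    · rw [h1, sub_self]; rfl
    · classical
      rw [Finsupp.sub_apply, basisVector_apply, basisVector_apply, if_neg, if_neg, sub_zero]
      · rintro rfl; exact (h1.trans_le he).ne hi
      · rintro rfl; exact (h2.trans_le he).ne hi

section Presentation

variable {g₁ : J → P} {src tgt : J → I}

/-- The morphism of free modules that maps the generator `j` to `tgt j - src j`. -/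
noncomputable def difference (k : Type v) [Field k] (g : I → P) (g₁ : J → P) (src tgt : J → I) :
    freeModule k g₁ ⟶ freeModule k g :=
  desc (M := freeModule k g) fun j =>
    (basisVector k g (g₁ j) (tgt j) - basisVector k g (g₁ j) (src j) : {i : I // g i ≤ g₁ j} →₀ k)

theorem component_difference (hs : ∀ j, g (src j) ≤ g₁ j) (ht : ∀ j, g (tgt j) ≤ g₁ j) {r : P}
    (j : {j : J // g₁ j ≤ r}) :
    component (difference k g g₁ src tgt) r (Finsupp.single j 1) =
      basisVector k g r (tgt j) - basisVector k g r (src j) := by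
  rw [← shift_basisVector j.2 (ht j.1), ← shift_basisVector j.2 (hs j.1), ← map_sub]
  refine (appHom_desc_single (M := freeModule k g) _ j 1).trans ?_
  rw [one_smul]
  rfl

theorem hasMatrix_difference [DecidableEq I] (hs : ∀ j, g (src j) ≤ g₁ j)
    (ht : ∀ j, g (tgt j) ≤ g₁ j) :
    HasMatrix (difference k g g₁ src tgt)
      (Matrix.of fun i j => (if i = tgt j then 1 else 0) - if i = src j then 1 else 0) := by
  refine fun i j => ⟨fun h => ?_, fun r hi hj => ?_⟩
  · by_cases h1 : i = tgt j
    · rw [h1]; exact ht j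
    · by_cases h2 : i = src j
      · rw [h2]; exact hs j
      · simp [h1, h2] at h
  · have := component_difference (k := k) hs ht ⟨j, hj⟩
    change (component (difference k g g₁ src tgt) r (Finsupp.single ⟨j, hj⟩ 1)) ⟨i, hi⟩ = _
    rw [this, Finsupp.sub_apply, basisVector_apply, basisVector_apply]
    rfl

open Classical in
/-- If no edge joins two vertices that the other edges of smaller or equal grade connect, the
boundaries of the edges of grade `r` are independent modulo those of the others. -/
theorem difference_hasRadicalKernel (hs : ∀ j, g (src j) ≤ g₁ j) (ht : ∀ j, g (tgt j) ≤ g₁ j)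
    (hind : ∀ j, ¬ Connected src tgt g₁ (· ≠ j) (g₁ j) (src j) (tgt j)) :
    HasRadicalKernel (difference k g g₁ src tgt) := by
  intro r x hx j hj
  let U : I → Prop := Connected src tgt g₁ (· ≠ j) (g₁ j) (src j)
  -- the sum of the coefficients of the vertices in the component `U` of `src j` without `j`
  let Λ : ({i : I // g i ≤ r} →₀ k) →ₗ[k] k :=
    Finsupp.linearCombination k fun i => if U i.1 then (1 : k) else 0
  have hΛ : ∀ i, g i ≤ r → Λ (basisVector k g r i) = if U i then 1 else 0 := by
    intro i hi
    rw [basisVector_of_le hi, Finsupp.linearCombination_single, one_smul]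
  have key : ∀ y : {j : J // g₁ j ≤ r} →₀ k,
      Λ (component (difference k g g₁ src tgt) r y) = - y ⟨j, hj.le⟩ := by
    intro y
    induction y using Finsupp.induction_linear with
    | zero => simp
    | add a b ha hb => rw [map_add, map_add, ha, hb, Finsupp.add_apply, neg_add]
    | single j' a =>
      have hs' : Finsupp.single j' a = a • Finsupp.single j' (1 : k) := by
        rw [Finsupp.smul_single, smul_eq_mul, mul_one]
      rw [hs', map_smul, map_smul, component_difference hs ht, map_sub,
        hΛ _ ((ht _).trans j'.2), hΛ _ ((hs _).trans j'.2), Finsupp.smul_apply,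
        Finsupp.single_apply]
      by_cases hjj : j' = ⟨j, hj.le⟩
      · subst hjj
        have h1 : U (src j) := .refl _
        have h2 : ¬ U (tgt j) := hind j
        simp [h1, h2]
      · have hne : j'.1 ≠ j := fun h => hjj (Subtype.ext h)
        have hrel : Connected src tgt g₁ (· ≠ j) (g₁ j) (src j') (tgt j') :=
          .rel _ _ ⟨j'.1, hne, j'.2.trans hj.ge, rfl, rfl⟩
        have hiff : U (tgt j') ↔ U (src j') :=
          ⟨fun h => .trans _ _ _ h (.symm _ _ hrel), fun h => .trans _ _ _ h hrel⟩
        simp [hiff, hjj]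
  have h0 := key x
  have hx' : component (difference k g g₁ src tgt) r x = 0 := hx
  rw [hx', map_zero] at h0
  exact neg_eq_zero.1 h0.symm

end Presentation

/-- The representatives together with a minimal set of edges with the same components at every
grade give a minimal presentation of the homology. -/
theorem minimalPresentation {a b : ℕ} {g : Fin a → P} {q : V → Fin a} {ι : Fin a → V}
    (h : G.IsReduction g q ι) (τ : Fin b → E)
    (hspan : ∀ e, Connected (fun j => q (G.fst (τ j))) (fun j => q (G.snd (τ j)))
      (fun j => G.gE (τ j)) (fun _ => True) (G.gE e) (q (G.fst e)) (q (G.snd e)))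
    (hind : ∀ j, ¬ Connected (fun j => q (G.fst (τ j))) (fun j => q (G.snd (τ j)))
      (fun j => G.gE (τ j)) (· ≠ j) (G.gE (τ j)) (q (G.fst (τ j))) (q (G.snd (τ j)))) :
    IsMinimalPresentation (difference k g (fun j => G.gE (τ j)) (fun j => q (G.fst (τ j)))
      fun j => q (G.snd (τ j))) (h.cover k) ∧
    IsBettiOne (G.H0 k) (gradeCount fun j => G.gE (τ j)) := by
  have hs : ∀ j, g (q (G.fst (τ j))) ≤ G.gE (τ j) := fun j => (h.le _).trans (G.fst_le _)
  have ht : ∀ j, g (q (G.snd (τ j))) ≤ G.gE (τ j) := fun j => (h.le _).trans (G.snd_le _)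
  refine h.cover_hasRadicalKernel.minimalPresentation h.cover_surjective
    (difference_hasRadicalKernel hs ht hind) fun r x => ?_
  rw [h.appHom_cover_eq_zero]
  change _ ↔ x ∈ LinearMap.range (component _ r)
  constructor
  · intro hx
    refine (Submodule.span_le.2 ?_) hx
    rintro _ ⟨e, he, rfl⟩
    exact ((hspan e).mono he).sub_mem_range _ fun j => component_difference hs ht j
  · rintro ⟨y, rfl⟩
    induction y using Finsupp.induction_linear with
    | zero => rw [map_zero]; exact Submodule.zero_mem _
    | add a b ha hb => rw [map_add]; exact Submodule.add_mem _ ha hb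
    | single j c =>
      have hs' : Finsupp.single j c = c • Finsupp.single j (1 : k) := by
        rw [Finsupp.smul_single, smul_eq_mul, mul_one]
      rw [hs', map_smul, component_difference hs ht]
      exact Submodule.smul_mem _ _ (Submodule.subset_span ⟨_, j.2, rfl⟩)

end IsReduction

end FilteredGraph

end GraphHomology

/-! ### From lists to modules -/

theorem eqvGen_map {α β : Type*} {r : α → α → Prop} {s : β → β → Prop} (f : α → β)
    (h : ∀ a b, r a b → s (f a) (f b)) {a b : α} (hab : Relation.EqvGen r a b) :
    Relation.EqvGen s (f a) (f b) := by
  induction hab with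
  | rel a b hab => exact .rel _ _ (h a b hab)
  | refl a => exact .refl _
  | symm a b _ ih => exact .symm _ _ ih
  | trans a b c _ _ ih ih' => exact .trans _ _ _ ih ih'

namespace RAM

section Interpretation

variable {P : Type u}

theorem gradeAt_ofFn {l : ℕ} (f : Fin l → P) (i : Fin l) : gradeAt (List.ofFn f) i = f i := by
  rw [gradeAt_of_lt (by simp)]
  simp

variable [PartialOrder P] {V E : Type} {n m : ℕ}

section

variable (G : FilteredGraph P V E) (eV : Fin n ≃ V) (eE : Fin m ≃ E)

theorem inputState_src (e : E) :
    (inputState G eV eE).arr .src (eE.symm e) = eV.symm (G.fst e) := by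
  simp [inputState]

theorem inputState_tgt (e : E) :
    (inputState G eV eE).arr .tgt (eE.symm e) = eV.symm (G.snd e) := by
  simp [inputState]

/-- The graph `G` with its vertices and edges replaced by their numbers. -/
def listedGraph : ListedGraph P where
  LV := List.ofFn fun i => G.gV (eV i)
  LE := List.ofFn fun i => G.gE (eE i)
  src := (inputState G eV eE).arr .src
  tgt := (inputState G eV eE).arr .tgt
  src_lt e he := by
    obtain ⟨e, rfl⟩ : ∃ e', e = eE.symm e' := ⟨eE ⟨e, by simpa using he⟩, by simp⟩
    rw [inputState_src]; simp
  tgt_lt e he := by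
    obtain ⟨e, rfl⟩ : ∃ e', e = eE.symm e' := ⟨eE ⟨e, by simpa using he⟩, by simp⟩
    rw [inputState_tgt]; simp
  src_le e he := by
    obtain ⟨e, rfl⟩ : ∃ e', e = eE.symm e' := ⟨eE ⟨e, by simpa using he⟩, by simp⟩
    rw [inputState_src, gradeAt_ofFn, gradeAt_ofFn]
    simpa using G.fst_le e
  tgt_le e he := by
    obtain ⟨e, rfl⟩ : ∃ e', e = eE.symm e' := ⟨eE ⟨e, by simpa using he⟩, by simp⟩
    rw [inputState_tgt, gradeAt_ofFn, gradeAt_ofFn]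
    simpa using G.snd_le e

theorem listedGraph_n : (listedGraph G eV eE).n = n := List.length_ofFn

theorem listedGraph_m : (listedGraph G eV eE).m = m := List.length_ofFn

theorem listedGraph_src (e : E) :
    (listedGraph G eV eE).src (eE.symm e) = eV.symm (G.fst e) := inputState_src G eV eE e

theorem listedGraph_tgt (e : E) :
    (listedGraph G eV eE).tgt (eE.symm e) = eV.symm (G.snd e) := inputState_tgt G eV eE e

theorem listedGraph_fV (x : V) : (listedGraph G eV eE).fV (eV.symm x) = G.gV x := by
  simp [listedGraph, ListedGraph.fV, gradeAt_ofFn]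

theorem listedGraph_fE (e : E) : (listedGraph G eV eE).fE (eE.symm e) = G.gE e := by
  simp [listedGraph, ListedGraph.fE, gradeAt_ofFn]

theorem symm_lt_listedGraph_n (x : V) : (eV.symm x : ℕ) < (listedGraph G eV eE).n := by
  rw [listedGraph_n]; exact (eV.symm x).2

theorem symm_lt_listedGraph_m (e : E) : (eE.symm e : ℕ) < (listedGraph G eV eE).m := by
  rw [listedGraph_m]; exact (eE.symm e).2

theorem holdsInput_inputState : HoldsInput (listedGraph G eV eE) (inputState G eV eE) :=
  ⟨(listedGraph_n G eV eE).symm, (listedGraph_m G eV eE).symm, rfl, rfl, rfl, rfl⟩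

end

variable {G : FilteredGraph P V E} {eV : Fin n ≃ V} {eE : Fin m ≃ E}

theorem exists_symm_eq_of_lt_n {u : ℕ} (hu : u < (listedGraph G eV eE).n) :
    ∃ x, u = eV.symm x :=
  ⟨eV ⟨u, by rwa [listedGraph_n] at hu⟩, by simp⟩

theorem exists_symm_eq_of_lt_m {e : ℕ} (he : e < (listedGraph G eV eE).m) :
    ∃ x, e = eE.symm x :=
  ⟨eE ⟨e, by rwa [listedGraph_m] at he⟩, by simp⟩

/-- A function on vertices extends to all natural numbers; the value outside the range of the
numbering is irrelevant, as the relation `Linked` does not leave it except for reflexivity. -/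
theorem exists_extension (eV : Fin n ≃ V) {I : Type} (i₀ : I) (f : V → I) :
    ∃ ψ : ℕ → I, ∀ x, ψ (eV.symm x) = f x := by
  refine ⟨fun u => if h : u < n then f (eV ⟨u, h⟩) else i₀, fun x => ?_⟩
  simp

variable {φ : ℕ → ℕ} {vs es : List ℕ}

/-- `q` and `ι` are the passage from a vertex to the position of its representative in `vs`,
and from a position in `vs` to the vertex there. -/
theorem exists_isReduction (hφ : IsVertexMinimal (listedGraph G eV eE) φ)
    (hvs : IsRepresentativeList (listedGraph G eV eE) φ vs) :
    ∃ (q : V → Fin (vs.filterMap ((listedGraph G eV eE).LV[·]?)).length)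
      (ι : Fin (vs.filterMap ((listedGraph G eV eE).LV[·]?)).length → V),
      G.IsReduction (vs.filterMap ((listedGraph G eV eE).LV[·]?)).get q ι ∧
      ∀ x, vs[(q x).val]? = some (φ (eV.symm x)) := by
  have hlt : ∀ u ∈ vs, u < (listedGraph G eV eE).n := fun u hu => ((hvs.mem u).1 hu).1
  have hlen := length_filterMap_getElem? (listedGraph G eV eE).LV hlt
  have hq : ∀ x : V, ∃ i : Fin (vs.filterMap ((listedGraph G eV eE).LV[·]?)).length,
      vs[i.val]? = some (φ (eV.symm x)) := by
    intro x
    have hx := symm_lt_listedGraph_n G eV eE x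
    obtain ⟨i, hi, h⟩ := List.getElem_of_mem
      ((hvs.mem (φ (eV.symm x))).2 ⟨hφ.map_lt _ hx, hφ.map_map _ hx⟩)
    exact ⟨⟨i, by rwa [hlen]⟩, by simp [h, hi]⟩
  have hι : ∀ i : Fin (vs.filterMap ((listedGraph G eV eE).LV[·]?)).length,
      ∃ x : V, vs[i.val]? = some (eV.symm x : ℕ) := by
    intro i
    have hi : i.val < vs.length := by rw [← hlen]; exact i.2
    obtain ⟨x, hx⟩ := exists_symm_eq_of_lt_n (hlt _ (List.getElem_mem hi))
    exact ⟨x, by rw [List.getElem?_eq_getElem hi, hx]⟩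
  choose q hq using hq
  choose ι hι using hι
  have hrep : ∀ i, φ (eV.symm (ι i)) = eV.symm (ι i) := fun i =>
    ((hvs.mem _).1 (List.mem_of_getElem? (hι i))).2
  have hφι : ∀ x, φ (eV.symm x) = eV.symm (ι (q x)) := fun x => by
    have := (hq x).symm.trans (hι (q x))
    simpa using this
  have hgrade : ∀ i, G.gV (ι i) = (vs.filterMap ((listedGraph G eV eE).LV[·]?)).get i := by
    intro i
    have hi : i.val < vs.length := by rw [← hlen]; exact i.2
    have h1 := getElem_filterMap_getElem? (listedGraph G eV eE).LV hlt i.val hi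
    have h2 : vs[i.val] = (eV.symm (ι i) : ℕ) := by
      have := hι i
      rwa [List.getElem?_eq_getElem hi, Option.some_inj] at this
    have h3 := listedGraph_fV G eV eE (ι i)
    rw [ListedGraph.fV, gradeAt_of_lt (symm_lt_listedGraph_n G eV eE _), WithBot.coe_inj] at h3
    rw [h2, List.getElem?_eq_getElem (symm_lt_listedGraph_n G eV eE _), h3,
      List.getElem?_eq_getElem i.2, Option.some_inj] at h1
    exact h1.symm
  have hgq : ∀ x, (((vs.filterMap ((listedGraph G eV eE).LV[·]?)).get (q x) : P) : WithBot P) =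
      (listedGraph G eV eE).fV (φ (eV.symm x)) := by
    intro x
    rw [hφι, listedGraph_fV, hgrade]
  refine ⟨q, ι, ⟨hgrade, fun i => ?_, fun x => ?_, fun x => ?_, fun e => ?_⟩, hq⟩
  · have hi : i.val < vs.length := by rw [← hlen]; exact i.2
    have := (hq (ι i)).trans ((congrArg some (hrep i)).trans (hι i).symm)
    exact Fin.ext ((List.getElem?_inj hi hvs.nodup).1 this.symm).symm
  · rw [← WithBot.coe_le_coe, hgq, ← listedGraph_fV G eV eE]
    exact hφ.grade_le _ (symm_lt_listedGraph_n G eV eE x)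
  · obtain ⟨ψ, hψ⟩ := exists_extension eV x id
    have := hφ.linked _ (symm_lt_listedGraph_n G eV eE x)
    have h := eqvGen_map (s := fun a b => ∃ e, True ∧ G.gE e ≤ G.gV x ∧ G.fst e = a ∧ G.snd e = b)
      ψ ?_ this
    · rwa [hφι, hψ, hψ] at h
    · rintro _ _ ⟨e, he, -, hle, rfl, rfl⟩
      obtain ⟨e, rfl⟩ := exists_symm_eq_of_lt_m he
      rw [listedGraph_fE, listedGraph_fV, WithBot.coe_le_coe] at hle
      exact ⟨e, trivial, hle, by rw [listedGraph_src, hψ]; rfl, by rw [listedGraph_tgt, hψ]; rfl⟩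
  · have := hφ.edge _ (symm_lt_listedGraph_m G eV eE e)
    rw [listedGraph_src, listedGraph_tgt, listedGraph_fE, ← hgq, ← hgq, WithBot.coe_lt_coe,
      WithBot.coe_lt_coe] at this
    refine this.imp_left fun h => Fin.ext ?_
    have hi : (q (G.fst e)).val < vs.length := by rw [← hlen]; exact (q _).2
    exact (List.getElem?_inj hi hvs.nodup).1 (by rw [hq, hq, h])


/-- `τ` enumerates the edges of `G` whose numbers are in the list `es`. -/
theorem exists_edgeList (hlt : ∀ e ∈ es, e < (listedGraph G eV eE).m) :
    ∃ τ : Fin (es.filterMap ((listedGraph G eV eE).LE[·]?)).length → E,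
      es.zipIdx = (List.finRange _).map (fun j => ((eE.symm (τ j) : ℕ), j.val)) ∧
      (fun j => G.gE (τ j)) = (es.filterMap ((listedGraph G eV eE).LE[·]?)).get := by
  have hlen := length_filterMap_getElem? (listedGraph G eV eE).LE hlt
  have hτ : ∀ j : Fin (es.filterMap ((listedGraph G eV eE).LE[·]?)).length,
      ∃ x : E, es[j.val]'(hlen ▸ j.2) = (eE.symm x : ℕ) := fun j =>
    exists_symm_eq_of_lt_m (hlt _ (List.getElem_mem _))
  choose τ hτ using hτ
  refine ⟨τ, List.ext_getElem (by simp [hlen]) fun i h1 h2 => ?_, funext fun j => ?_⟩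
  · simp only [List.getElem_zipIdx, List.getElem_map, List.getElem_finRange, Fin.val_cast,
      Nat.zero_add, Prod.mk.injEq]
    exact ⟨hτ ⟨i, by simpa using h2⟩, trivial⟩
  · have hj : j.val < es.length := by rw [← hlen]; exact j.2
    have h1 := getElem_filterMap_getElem? (listedGraph G eV eE).LE hlt j.val hj
    have h3 := listedGraph_fE G eV eE (τ j)
    rw [ListedGraph.fE, gradeAt_of_lt (symm_lt_listedGraph_m G eV eE _), WithBot.coe_inj] at h3
    rw [hτ, List.getElem?_eq_getElem (symm_lt_listedGraph_m G eV eE _), h3,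
      List.getElem?_eq_getElem j.2, Option.some_inj] at h1
    exact h1.symm

/-- The two entries of each column lie in different rows, as the edges are not loops. -/
theorem isCoordinateFormat_flatMap (k : Type v) [Field k] {a b : ℕ} {src tgt : Fin b → Fin a}
    (hne : ∀ j, src j ≠ tgt j) :
    IsCoordinateFormat
      ((List.finRange b).flatMap fun j =>
        [((src j).val + 1, j.val + 1, (-1 : ℤ)), ((tgt j).val + 1, j.val + 1, 1)])
      (Matrix.of fun i j => (if i = tgt j then (1 : k) else 0) - if i = src j then 1 else 0) := by
  refine ⟨?_, fun t ht => ?_, fun i j hA => ?_⟩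
  · rw [List.map_flatMap, List.nodup_flatMap]
    refine ⟨fun j _ => ?_, (List.nodup_finRange b).imp fun {j j'} hj => ?_⟩
    · simp [Fin.val_inj, hne]
    · simp [Function.onFun, List.Disjoint, Fin.val_inj, hj]
  · obtain ⟨j, -, hj⟩ := List.mem_flatMap.1 ht
    simp only [List.mem_cons, List.not_mem_nil, or_false] at hj
    rcases hj with rfl | rfl
    · exact ⟨src j, j, rfl, rfl, by simp [hne j]⟩
    · exact ⟨tgt j, j, rfl, rfl, by simp [(hne j).symm]⟩
  · simp only [List.mem_flatMap, List.mem_finRange, true_and]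
    by_cases h1 : i = tgt j
    · exact ⟨1, j, by simp [h1]⟩
    · by_cases h2 : i = src j
      · exact ⟨-1, j, by simp [h2]⟩
      · simp [h1, h2] at hA

/-- The difference morphism of the remaining edges has the matrix that the machine writes. -/
theorem encodesMinimalPresentation (hφ : IsVertexMinimal (listedGraph G eV eE) φ)
    (hvs : IsRepresentativeList (listedGraph G eV eE) φ vs)
    (hes : IsEdgeMinimal (listedGraph G eV eE) φ es) {row : ℕ → ℕ}
    (hrow : ∀ (i : ℕ) (hi : i < vs.length), row vs[i] = i + 1) (k : Type v) [Field k] :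
    EncodesMinimalPresentation (G.H0 k) (vs.filterMap ((listedGraph G eV eE).LV[·]?))
      (es.filterMap ((listedGraph G eV eE).LE[·]?))
      (matrixTriples (listedGraph G eV eE) φ row es) ∧
    IsBettiOne (G.H0 k) (gradeCount (es.filterMap ((listedGraph G eV eE).LE[·]?)).get) := by
  obtain ⟨q, ι, hred, hq⟩ := exists_isReduction hφ hvs
  obtain ⟨τ, hzip, hτ⟩ := exists_edgeList (eV := eV) (G := G) hes.lt
  have hmem : ∀ e, e ∈ es ↔ ∃ j, e = (eE.symm (τ j) : ℕ) := by
    intro e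
    have h : e ∈ es ↔ e ∈ es.zipIdx.map Prod.fst := by rw [List.zipIdx_map_fst]
    rw [h, hzip]
    simp [eq_comm]
  have hinj : Function.Injective τ := by
    have : (es.zipIdx.map Prod.fst).Nodup := by simpa using hes.nodup
    rw [hzip, List.map_map] at this
    have := List.inj_on_of_nodup_map this
    intro j j' hj
    exact this (by simp) (by simp) (by simp [hj])
  have hrowq : ∀ x, row (φ (eV.symm x)) = (q x).val + 1 := by
    intro x
    obtain ⟨hi, h⟩ := List.getElem?_eq_some_iff.1 (hq x)
    rw [← h, hrow]
  have hspan : ∀ e, Connected (fun j => q (G.fst (τ j))) (fun j => q (G.snd (τ j)))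
      (fun j => G.gE (τ j)) (fun _ => True) (G.gE e) (q (G.fst e)) (q (G.snd e)) := by
    intro e
    obtain ⟨ψ, hψ⟩ := exists_extension eV (q (G.fst e)) q
    have hψφ : ∀ x, ψ (φ (eV.symm x)) = q x := by
      intro x
      have hx := symm_lt_listedGraph_n G eV eE x
      obtain ⟨y, hy⟩ := exists_symm_eq_of_lt_n (hφ.map_lt _ hx)
      rw [hy, hψ]
      refine Fin.ext ((List.getElem?_inj (List.getElem?_eq_some_iff.1 (hq y)).1 hvs.nodup).1 ?_)
      rw [hq, hq, ← hy, hφ.map_map _ hx]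
    have h := eqvGen_map (s := fun a b => ∃ j, True ∧ G.gE (τ j) ≤ G.gE e ∧
      q (G.fst (τ j)) = a ∧ q (G.snd (τ j)) = b) ψ ?_
      (hes.linked _ (symm_lt_listedGraph_m G eV eE e))
    · rwa [listedGraph_src, listedGraph_tgt, hψφ, hψφ] at h
    · rintro _ _ ⟨d, hd, hdes, hle, rfl, rfl⟩
      obtain ⟨j, rfl⟩ := (hmem d).1 hdes
      rw [listedGraph_fE, listedGraph_fE, WithBot.coe_le_coe] at hle
      exact ⟨j, trivial, hle, by simp [listedGraph_src, hψφ], by simp [listedGraph_tgt, hψφ]⟩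
  have hind : ∀ j, ¬ Connected (fun j => q (G.fst (τ j))) (fun j => q (G.snd (τ j)))
      (fun j => G.gE (τ j)) (· ≠ j) (G.gE (τ j)) (q (G.fst (τ j))) (q (G.snd (τ j))) := by
    intro j hj
    refine hes.not_linked _ ((hmem _).2 ⟨j, rfl⟩) ?_
    have h := eqvGen_map (s := fun a b => ∃ d < (listedGraph G eV eE).m,
      (d ∈ es ∧ d ≠ eE.symm (τ j)) ∧
      (listedGraph G eV eE).fE d ≤ (listedGraph G eV eE).fE (eE.symm (τ j)) ∧
      φ ((listedGraph G eV eE).src d) = a ∧ φ ((listedGraph G eV eE).tgt d) = b)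
      (fun i => (vs[i.val]?).getD 0) ?_ hj
    · rw [listedGraph_src, listedGraph_tgt]
      simp only [hq, Option.getD_some] at h
      exact h
    · rintro _ _ ⟨j', hne, hle, rfl, rfl⟩
      refine ⟨eE.symm (τ j'), symm_lt_listedGraph_m G eV eE _, ⟨(hmem _).2 ⟨j', rfl⟩, ?_⟩, ?_, ?_,
        ?_⟩
      · simpa [Fin.val_inj] using hinj.ne hne
      · rwa [listedGraph_fE, listedGraph_fE, WithBot.coe_le_coe]
      · simp [listedGraph_src, hq]
      · simp [listedGraph_tgt, hq]
  have hne : ∀ j, q (G.fst (τ j)) ≠ q (G.snd (τ j)) := fun j h => hind j (h ▸ .refl _)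
  have htriples : matrixTriples (listedGraph G eV eE) φ row es =
      (List.finRange _).flatMap fun j =>
        [((q (G.fst (τ j))).val + 1, j.val + 1, (-1 : ℤ)),
          ((q (G.snd (τ j))).val + 1, j.val + 1, 1)] := by
    rw [matrixTriples, hzip, List.flatMap_map]
    simp only [listedGraph_src, listedGraph_tgt, hrowq]
  obtain ⟨h₁, h₂⟩ := hred.minimalPresentation (k := k) τ hspan hind
  have hmat := FilteredGraph.IsReduction.hasMatrix_difference (k := k)
    (fun j => (hred.le (G.fst (τ j))).trans (G.fst_le _))
    (fun j => (hred.le (G.snd (τ j))).trans (G.snd_le _))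
  rw [htriples]
  rw [hτ] at h₁ h₂ hmat
  exact ⟨⟨_, _, _, isCoordinateFormat_flatMap k hne, hmat, h₁⟩, h₂⟩

theorem isBettiZero_of_isVertexMinimal (hφ : IsVertexMinimal (listedGraph G eV eE) φ)
    (hvs : IsRepresentativeList (listedGraph G eV eE) φ vs) (k : Type v) [Field k] :
    IsBettiZero (G.H0 k) (gradeCount (vs.filterMap ((listedGraph G eV eE).LV[·]?)).get) := by
  obtain ⟨q, ι, hred, -⟩ := exists_isReduction hφ hvs
  exact (hred.cover_hasRadicalKernel (k := k)).isBettiZero hred.cover_surjective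

end Interpretation

end RAM

/-- There is one constant `c` such that, for every poset `P`, every finite `P`-filtered graph `G`
and every listing of its vertices and edges, the algorithm that collapses `G` to a
vertex-minimal graph halts within `c (|G| + 1)` steps and its
output is the zeroth Betti table of `H₀(G; k)`, and the minimal presentation algorithm halts within `c (|G| + 1)²` steps
and its output is a minimal presentation of `H₀(G; k)`, whose two lists of grades are the zeroth
and the first Betti table of `H₀(G; k)`, over every field `k`. -/
theorem theoremA :
    ∃ c : ℕ, ∀ (P : Type u) [PartialOrder P] (V E : Type) (G : FilteredGraph P V E)
      (n m : ℕ) (eV : Fin n ≃ V) (eE : Fin m ≃ E),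
      (∃ (s : RAM.State P) (t : ℕ),
        RAM.Exec RAM.vertexCollapse (RAM.inputState G eV eE) s t ∧
        t ≤ c * (G.size + 1) ∧
        ∀ (k : Type v) [Field k],
          IsBettiZero (G.H0 k) (gradeCount (s.grades .reducedBeta).get)) ∧
      (∃ (s : RAM.State P) (t : ℕ),
        RAM.Exec RAM.presentation (RAM.inputState G eV eE) s t ∧
        t ≤ c * (G.size + 1) ^ 2 ∧
        ∀ (k : Type v) [Field k],
          EncodesMinimalPresentation (G.H0 k) (s.grades .beta0) (s.grades .beta1) s.triples ∧
          IsBettiZero (G.H0 k) (gradeCount (s.grades .beta0).get) ∧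
          IsBettiOne (G.H0 k) (gradeCount (s.grades .beta1).get)) := by
  refine ⟨7000, fun P _ V E G n m eV eE => ?_⟩
  have hsize : G.size = n + m := by
    rw [FilteredGraph.size, ← Nat.card_congr eV, ← Nat.card_congr eE, Nat.card_fin, Nat.card_fin]
  have hin := RAM.holdsInput_inputState G eV eE
  rw [hsize]
  constructor
  · obtain ⟨s, t, hex, ht, φ, hφ, hmin, hβ⟩ := RAM.runs_vertexCollapse hin
    rw [RAM.listedGraph_n, RAM.listedGraph_m] at ht
    refine ⟨s, t, hex, by omega, fun k _ => ?_⟩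
    rw [hβ]
    exact RAM.isBettiZero_of_isVertexMinimal (hφ.isVertexMinimal hmin) hφ.isRepresentativeList k
  · obtain ⟨s, t, hex, ht, φ, vs, es, row, hφ, hvs, hes, hrow, hβ₀, hβ₁, htr⟩ :=
      RAM.runs_presentation hin
    rw [RAM.listedGraph_n, RAM.listedGraph_m] at ht
    refine ⟨s, t, hex, ht, fun k _ => ?_⟩
    rw [hβ₀, hβ₁, htr]
    obtain ⟨h₁, h₂⟩ := RAM.encodesMinimalPresentation hφ hvs hes hrow k
    exact ⟨h₁, RAM.isBettiZero_of_isVertexMinimal hφ hvs k, h₂⟩
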